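/- Let $F$ be a complete discrete valuation field whose residue field $k$ is an arbitrary (possibly imperfect) field of characteristic $p>0$ with $\wp(k)\neq k$, where $\wp(a)=a^p-a$. Let $L/F$ be a cyclic totally ramified $p$-extension, i.e. a finite Galois extension with cyclic Galois group of $p$-power order and with $e(L|F)=[L:F]$. Fix a separable closure of $F$ containing $L$, let $\tilde F$ be the maximal abelian unramified $p$-extension of $F$ in it (the compositum of all finite abelian unramified $p$-extensions of $F$), and put $\tilde L=L\tilde F$. For an algebraic extension $E/F$ write $U_E$ for the group of units of its ring of integers and $U_{1,E}$ for the group of units congruent to $1$ modulo the maximal ideal. Put $$\mathrm{Gal}(L/F)^\sim=\mathrm{Hom}_{\mathrm{cont}}(\mathrm{Gal}(\tilde F/F),\mathrm{Gal}(L/F)),$$ and for $\chi\in\mathrm{Gal}(L/F)^\sim$ let $\Sigma_\chi$ be the field of those $\alpha\in\tilde L$ which, for every $\varphi\in\mathrm{Gal}(\tilde F/F)$, are fixed by the automorphism of $\tilde L/F$ that restricts to $\varphi$ on $\tilde F$ and to $\chi(\varphi)$ on $L$. Then there is exactly one map $$\Upsilon_{L/F}:\mathrm{Gal}(L/F)^\sim\longrightarrow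 (U_{1,F}\cap N_{\tilde L/\tilde F}U_{1,\tilde L})/N_{L/F}U_{1,L}$$ such that, for every $\chi$ and every choice of prime elements $\pi_\chi$ of $\Sigma_\chi$ and $\pi_L$ of $L$, the class $\Upsilon_{L/F}(\chi)$ consists of exactly those $y\in U_{1,F}\cap N_{\tilde L/\tilde F}U_{1,\tilde L}$ with $$y\equiv N_{\Sigma_\chi/F}\pi_\chi\,/\,N_{L/F}\pi_L \pmod{N_{L/F}U_L},$$ and $\Upsilon_{L/F}$ is an isomorphism of groups. -/

import Mathlib

open IsLocalRing

namespace LocalReciprocity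

noncomputable section

section Integers

variable (A E : Type*) [CommRing A] [Field E] [Algebra A E]

/-- The maximal ideal of the ring of integers of `E`. Here `A` is a complete discrete valuation
ring and `E` is an algebraic extension of its fraction field, so that the ring of integers of `E`
(the valuation ring of the unique extension of the valuation) is the integral closure of `A` in
`E`; it is a local ring, and its Jacobson radical is its maximal ideal. -/
def maxIdeal : Ideal (integralClosure A E) := Ideal.jacobson ⊥

/-- The group of units `U_E` of the ring of integers of `E`, as a subgroup of `Eˣ`. -/
def unitGroup : Subgroup Eˣ :=
  (Units.map ((integralClosure A E).val : integralClosure A E →* E)).range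

/-- The group `U_{1,E} = 1 + 𝔪_E` of principal units of `E`, as a subgroup of `Eˣ`: the image of
the kernel of the reduction map on the units of the ring of integers. -/
def principalUnits : Subgroup Eˣ :=
  (Units.map (Ideal.Quotient.mk (maxIdeal A E) :
      integralClosure A E →* integralClosure A E ⧸ maxIdeal A E)).ker.map
    (Units.map ((integralClosure A E).val : integralClosure A E →* E))

/-- `π` is a prime element of `E`. -/
def IsPrimeElement (π : Eˣ) : Prop :=
  ∃ ϖ : integralClosure A E, (ϖ : E) = π ∧ Irreducible ϖ

end Integers

section Extensions

variable (A : Type*) [CommRing A] [IsLocalRing A] (F : Type*) [Field F] [Algebra A F]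
  (E : Type*) [Field E] [Algebra A E] [Algebra F E]

/-- The extension `E/F` (of finite degree) is totally ramified: `e(E|F) = [E : F]`. -/
def IsTotallyRamified : Prop :=
  (maximalIdeal A).map (algebraMap A (integralClosure A E)) =
    maxIdeal A E ^ Module.finrank F E

/-- `E/F` is a finite abelian unramified `p`-extension. Unramified means that the ramification
index is `1` and that the extension of residue fields is separable, which amounts to the ring of
integers of `E` being unramified over `A`. -/
structure IsFiniteAbelianUnramified (p : ℕ) : Prop where
  finiteDimensional : FiniteDimensional F E
  isAbelianGalois : IsAbelianGalois F E
  isPGroup : IsPGroup p Gal(E/F)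
  formallyUnramified : Algebra.FormallyUnramified A (integralClosure A E)

end Extensions

section Reciprocity

variable (p : ℕ) (A : Type*) [CommRing A] [IsLocalRing A]
  {F : Type*} [Field F] [Algebra A F]
  {Ω : Type*} [Field Ω] [Algebra F Ω] [Algebra A Ω] [IsScalarTower A F Ω]

variable (F Ω) in
/-- The maximal abelian unramified `p`-extension `F̃` of `F` in `Ω`: the compositum of all finite
abelian unramified `p`-extensions of `F` in `Ω`. -/
def maxAbUnram : IntermediateField F Ω :=
  ⨆ E : {E : IntermediateField F Ω // IsFiniteAbelianUnramified A F E p}, E.1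

instance : Normal F (maxAbUnram p A F Ω) :=
  IntermediateField.normal_iSup (h := fun E => E.2.isAbelianGalois.toIsGalois.to_normal)

variable (L : IntermediateField F Ω)

instance : IsScalarTower A (maxAbUnram p A F Ω) Ω :=
  IsScalarTower.of_algebraMap_eq fun _ => rfl

/-- `L̃ = L F̃`, viewed as an extension of `F̃`. -/
def tildeExt : IntermediateField (maxAbUnram p A F Ω) Ω :=
  IntermediateField.extendScalars (F := maxAbUnram p A F Ω) (E := L ⊔ maxAbUnram p A F Ω)
    le_sup_right

/-- `Gal(L/F)^∼`: continuous homomorphisms `Gal(F̃/F) → Gal(L/F)` for the Krull topologies. -/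
abbrev GalTilde : Type _ := Gal(maxAbUnram p A F Ω/F) →ₜ* Gal(L/F)

/-- For `Gal(L/F)` commutative, `Gal(L/F)^∼` is a group under pointwise multiplication. -/
instance [IsMulCommutative Gal(L/F)] : CommGroup (GalTilde p A L) :=
  letI : CommGroup Gal(L/F) :=
    { (inferInstance : Group Gal(L/F)) with mul_comm := mul_comm' }
  inferInstanceAs (CommGroup (Gal(maxAbUnram p A F Ω/F) →ₜ* Gal(L/F)))

variable {p A L} in
/-- The automorphisms `τ` of `Ω/F` which restrict to `φ χ(φ)` on `L̃` for some `φ ∈ Gal(F̃/F)`,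
i.e. such that `τ` restricts to some `φ` on `F̃` and to `χ(φ)` on `L`. -/
def twistedGroup [Normal F L] [Normal F Ω] (χ : GalTilde p A L) : Subgroup Gal(Ω/F) :=
  (χ.toMonoidHom.comp (AlgEquiv.restrictNormalHom (maxAbUnram p A F Ω))).eqLocus
    (AlgEquiv.restrictNormalHom L)

variable {p A L} in
/-- `Σ_χ`: the elements of `L̃` fixed by `φ χ(φ)` for all `φ ∈ Gal(F̃/F)`. -/
def twistedField [Normal F L] [Normal F Ω] (χ : GalTilde p A L) : IntermediateField F Ω :=
  (L ⊔ maxAbUnram p A F Ω) ⊓ IntermediateField.fixedField (twistedGroup χ)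

/-- The norm group `N_{L/F} U_L`. -/
def normUnits : Subgroup Fˣ :=
  (unitGroup A L).map (Units.map (Algebra.norm F : L →* F))

/-- The norm group `N_{L/F} U_{1,L}`. -/
def normPrincipalUnits : Subgroup Fˣ :=
  (principalUnits A L).map (Units.map (Algebra.norm F : L →* F))

/-- The group `U_{1,F} ∩ N_{L̃/F̃} U_{1,L̃}`. -/
def tildeNorms : Subgroup Fˣ :=
  principalUnits A F ⊓
    ((principalUnits A (tildeExt p A L)).map
      (Units.map (Algebra.norm (maxAbUnram p A F Ω) :
        tildeExt p A L →* maxAbUnram p A F Ω))).comap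
      (Units.map (algebraMap F (maxAbUnram p A F Ω) : F →* maxAbUnram p A F Ω))

/-- The group `(U_{1,F} ∩ N_{L̃/F̃} U_{1,L̃}) / N_{L/F} U_{1,L}`. -/
abbrev TildeNormQuotient : Type _ :=
  tildeNorms p A L ⧸ (normPrincipalUnits A L).subgroupOf (tildeNorms p A L)

variable {p A L} in
/-- `Υ` is the map `χ ↦ N_{Σ_χ/F} π_χ / N_{L/F} π_L mod N_{L/F} U_L`: for every choice of the prime
elements `π_χ` of `Σ_χ` and `π_L` of `L`, the class `Υ χ` consists of exactly those elements `y` of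
`U_{1,F} ∩ N_{L̃/F̃} U_{1,L̃}` which are congruent to `N_{Σ_χ/F} π_χ / N_{L/F} π_L` modulo
`N_{L/F} U_L`. -/
def IsReciprocityMap [Normal F L] [Normal F Ω] (Υ : GalTilde p A L → TildeNormQuotient p A L) :
    Prop :=
  ∀ (χ : GalTilde p A L) (πχ : (twistedField χ)ˣ) (πL : Lˣ),
    IsPrimeElement A (twistedField χ) πχ → IsPrimeElement A L πL →
    ∀ y : tildeNorms p A L, Υ χ = (y : TildeNormQuotient p A L) ↔
      Units.map (Algebra.norm F : twistedField χ →* F) πχ /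
        Units.map (Algebra.norm F : L →* F) πL / (y : Fˣ) ∈ normUnits A L

end Reciprocity

end

end LocalReciprocity

open LocalReciprocity

/-! Write $T=\tilde F$ and $n=[L:F]$. Since $T$ has only the values of $F$, the fields $L$ and $T$
are linearly disjoint, and a generator of $\mathrm{Gal}(L/F)$ lifts to some $\sigma$ trivial on $T$.
Let $\pi$ be a prime element of $L$, $U_1$ the principal units of $LT$, and $V=U_1^{\sigma-1}$ the
group of quotients $\sigma w/w$ (`InV`). Hilbert 90 and the factorization of elements of $LT$ into a
power of $\pi$, an element of $T$ and a principal unit give the exact sequence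
$$1\to\mathrm{Gal}(L/F)\to U_1/V\to N U_1\to 1,\qquad \tau\mapsto\tau\pi/\pi .$$

The group $\mathrm{Gal}(LT/L)\cong\mathrm{Gal}(T/F)$ acts trivially on the left term. The connecting
homomorphism sends $y=N\eta\in F$ to the character $\chi$ with $\eta/h\eta\equiv\chi(h)\pi/\pi$
modulo $V$ (`IsAssociated`, `exists_isAssociated`), and it kills $N_{L/F}U_{1,L}$
(`IsAssociated.eq_one`).

It kills nothing else: an invariant class of $U_1/V$ has the norm of a principal unit of $L$
(`CompleteSetting.exists_nrm_eq`). This is proved by successive approximation at a finite level $LM$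
with $M\subseteq T$, where $M$ has an integral element of trace one, so that additive cocycles on
the graded pieces are coboundaries. Perfectness of the residue field plays no role; the input is
that inertia is trivial.

It is onto, and its inverse is $\Upsilon$: a twisted trace produces a prime element $\pi\eta$ of
$\Sigma_\chi$ with $\eta\in U_1$ (`exists_twisted_prime`), and then $\eta$ is associated with $\chi$
(`isAssociated_of_fixed`). As $\sigma$ generates both $\mathrm{Gal}(L/F)$ and
$\mathrm{Gal}(\Sigma_\chi/F)$, both norms are $\prod\sigma^i$, so $N\eta=N\pi_\chi/N\pi_L$. Other
prime elements change this by $N_{L/F}U_L$, and $N_{L/F}U_L\cap U_{1,F}=N_{L/F}U_{1,L}$. -/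

open scoped NNReal

set_option linter.unusedSectionVars false

namespace LocalReciprocity

/-- `v` is the extension to `Ω` of the valuation of the complete discrete valuation ring `A`: its
valuation ring is the integral closure of `A`, it is invariant under automorphisms, and finite
subextensions are complete. -/
structure IsExtendedValuation (A F : Type*) {Ω : Type*} [CommRing A] [Field F] [Field Ω]
    [Algebra F Ω] [Algebra A Ω] (v : Valuation Ω ℝ≥0) : Prop where
  le_one_iff : ∀ x : Ω, v x ≤ 1 ↔ IsIntegral A x
  map_algEquiv : ∀ (g : Gal(Ω/F)) (x : Ω), v (g x) = v x
  complete : ∀ (E : IntermediateField F Ω), FiniteDimensional F E →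
    ∀ (x : ℕ → Ω) (r : ℝ≥0), r < 1 → (∀ i, x i ∈ E) → (∀ i, v (x (i + 1) - x i) ≤ r ^ i) →
      ∃ y ∈ E, ∀ i, v (y - x i) ≤ r ^ i

/-! ### The extended valuation, by the spectral norm. -/

section Existence

variable (A : Type*) [CommRing A] [IsDomain A] [IsDiscreteValuationRing A]
  (F : Type*) [Field F] [Algebra A F] [IsFractionRing A F]

/-- The absolute value on the fraction field of a discrete valuation ring. -/
noncomputable def dvrAbv : AbsoluteValue F ℝ :=
  (IsDiscreteValuationRing.maximalIdeal A).adicAbv (b := 2) (by norm_num)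

lemma isNonarchimedean_dvrAbv : IsNonarchimedean (dvrAbv A F) :=
  (IsDiscreteValuationRing.maximalIdeal A).isNonarchimedean_adicAbv (b := 2) (by norm_num)

lemma dvrAbv_algebraMap_le_one (a : A) : dvrAbv A F (algebraMap A F a) ≤ 1 :=
  (IsDiscreteValuationRing.maximalIdeal A).adicAbv_coe_le_one (b := 2) (by norm_num) a

lemma dvrAbv_algebraMap_lt_one_iff (a : A) :
    dvrAbv A F (algebraMap A F a) < 1 ↔ a ∈ maximalIdeal A :=
  (IsDiscreteValuationRing.maximalIdeal A).adicAbv_coe_lt_one_iff (b := 2) (by norm_num) a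

lemma dvrAbv_unit (u : Aˣ) : dvrAbv A F (algebraMap A F u) = 1 := by
  refine le_antisymm (dvrAbv_algebraMap_le_one A F u) (not_lt.1 fun h => ?_)
  rw [dvrAbv_algebraMap_lt_one_iff] at h
  exact h u.isUnit

variable {A} in
lemma dvrAbv_irreducible_pos {ϖ : A} (h : Irreducible ϖ) : 0 < dvrAbv A F (algebraMap A F ϖ) :=
  (dvrAbv A F).pos (by simpa using h.ne_zero)

variable {A} in
lemma dvrAbv_irreducible_lt_one {ϖ : A} (h : Irreducible ϖ) :
    dvrAbv A F (algebraMap A F ϖ) < 1 := by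
  rw [dvrAbv_algebraMap_lt_one_iff, h.maximalIdeal_eq]
  exact Ideal.mem_span_singleton_self ϖ

variable {A F} in
lemma exists_algebraMap_of_dvrAbv_le_one {x : F} (hx : dvrAbv A F x ≤ 1) :
    ∃ a, algebraMap A F a = x := by
  obtain ⟨a, rfl⟩ | ⟨a, ha⟩ := ValuationRing.isInteger_or_isInteger A x
  · exact ⟨a, rfl⟩
  by_cases hm : a ∈ maximalIdeal A
  · have h1 := (dvrAbv_algebraMap_lt_one_iff A F a).2 hm
    rw [ha, map_inv₀] at h1
    by_cases h0 : x = 0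
    · exact ⟨0, by simp [h0]⟩
    · have := (dvrAbv A F).pos h0
      exact absurd h1 (not_lt.2 ((one_le_inv₀ this).2 hx))
  · obtain ⟨u, rfl⟩ : IsUnit a := by simpa using hm
    refine ⟨(u⁻¹ : Aˣ), ?_⟩
    have h2 : algebraMap A F u * algebraMap A F (u⁻¹ : Aˣ) = 1 := by
      rw [← map_mul]; simp
    rw [ha] at h2
    by_cases h0 : x = 0
    · simp [h0] at h2
    · field_simp at h2
      exact h2

variable {A} in
lemma mem_pow_iff_dvrAbv_le {ϖ : A} (hϖ : Irreducible ϖ) (a : A) (N : ℕ) :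
    a ∈ maximalIdeal A ^ N ↔
      dvrAbv A F (algebraMap A F a) ≤ dvrAbv A F (algebraMap A F ϖ) ^ N := by
  rw [hϖ.maximalIdeal_eq, Ideal.span_singleton_pow, Ideal.mem_span_singleton]
  constructor
  · rintro ⟨c, rfl⟩
    rw [map_mul, map_mul, map_pow, map_pow]
    exact mul_le_of_le_one_right (by positivity) (dvrAbv_algebraMap_le_one A F c)
  · intro h
    by_cases h0 : a = 0
    · simp [h0]
    obtain ⟨k, u, rfl⟩ := IsDiscreteValuationRing.eq_unit_mul_pow_irreducible h0 hϖ
    rw [map_mul, map_mul, dvrAbv_unit, one_mul, map_pow, map_pow,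
      pow_le_pow_iff_right_of_lt_one₀ (dvrAbv_irreducible_pos F hϖ)
        (dvrAbv_irreducible_lt_one F hϖ)] at h
    exact Dvd.dvd.mul_left (pow_dvd_pow ϖ h) _

/-- The fraction field of a discrete valuation ring, as a normed field. -/
@[reducible]
noncomputable def dvrNormedField : NontriviallyNormedField F where
  __ := (dvrAbv A F).toNormedField
  non_trivial := by
    obtain ⟨ϖ, hϖ⟩ := IsDiscreteValuationRing.exists_irreducible A
    refine ⟨(algebraMap A F ϖ)⁻¹, ?_⟩
    change 1 < dvrAbv A F _
    rw [map_inv₀]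
    exact (one_lt_inv₀ (dvrAbv_irreducible_pos F hϖ)).2 (dvrAbv_irreducible_lt_one F hϖ)

/-- It suffices to test sequences that converge geometrically. Such a sequence differs from its
first term by integral elements, so adic completeness of `A` supplies the limit. -/
lemma completeSpace_dvrNormedField [IsAdicComplete (maximalIdeal A) A] :
    letI := dvrNormedField A F
    CompleteSpace F := by
  let := dvrNormedField A F
  obtain ⟨ϖ, hϖ⟩ := IsDiscreteValuationRing.exists_irreducible A
  have hpos := dvrAbv_irreducible_pos F hϖ
  have hlt := dvrAbv_irreducible_lt_one F hϖ
  set q := dvrAbv A F (algebraMap A F ϖ) with hq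
  have hdist : ∀ x y : F, dist x y = dvrAbv A F (x - y) := fun x y => dist_eq_norm x y
  refine Metric.complete_of_convergent_controlled_sequences (fun N => q ^ N)
    (fun N => by positivity) fun u hu => ?_
  have hint : ∀ n, ∃ a, algebraMap A F a = u n - u 0 := fun n =>
    exists_algebraMap_of_dvrAbv_le_one (by
      have := hu 0 n 0 n.zero_le le_rfl
      rw [hdist, pow_zero] at this
      exact this.le)
  choose a ha using hint
  obtain ⟨l, hl⟩ := IsPrecomplete.prec' (I := maximalIdeal A) a (fun {m n} hmn => by
    rw [SModEq.sub_mem, smul_eq_mul, Ideal.mul_top, mem_pow_iff_dvrAbv_le F hϖ, map_sub, ha, ha,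
      sub_sub_sub_cancel_right, ← hdist]
    exact (hu m m n le_rfl hmn).le)
  refine ⟨algebraMap A F l + u 0, ?_⟩
  rw [tendsto_iff_dist_tendsto_zero]
  refine squeeze_zero (fun _ => dist_nonneg) (fun n => ?_)
    (tendsto_pow_atTop_nhds_zero_of_lt_one hpos.le hlt)
  have h := hl n
  rw [SModEq.sub_mem, smul_eq_mul, Ideal.mul_top, mem_pow_iff_dvrAbv_le F hϖ, map_sub, ha] at h
  rw [hdist, show u n - (algebraMap A F l + u 0) = u n - u 0 - algebraMap A F l by ring]
  exact h

/-- The spectral norm is multiplicative because `F` is complete. It is at most $1$ exactly when the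
minimal polynomial over `F` has coefficients in `A`, which is integrality because `A` is integrally
closed. Completeness is stated only for finite subextensions, since `Ω` itself need not be complete.
-/
theorem exists_isExtendedValuation [IsAdicComplete (maximalIdeal A) A]
    (Ω : Type*) [Field Ω] [Algebra F Ω] [Algebra.IsAlgebraic F Ω]
    [Algebra A Ω] [IsScalarTower A F Ω] :
    ∃ v : Valuation Ω ℝ≥0, IsExtendedValuation A F v := by
  let := dvrNormedField A F
  have := completeSpace_dvrNormedField A F
  have hnorm : ∀ x : F, ‖x‖ = dvrAbv A F x := fun x => rfl
  have : IsUltrametricDist F :=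
    IsUltrametricDist.isUltrametricDist_of_isNonarchimedean_norm (isNonarchimedean_dvrAbv A F)
  let nΩ := spectralNorm.normedField F Ω
  have : IsUltrametricDist Ω :=
    IsUltrametricDist.isUltrametricDist_of_isNonarchimedean_norm
      (isNonarchimedean_spectralNorm (K := F) (L := Ω))
  have hv : ∀ x : Ω, ((NormedField.valuation (K := Ω) x : ℝ≥0) : ℝ) = spectralNorm F Ω x :=
    fun x => rfl
  refine ⟨NormedField.valuation (K := Ω), fun x => ?_, fun g x => ?_, ?_⟩
  · have halg : IsIntegral F x := Algebra.IsIntegral.isIntegral x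
    rw [← NNReal.coe_le_coe, hv, NNReal.coe_one, spectralNorm,
      spectralValue_le_one_iff (minpoly.monic halg)]
    constructor
    · intro h
      have hl : minpoly F x ∈ Polynomial.lifts (algebraMap A F) := by
        rw [Polynomial.lifts_iff_coeff_lifts]
        intro n
        obtain ⟨a, ha⟩ := exists_algebraMap_of_dvrAbv_le_one (h n)
        exact ⟨a, ha⟩
      obtain ⟨P, hP, -, hm⟩ := Polynomial.lifts_and_natDegree_eq_and_monic hl (minpoly.monic halg)
      refine ⟨P, hm, ?_⟩
      have := minpoly.aeval F x
      rwa [← hP, Polynomial.aeval_map_algebraMap] at this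
    · intro h n
      rw [minpoly.isIntegrallyClosed_eq_field_fractions' F h, Polynomial.coeff_map]
      exact dvrAbv_algebraMap_le_one A F _
  · rw [← NNReal.coe_inj, hv, hv]
    exact (spectralNorm_eq_of_equiv g x).symm
  · intro E hE x r hr hx h
    let nS := spectralNorm.normedSpace F Ω
    have hcE : IsComplete (E : Set Ω) := by
      have : FiniteDimensional F (Subalgebra.toSubmodule E.toSubalgebra) := hE
      exact Submodule.complete_of_finiteDimensional (Subalgebra.toSubmodule E.toSubalgebra)
    have hd : ∀ a b : Ω, dist a b = ((NormedField.valuation (K := Ω) (a - b) : ℝ≥0) : ℝ) :=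
      fun a b => dist_eq_norm a b
    have htail : ∀ i k, NormedField.valuation (K := Ω) (x (i + k) - x i) ≤ r ^ i := by
      intro i k
      induction k with
      | zero => simp
      | succ k ih =>
        rw [← sub_add_sub_cancel _ (x (i + k))]
        refine (Valuation.map_add _ _ _).trans (max_le ((h (i + k)).trans ?_) ih)
        exact pow_le_pow_of_le_one zero_le hr.le (Nat.le_add_right _ _)
    have hc : CauchySeq x := by
      refine cauchySeq_of_le_geometric (r : ℝ) 1 (by exact_mod_cast hr) fun i => ?_
      rw [dist_comm, hd, one_mul]
      exact_mod_cast h i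
    obtain ⟨z, hzE, hz⟩ := cauchySeq_tendsto_of_isComplete hcE hx hc
    refine ⟨z, hzE, fun i => ?_⟩
    have h1 : Filter.Tendsto (fun k => dist (x (i + k)) (x i)) Filter.atTop
        (nhds (dist z (x i))) :=
      (hz.comp (Filter.tendsto_add_atTop_nat i |>.congr fun k => add_comm k i)).dist
        tendsto_const_nhds
    have h2 : dist z (x i) ≤ (r : ℝ) ^ i := le_of_tendsto' h1 fun k => by
      rw [hd]
      exact_mod_cast htail i k
    rw [hd] at h2
    exact_mod_cast h2

end Existence

/-! ### Integers, units and prime elements in terms of the valuation. -/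

namespace IsExtendedValuation

section Translation

variable {A F Ω : Type*} [CommRing A] [Field F] [Field Ω] [Algebra F Ω] [Algebra A Ω]
  {v : Valuation Ω ℝ≥0} (hv : IsExtendedValuation A F v)
  {E : Type*} [Field E] [Algebra A E] [Algebra E Ω] [IsScalarTower A E Ω]

include hv

lemma isIntegral_iff (x : E) : IsIntegral A x ↔ v (algebraMap E Ω x) ≤ 1 := by
  rw [hv.le_one_iff, isIntegral_algebraMap_iff (algebraMap E Ω).injective]

lemma coe_le_one (x : integralClosure A E) : v (algebraMap E Ω x) ≤ 1 :=
  (hv.isIntegral_iff _).1 x.2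

lemma isUnit_iff (x : integralClosure A E) : IsUnit x ↔ v (algebraMap E Ω x) = 1 := by
  constructor
  · rintro ⟨u, rfl⟩
    refine le_antisymm (hv.coe_le_one _) ?_
    have h1 : v (algebraMap E Ω (u : integralClosure A E)) *
        v (algebraMap E Ω (u⁻¹ : (integralClosure A E)ˣ)) = 1 := by
      rw [← map_mul, ← map_mul, ← MulMemClass.coe_mul, Units.mul_inv, OneMemClass.coe_one,
        map_one, map_one]
    rw [← h1]
    exact mul_le_of_le_one_right zero_le (hv.coe_le_one _)
  · intro h
    have h0 : (x : E) ≠ 0 := by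
      intro h0
      rw [h0, map_zero, map_zero] at h
      exact zero_ne_one h
    have hi : IsIntegral A (x : E)⁻¹ := by
      rw [hv.isIntegral_iff, map_inv₀, map_inv₀, h, inv_one]
    exact IsUnit.of_mul_eq_one (⟨(x : E)⁻¹, hi⟩ : integralClosure A E)
      (Subtype.ext (mul_inv_cancel₀ h0))

lemma mem_maxIdeal_iff (x : integralClosure A E) :
    x ∈ maxIdeal A E ↔ v (algebraMap E Ω x) < 1 := by
  rw [maxIdeal, Ideal.mem_jacobson_bot]
  constructor
  · intro h
    refine lt_of_le_of_ne (hv.coe_le_one x) fun h1 => ?_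
    obtain ⟨u, rfl⟩ := (hv.isUnit_iff x).2 h1
    -- For a unit $x$ the choice $y=-x^{-1}$ makes $xy+1$ zero, which is not a unit.
    have := h (-(u⁻¹ : (integralClosure A E)ˣ))
    simp at this
  · intro h y
    rw [hv.isUnit_iff, AddMemClass.coe_add, OneMemClass.coe_one, map_add, map_one, add_comm]
    refine Valuation.map_one_add_of_lt v ?_
    rw [MulMemClass.coe_mul, map_mul, map_mul]
    exact lt_of_le_of_lt (mul_le_of_le_one_right zero_le (hv.coe_le_one y)) h

lemma mem_unitGroup_iff (x : Eˣ) : x ∈ unitGroup A E ↔ v (algebraMap E Ω x) = 1 := by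
  constructor
  · rintro ⟨u, rfl⟩
    exact (hv.isUnit_iff _).1 u.isUnit
  · intro h
    obtain ⟨u, hu⟩ := (hv.isUnit_iff ⟨(x : E), (hv.isIntegral_iff _).2 h.le⟩).2 h
    exact ⟨u, Units.ext (congrArg Subtype.val hu)⟩

lemma mem_principalUnits_iff (x : Eˣ) :
    x ∈ principalUnits A E ↔ v (algebraMap E Ω x - 1) < 1 := by
  have key : ∀ u : (integralClosure A E)ˣ,
      u ∈ (Units.map (Ideal.Quotient.mk (maxIdeal A E) :
        integralClosure A E →* integralClosure A E ⧸ maxIdeal A E)).ker ↔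
      v (algebraMap E Ω (u : integralClosure A E) - 1) < 1 := by
    intro u
    rw [MonoidHom.mem_ker, Units.ext_iff, Units.coe_map, Units.val_one]
    change Ideal.Quotient.mk (maxIdeal A E) (u : integralClosure A E) = 1 ↔ _
    rw [← map_one (Ideal.Quotient.mk (maxIdeal A E)), Ideal.Quotient.eq, hv.mem_maxIdeal_iff]
    simp
  constructor
  · rintro ⟨u, hu, rfl⟩
    exact (key u).1 hu
  · intro h
    have h1 : v (algebraMap E Ω x) = 1 := by
      have := Valuation.map_one_add_of_lt v h
      rwa [add_sub_cancel] at this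
    obtain ⟨u, hu⟩ := (hv.mem_unitGroup_iff x).2 h1
    refine ⟨u, (key u).2 ?_, hu⟩
    rw [← hu] at h
    exact h

/-- If the valuation of `E` is discrete with generator `r`, the prime elements are the elements
of valuation `r`. -/
lemma isPrimeElement_iff {r : ℝ≥0} (hr0 : 0 < r) (hr : r < 1) (hval : ∀ x : E, x ≠ 0 → ∃ k : ℤ,
    v (algebraMap E Ω x) = r ^ k) (hex : ∃ x : E, v (algebraMap E Ω x) = r) (π : Eˣ) :
    IsPrimeElement A E π ↔ v (algebraMap E Ω π) = r := by
  obtain ⟨z, hz⟩ := hex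
  constructor
  · rintro ⟨ϖ, h1, h2⟩
    obtain ⟨k, hk⟩ := hval π π.ne_zero
    have hz0 : z ≠ 0 := by
      rintro rfl
      rw [map_zero, map_zero] at hz
      exact hr0.ne hz
    have hlt : v (algebraMap E Ω π) < 1 := by
      rw [← h1]
      exact lt_of_le_of_ne (hv.coe_le_one ϖ) fun h => h2.not_isUnit ((hv.isUnit_iff _).2 h)
    have hk1 : 0 < k := by
      rwa [hk, zpow_lt_one_iff_right_of_lt_one₀ hr0 hr] at hlt
    have hzi : IsIntegral A z := by rw [hv.isIntegral_iff, hz]; exact hr.le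
    have hqv : v (algebraMap E Ω ((π : E) / z)) = r ^ (k - 1) := by
      rw [map_div₀, map_div₀, hk, hz, zpow_sub_one₀ hr0.ne', div_eq_mul_inv]
    have hqi : IsIntegral A ((π : E) / z) := by
      rw [hv.isIntegral_iff, hqv, zpow_le_one_iff_right_of_lt_one₀ hr0 hr]
      omega
    -- A factorization of $\pi$ into integers in which $z$ is not a unit, so irreducibility makes
    -- $\pi/z$ a unit.
    have hprod : ϖ = (⟨z, hzi⟩ : integralClosure A E) * ⟨(π : E) / z, hqi⟩ :=
      Subtype.ext (by rw [h1]; exact (mul_div_cancel₀ _ hz0).symm)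
    rcases h2.isUnit_or_isUnit hprod with h | h
    · rw [hv.isUnit_iff] at h
      exact absurd (hz.symm.trans h) hr.ne
    · rw [hv.isUnit_iff] at h
      rw [map_div₀, map_div₀, hz, div_eq_one_iff_eq hr0.ne'] at h
      exact h
  · intro h
    have hi : IsIntegral A (π : E) := by rw [hv.isIntegral_iff, h]; exact hr.le
    refine ⟨⟨π, hi⟩, rfl, ⟨fun hu => ?_, fun a b hab => ?_⟩⟩
    · rw [hv.isUnit_iff] at hu
      exact hr.ne (h.symm.trans hu)
    · have hab' : (π : E) = a * b := congrArg Subtype.val hab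
      have ha0 : (a : E) ≠ 0 := fun h0 => π.ne_zero (by rw [hab', h0, zero_mul])
      have hb0 : (b : E) ≠ 0 := fun h0 => π.ne_zero (by rw [hab', h0, mul_zero])
      obtain ⟨i, hi⟩ := hval a ha0
      obtain ⟨j, hj⟩ := hval b hb0
      have hi0 := hv.coe_le_one a
      have hj0 := hv.coe_le_one b
      rw [hi, zpow_le_one_iff_right_of_lt_one₀ hr0 hr] at hi0
      rw [hj, zpow_le_one_iff_right_of_lt_one₀ hr0 hr] at hj0
      rw [hab', map_mul, map_mul, hi, hj, ← zpow_add₀ hr0.ne'] at h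
      have hij : i + j = 1 := by
        have : r ^ (i + j) = r ^ (1 : ℤ) := by rw [h, zpow_one]
        exact zpow_right_injective₀ hr0 hr.ne this
      rw [hv.isUnit_iff, hv.isUnit_iff, hi, hj]
      obtain h | h : i = 0 ∨ j = 0 := by omega
      · exact Or.inl (by rw [h, zpow_zero])
      · exact Or.inr (by rw [h, zpow_zero])

end Translation

section Base

variable {A F Ω : Type*} [CommRing A] [IsDomain A] [IsDiscreteValuationRing A]
  [Field F] [Algebra A F] [IsFractionRing A F] [Field Ω] [Algebra F Ω] [Algebra A Ω]
  [IsScalarTower A F Ω] {v : Valuation Ω ℝ≥0} (hv : IsExtendedValuation A F v)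

include hv

omit [IsDomain A] [IsDiscreteValuationRing A] [Algebra A F] [IsFractionRing A F]
  [IsScalarTower A F Ω] in
lemma algebraMap_le_one (a : A) : v (algebraMap A Ω a) ≤ 1 :=
  (hv.le_one_iff _).2 isIntegral_algebraMap

omit [IsDomain A] [IsDiscreteValuationRing A] [Algebra A F] [IsFractionRing A F]
  [IsScalarTower A F Ω] in
lemma algebraMap_unit (a : Aˣ) : v (algebraMap A Ω a) = 1 := by
  refine le_antisymm (hv.algebraMap_le_one _) ?_
  have h : v (algebraMap A Ω a) * v (algebraMap A Ω (a⁻¹ : Aˣ)) = 1 := by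
    rw [← map_mul, ← map_mul, Units.mul_inv, map_one, map_one]
  rw [← h]
  exact mul_le_of_le_one_right zero_le (hv.algebraMap_le_one _)

lemma exists_algebraMap_of_le_one {x : F} (hx : v (algebraMap F Ω x) ≤ 1) :
    ∃ a, algebraMap A F a = x :=
  IsIntegrallyClosed.isIntegral_iff.1 ((hv.isIntegral_iff x).2 hx)

lemma irreducible_pos {ϖ : A} (hϖ : Irreducible ϖ) : 0 < v (algebraMap A Ω ϖ) := by
  rw [IsScalarTower.algebraMap_apply A F Ω, Valuation.pos_iff]
  simpa using hϖ.ne_zero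

lemma irreducible_lt_one {ϖ : A} (hϖ : Irreducible ϖ) : v (algebraMap A Ω ϖ) < 1 := by
  refine lt_of_le_of_ne (hv.algebraMap_le_one ϖ) fun h => hϖ.not_isUnit ?_
  rw [IsScalarTower.algebraMap_apply A F Ω] at h
  obtain ⟨b, hb⟩ := hv.exists_algebraMap_of_le_one (x := (algebraMap A F ϖ)⁻¹) (by
    rw [map_inv₀, map_inv₀, h, inv_one])
  refine IsUnit.of_mul_eq_one b (IsFractionRing.injective A F ?_)
  rw [map_mul, hb, map_one, mul_inv_cancel₀]
  simpa using hϖ.ne_zero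

lemma lt_one_of_mem_maximalIdeal {a : A} (ha : a ∈ maximalIdeal A) : v (algebraMap A Ω a) < 1 := by
  obtain ⟨ϖ, hϖ⟩ := IsDiscreteValuationRing.exists_irreducible A
  rw [hϖ.maximalIdeal_eq, Ideal.mem_span_singleton] at ha
  obtain ⟨c, rfl⟩ := ha
  rw [map_mul, map_mul]
  exact lt_of_le_of_lt (mul_le_of_le_one_right zero_le (hv.algebraMap_le_one c))
    (hv.irreducible_lt_one hϖ)

lemma exists_zpow_of_base {ϖ : A} (hϖ : Irreducible ϖ) {x : F} (hx : x ≠ 0) :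
    ∃ k : ℤ, v (algebraMap F Ω x) = v (algebraMap A Ω ϖ) ^ k := by
  have key : ∀ a : A, a ≠ 0 → ∃ k : ℕ,
      v (algebraMap F Ω (algebraMap A F a)) = v (algebraMap A Ω ϖ) ^ k := by
    intro a ha
    obtain ⟨k, u, rfl⟩ := IsDiscreteValuationRing.eq_unit_mul_pow_irreducible ha hϖ
    refine ⟨k, ?_⟩
    rw [← IsScalarTower.algebraMap_apply A F Ω, map_mul, map_mul, hv.algebraMap_unit, one_mul,
      map_pow, map_pow]
  obtain ⟨a, b, hb, rfl⟩ := IsFractionRing.div_surjective (A := A) x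
  have ha : a ≠ 0 := by rintro rfl; simp at hx
  obtain ⟨i, hi⟩ := key a ha
  obtain ⟨j, hj⟩ := key b (nonZeroDivisors.ne_zero hb)
  refine ⟨i - j, ?_⟩
  rw [map_div₀, map_div₀, hi, hj, zpow_sub₀ (hv.irreducible_pos hϖ).ne', zpow_natCast,
    zpow_natCast]

end Base

/-! ### Totally ramified extensions: expansions in powers of a prime element. -/

section Ramified

variable {A F Ω : Type*} [CommRing A] [IsDomain A] [IsDiscreteValuationRing A]
  [Field F] [Algebra A F] [IsFractionRing A F] [Field Ω] [Algebra F Ω] [Algebra A Ω]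
  [IsScalarTower A F Ω] {v : Valuation Ω ℝ≥0} (hv : IsExtendedValuation A F v)
  {n : ℕ} {ϖ : A} {π : Ω}

include hv

omit [IsDomain A] [IsDiscreteValuationRing A] [Algebra A F] [IsFractionRing A F]
  [IsScalarTower A F Ω] hv in
/-- A finite sum of elements of pairwise distinct valuations has the valuation of one of them. -/
lemma exists_dominant {ι : Type*} (s : Finset ι) (f : ι → Ω) (hs : s.Nonempty)
    (hne : ∀ i ∈ s, ∀ j ∈ s, f i ≠ 0 → v (f i) = v (f j) → i = j) :
    ∃ j ∈ s, v (∑ i ∈ s, f i) = v (f j) ∧ ∀ i ∈ s, v (f i) ≤ v (f j) := by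
  classical
  obtain ⟨j, hj, hmax⟩ := s.exists_max_image (fun i => v (f i)) hs
  refine ⟨j, hj, ?_, hmax⟩
  by_cases h0 : f j = 0
  · have : ∑ i ∈ s, f i = 0 := Finset.sum_eq_zero fun i hi => by
      have := hmax i hi
      rw [h0, map_zero] at this
      exact (Valuation.zero_iff v).1 (le_antisymm this zero_le)
    rw [this, h0]
  · rw [← Finset.add_sum_erase s f hj]
    refine Valuation.map_add_eq_of_lt_left v ?_
    refine Valuation.map_sum_lt v ((Valuation.ne_zero_iff v).2 h0) fun i hi => ?_
    rw [Finset.mem_erase] at hi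
    exact lt_of_le_of_ne (hmax i hi.2) fun h => hi.1 (hne j hj i hi.2 h0 h.symm).symm

lemma ramified_pos (hn : n ≠ 0) (hϖ : Irreducible ϖ) (hπ : v π ^ n = v (algebraMap A Ω ϖ)) :
    0 < v π := by
  refine pos_of_ne_zero fun h => ?_
  rw [h, zero_pow hn] at hπ
  exact (hv.irreducible_pos hϖ).ne hπ

lemma ramified_lt_one (hϖ : Irreducible ϖ) (hπ : v π ^ n = v (algebraMap A Ω ϖ)) :
    v π < 1 := by
  by_contra h
  exact (hv.irreducible_lt_one hϖ).not_ge (hπ ▸ one_le_pow₀ (not_lt.1 h))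

lemma ramified_term (hϖ : Irreducible ϖ) (hπ : v π ^ n = v (algebraMap A Ω ϖ))
    (hn : n ≠ 0) {c : F} (hc : c ≠ 0) (i : ℕ) :
    ∃ k : ℤ, v (algebraMap F Ω c * π ^ i) = v π ^ (n * k + i) := by
  obtain ⟨k, hk⟩ := hv.exists_zpow_of_base hϖ hc
  refine ⟨k, ?_⟩
  rw [map_mul, hk, map_pow, ← hπ, zpow_add₀ (hv.ramified_pos hn hϖ hπ).ne', zpow_mul, zpow_natCast,
    zpow_natCast]

/-- A nonzero term of index $i$ has exponent congruent to $i$ modulo $n$, so distinct nonzero terms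
have distinct valuations and cannot cancel. -/
lemma ramified_dominant (hϖ : Irreducible ϖ) (hπ : v π ^ n = v (algebraMap A Ω ϖ))
    (hn : n ≠ 0) (c : Fin n → F) :
    ∃ j : Fin n, v (∑ i, algebraMap F Ω (c i) * π ^ (i : ℕ)) =
        v (algebraMap F Ω (c j) * π ^ (j : ℕ)) ∧
      ∀ i : Fin n, v (algebraMap F Ω (c i) * π ^ (i : ℕ)) ≤
        v (algebraMap F Ω (c j) * π ^ (j : ℕ)) := by
  have hp := hv.ramified_pos hn hϖ hπ
  have hl := hv.ramified_lt_one hϖ hπ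
  obtain ⟨j, -, h1, h2⟩ := exists_dominant (v := v) Finset.univ
    (fun i : Fin n => algebraMap F Ω (c i) * π ^ (i : ℕ))
    ⟨⟨0, Nat.pos_of_ne_zero hn⟩, Finset.mem_univ _⟩ (by
      intro i _ j _ h0 h
      have hi : c i ≠ 0 := by rintro h; simp [h] at h0
      have hj : c j ≠ 0 := by
        rintro hj
        rw [hj, map_zero, zero_mul, map_zero] at h
        exact h0 ((Valuation.zero_iff v).1 h)
      obtain ⟨k, hk⟩ := hv.ramified_term hϖ hπ hn hi i
      obtain ⟨l, hl'⟩ := hv.ramified_term hϖ hπ hn hj j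
      rw [hk, hl'] at h
      have := zpow_right_injective₀ hp hl.ne h
      have h3 : ((n : ℤ) * k + i) % n = ((n : ℤ) * l + j) % n := by rw [this]
      rw [Int.mul_add_emod_self_left, Int.mul_add_emod_self_left,
        Int.emod_eq_of_lt (by positivity) (by exact_mod_cast i.2),
        Int.emod_eq_of_lt (by positivity) (by exact_mod_cast j.2)] at h3
      exact Fin.ext (by exact_mod_cast h3))
  exact ⟨j, h1, fun i => h2 i (Finset.mem_univ i)⟩

/-- In a vanishing combination the dominant term vanishes, hence all terms do. So
$1,\pi,\dots,\pi^{n-1}$ are independent, and they form a basis by counting dimensions. -/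
lemma ramified_expansion (hϖ : Irreducible ϖ) (hπ : v π ^ n = v (algebraMap A Ω ϖ))
    (hn : n ≠ 0) {E : IntermediateField F Ω} [FiniteDimensional F E]
    (hE : Module.finrank F E = n) (hπE : π ∈ E) {x : Ω} (hx : x ∈ E) :
    ∃ c : Fin n → F, x = ∑ i, algebraMap F Ω (c i) * π ^ (i : ℕ) := by
  have hp := hv.ramified_pos hn hϖ hπ
  let b : Fin n → E := fun i => ⟨π, hπE⟩ ^ (i : ℕ)
  have hcoe : ∀ c : Fin n → F, ((∑ i, c i • b i : E) : Ω) =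
      ∑ i, algebraMap F Ω (c i) * π ^ (i : ℕ) := by
    intro c
    rw [AddSubmonoidClass.coe_finsetSum]
    refine Finset.sum_congr rfl fun i _ => ?_
    rw [IntermediateField.coe_smul, Algebra.smul_def]
    rfl
  have hli : LinearIndependent F b := by
    rw [Fintype.linearIndependent_iff]
    intro c hc i
    obtain ⟨j, h1, h2⟩ := hv.ramified_dominant hϖ hπ hn c
    rw [← hcoe, hc, ZeroMemClass.coe_zero, map_zero] at h1
    have h3 := (Valuation.zero_iff v).1 (le_antisymm (h1 ▸ h2 i) zero_le)
    rcases mul_eq_zero.1 h3 with h | h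
    · simpa using h
    · exact absurd h (pow_ne_zero _ ((Valuation.pos_iff v).1 hp))
  have hspan := hli.span_eq_top_of_card_eq_finrank' (by rw [Fintype.card_fin, hE])
  obtain ⟨c, hc⟩ := (Submodule.mem_span_range_iff_exists_fun F).1
    (hspan.symm ▸ Submodule.mem_top : (⟨x, hx⟩ : E) ∈ Submodule.span F (Set.range b))
  exact ⟨c, by rw [← hcoe, hc]⟩

/-- The values of a totally ramified extension. -/
lemma ramified_exists_zpow (hϖ : Irreducible ϖ) (hπ : v π ^ n = v (algebraMap A Ω ϖ))
    (hn : n ≠ 0) {E : IntermediateField F Ω} [FiniteDimensional F E]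
    (hE : Module.finrank F E = n) (hπE : π ∈ E) {x : Ω} (hx : x ∈ E) (hx0 : x ≠ 0) :
    ∃ k : ℤ, v x = v π ^ k := by
  obtain ⟨c, rfl⟩ := hv.ramified_expansion hϖ hπ hn hE hπE hx
  obtain ⟨j, h1, -⟩ := hv.ramified_dominant hϖ hπ hn c
  have hj : c j ≠ 0 := by
    intro hj
    rw [hj, map_zero, zero_mul, map_zero] at h1
    exact hx0 ((Valuation.zero_iff v).1 h1)
  obtain ⟨k, hk⟩ := hv.ramified_term hϖ hπ hn hj j
  exact ⟨_, h1.trans hk⟩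

/-- An element of a totally ramified extension is at distance from `F` measured by an element whose
valuation is not a value of `F`, or in `F`. -/
lemma ramified_exists_sub (hϖ : Irreducible ϖ) (hπ : v π ^ n = v (algebraMap A Ω ϖ))
    (hn : n ≠ 0) {E : IntermediateField F Ω} [FiniteDimensional F E]
    (hE : Module.finrank F E = n) (hπE : π ∈ E) {x : Ω} (hx : x ∈ E) :
    ∃ c : F, v (algebraMap F Ω c) ≤ v x ∧ (x = algebraMap F Ω c ∨
      ∃ k : ℤ, ¬ (n : ℤ) ∣ k ∧ v (x - algebraMap F Ω c) = v π ^ k) := by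
  obtain ⟨c, hc⟩ := hv.ramified_expansion hϖ hπ hn hE hπE hx
  have hp := hv.ramified_pos hn hϖ hπ
  let z : Fin n := ⟨0, Nat.pos_of_ne_zero hn⟩
  refine ⟨c z, ?_, ?_⟩
  · obtain ⟨j, h1, h2⟩ := hv.ramified_dominant hϖ hπ hn c
    have := h2 z
    rw [← h1, ← hc] at this
    simpa [z] using this
  -- Without its constant term, the expansion has only exponents not divisible by $n$.
  · let c' : Fin n → F := Function.update c z 0
    have hx' : x - algebraMap F Ω (c z) = ∑ i, algebraMap F Ω (c' i) * π ^ (i : ℕ) := by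
      rw [hc, ← Finset.add_sum_erase _ _ (Finset.mem_univ z),
        ← Finset.add_sum_erase _ (fun i => algebraMap F Ω (c' i) * π ^ (i : ℕ)) (Finset.mem_univ z)]
      have : ∑ i ∈ Finset.univ.erase z, algebraMap F Ω (c' i) * π ^ (i : ℕ) =
          ∑ i ∈ Finset.univ.erase z, algebraMap F Ω (c i) * π ^ (i : ℕ) :=
        Finset.sum_congr rfl fun i hi => by
          simp only [c', Function.update_of_ne (Finset.ne_of_mem_erase hi)]
      rw [this]
      simp [c', z]
    obtain ⟨j, h1, h2⟩ := hv.ramified_dominant hϖ hπ hn c'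
    by_cases hj : c' j = 0
    · left
      rw [hj, map_zero, zero_mul, map_zero, ← hx'] at h1
      exact sub_eq_zero.1 ((Valuation.zero_iff v).1 h1)
    · right
      obtain ⟨k, hk⟩ := hv.ramified_term hϖ hπ hn hj j
      refine ⟨_, ?_, by rw [hx', h1, hk]⟩
      have hjz : j ≠ z := by
        rintro rfl
        simp [c'] at hj
      have hj0 : (j : ℕ) ≠ 0 := fun h => hjz (Fin.ext h)
      rw [Int.dvd_add_right (Dvd.intro _ rfl), Int.natCast_dvd_natCast]
      exact fun h => absurd (Nat.le_of_dvd (Nat.pos_of_ne_zero hj0) h) (not_le.2 j.2)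

/-- The residue field of a totally ramified extension is that of `A`. -/
lemma ramified_residue (hϖ : Irreducible ϖ) (hπ : v π ^ n = v (algebraMap A Ω ϖ))
    (hn : n ≠ 0) {E : IntermediateField F Ω} [FiniteDimensional F E]
    (hE : Module.finrank F E = n) (hπE : π ∈ E) {x : Ω} (hx : x ∈ E) (hx1 : v x ≤ 1) :
    ∃ a : A, v (x - algebraMap A Ω a) < 1 := by
  obtain ⟨c, hc1, hc2⟩ := hv.ramified_exists_sub hϖ hπ hn hE hπE hx
  obtain ⟨a, rfl⟩ := hv.exists_algebraMap_of_le_one (hc1.trans hx1)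
  rw [← IsScalarTower.algebraMap_apply A F Ω] at hc1 hc2
  refine ⟨a, ?_⟩
  obtain h | ⟨k, hk, h⟩ := hc2
  · rw [h, sub_self, map_zero]
    exact one_pos
  · refine lt_of_le_of_ne ((Valuation.map_sub v _ _).trans
      (max_le hx1 (hv.algebraMap_le_one a))) fun h1 => ?_
    rw [h1] at h
    -- Valuation $1$ has exponent $0$, which $n\nmid k$ excludes.
    have : v π ^ (0 : ℤ) = v π ^ k := by rw [zpow_zero, h]
    have := zpow_right_injective₀ (hv.ramified_pos hn hϖ hπ) (hv.ramified_lt_one hϖ hπ).ne this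
    exact hk (this ▸ dvd_zero _)

end Ramified

end IsExtendedValuation

instance {A F Ω : Type*} [CommRing A] [Field F] [Algebra A F] [Field Ω] [Algebra F Ω] [Algebra A Ω]
    [IsScalarTower A F Ω] (E : IntermediateField F Ω) : IsScalarTower A E Ω :=
  IsScalarTower.of_algebraMap_eq fun _ => rfl

/-! ### Uniformizers and inertia of finite extensions. -/

namespace IsExtendedValuation

variable {A F Ω : Type*} [CommRing A] [IsDomain A] [IsDiscreteValuationRing A]
  [Field F] [Algebra A F] [IsFractionRing A F] [Field Ω] [Algebra F Ω] [Algebra A Ω]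
  [IsScalarTower A F Ω] {v : Valuation Ω ℝ≥0} (hv : IsExtendedValuation A F v)

include hv

lemma isNoetherianRing_integralClosure (E : IntermediateField F Ω) [FiniteDimensional F E]
    [Algebra.IsSeparable F E] : IsNoetherianRing (integralClosure A E) :=
  IsIntegralClosure.isNoetherianRing A F E (integralClosure A E)

/-- A totally ramified extension contains an element whose valuation is the root of the valuation
of a prime element of `A`. -/
lemma exists_uniformizer (E : IntermediateField F Ω) [FiniteDimensional F E]
    [Algebra.IsSeparable F E] (hE : IsTotallyRamified A F E) {ϖ : A} (hϖ : Irreducible ϖ) :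
    ∃ π ∈ E, v π ^ Module.finrank F E = v (algebraMap A Ω ϖ) := by
  have := hv.isNoetherianRing_integralClosure E
  obtain ⟨S, hS⟩ := (isNoetherianRing_iff_ideal_fg _).1 this (maxIdeal A E)
  have hle : ∀ x : integralClosure A E, x ∈ maxIdeal A E ↔ v (x : E) < 1 := hv.mem_maxIdeal_iff
  have hϖm : algebraMap A (integralClosure A E) ϖ ∈ maxIdeal A E :=
    (hle _).2 (hv.irreducible_lt_one hϖ)
  have hϖpos := hv.irreducible_pos hϖ
  have hSne : S.Nonempty := by
    rw [Finset.nonempty_iff_ne_empty]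
    rintro rfl
    rw [← hS, Finset.coe_empty, Ideal.span_empty, Ideal.mem_bot] at hϖm
    have : v ((algebraMap A (integralClosure A E) ϖ : E) : Ω) = 0 := by rw [hϖm]; simp
    exact hϖpos.ne' this
  -- A generator of largest valuation divides all the others, so the maximal ideal is principal.
  obtain ⟨z, hzS, hz⟩ := S.exists_max_image (fun x => v ((x : E) : Ω)) hSne
  have hzm : z ∈ maxIdeal A E := hS ▸ Ideal.subset_span hzS
  have hdom : ∀ x : integralClosure A E, v ((x : E) : Ω) ≤ v ((z : E) : Ω) → z ∣ x := by
    intro x hx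
    by_cases hz0 : (z : E) = 0
    · rw [hz0] at hx
      have hx0 : v ((x : E) : Ω) = 0 := le_antisymm (by simpa using hx) zero_le
      have : x = 0 := by
        have := (Valuation.zero_iff v).1 hx0
        exact Subtype.ext (Subtype.ext this)
      rw [this]
      exact dvd_zero _
    · have hi : IsIntegral A ((x : E) / z) := by
        rw [hv.isIntegral_iff, map_div₀, map_div₀]
        exact div_le_one_of_le₀ hx zero_le
      exact ⟨⟨_, hi⟩, Subtype.ext (mul_div_cancel₀ _ hz0).symm⟩
  have hspan : maxIdeal A E = Ideal.span {z} := by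
    refine le_antisymm ?_ ((Ideal.span_singleton_le_iff_mem _).2 hzm)
    rw [← hS, Ideal.span_le]
    intro x hx
    exact Ideal.mem_span_singleton.2 (hdom x (hz x hx))
  -- Total ramification now says that $\varpi$ and $z^{[E:F]}$ are associates.
  rw [IsTotallyRamified, hspan, Ideal.span_singleton_pow, hϖ.maximalIdeal_eq, Ideal.map_span,
    Set.image_singleton, Ideal.span_singleton_eq_span_singleton] at hE
  obtain ⟨u, hu⟩ := hE
  refine ⟨((z : E) : Ω), (z : E).2, ?_⟩
  have h1 := (hv.isUnit_iff _).1 u.isUnit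
  have h2 := congrArg (fun x : integralClosure A E => v ((x : E) : Ω)) hu
  simp only [MulMemClass.coe_mul, map_mul, SubmonoidClass.coe_pow, map_pow] at h2
  rw [← h2]
  change v (((algebraMap A (integralClosure A E) ϖ : integralClosure A E) : E) : Ω) * _ =
    v (algebraMap A Ω ϖ)
  rw [show v (((u : integralClosure A E) : E) : Ω) = 1 from h1, mul_one]
  rfl

/-- The inertia group of a formally unramified extension is trivial. -/
lemma exists_of_formallyUnramified (M : IntermediateField F Ω) [FiniteDimensional F M]
    [IsGalois F M] [Algebra.FormallyUnramified A (integralClosure A M)] (g : Gal(Ω/F))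
    (hg : g ∉ M.fixingSubgroup) : ∃ a ∈ M, v a ≤ 1 ∧ v (g a - a) = 1 := by
  have := hv.isNoetherianRing_integralClosure M
  by_contra! hcon
  have hle : ∀ x : integralClosure A M, x ∈ maxIdeal A M ↔ v (x : M) < 1 := hv.mem_maxIdeal_iff
  let γ : M →ₐ[F] M := (g : Ω →ₐ[F] Ω).restrictNormal M
  have hγ : ∀ x : M, (γ x : Ω) = g x := fun x => (g : Ω →ₐ[F] Ω).restrictNormal_commutes M x
  let f : integralClosure A M →ₐ[A] integralClosure A M := (γ.restrictScalars A).mapIntegralClosure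
  have hf : ∀ x, ((f x : M) : Ω) = g (x : M) := fun x => hγ x
  have htop : maxIdeal A M ≠ ⊤ := by
    rw [Ideal.ne_top_iff_one, hle]
    simp
  have key : f = AlgHom.id A _ := by
    -- If $g$ moves no integer of $M$ by a unit, it agrees with the identity modulo the maximal
    -- ideal. Formal unramifiedness propagates the agreement to all powers of that ideal, whose
    -- intersection is zero.
    refine Algebra.FormallyUnramified.ext_of_iInf (maxIdeal A M)
      (Ideal.iInf_pow_eq_bot_of_isDomain _ htop) fun x => ?_
    rw [Ideal.Quotient.eq, hle]
    have h1 : v ((x : M) : Ω) ≤ 1 := hv.coe_le_one x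
    have h2 := hcon _ (x : M).2 h1
    refine lt_of_le_of_ne ?_ ?_
    · exact hv.coe_le_one (f x - x)
    · change v (((f x : M) : Ω) - (x : M)) ≠ 1
      rw [hf]
      exact h2
  refine hg ((IntermediateField.mem_fixingSubgroup_iff _ _).2 fun x hx => ?_)
  have := integralClosure.isFractionRing_of_finite_extension (A := A) F M
  obtain ⟨a, b, hb0, hab⟩ := IsFractionRing.div_surjective (A := integralClosure A M)
    (⟨x, hx⟩ : M)
  have hfix : ∀ a : integralClosure A M, g (a : M) = (a : M) := fun a => by
    rw [← hf, key]
    rfl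
  have hx' : x = ((a : M) : Ω) / ((b : M) : Ω) := (congrArg (Subtype.val) hab).symm
  rw [hx', map_div₀, hfix, hfix]

end IsExtendedValuation

/-! ### Automorphisms of composita. -/

section Galois

variable {F Ω : Type*} [Field F] [Field Ω] [Algebra F Ω]

lemma coe_restrictNormalHom [Normal F Ω] (M : IntermediateField F Ω) [Normal F M] (g : Gal(Ω/F))
    (x : M) : ((AlgEquiv.restrictNormalHom M g x : M) : Ω) = g x :=
  AlgEquiv.restrictNormal_commutes g M x

lemma apply_mem_of_normal (M : IntermediateField F Ω) [Normal F M] (g : Gal(Ω/F))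
    {x : Ω} (hx : x ∈ M) : g x ∈ M := by
  have := (g : Ω →ₐ[F] Ω).restrictNormal_commutes M ⟨x, hx⟩
  exact this ▸ ((g : Ω →ₐ[F] Ω).restrictNormal M ⟨x, hx⟩).2

lemma restrictNormalHom_eq_iff [Normal F Ω] {M : IntermediateField F Ω} [Normal F M]
    {g g' : Gal(Ω/F)} : AlgEquiv.restrictNormalHom M g = AlgEquiv.restrictNormalHom M g' ↔
      ∀ x ∈ M, g x = g' x := by
  constructor
  · intro h x hx
    rw [← coe_restrictNormalHom M g ⟨x, hx⟩, h, coe_restrictNormalHom]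
  · intro h
    ext x
    rw [coe_restrictNormalHom, coe_restrictNormalHom, h x x.2]

lemma mem_fixingSubgroup_iff_restrictNormalHom [Normal F Ω] {M : IntermediateField F Ω}
    [Normal F M] {g : Gal(Ω/F)} : g ∈ M.fixingSubgroup ↔ AlgEquiv.restrictNormalHom M g = 1 := by
  rw [← map_one (AlgEquiv.restrictNormalHom (F := F) (K₁ := Ω) M), restrictNormalHom_eq_iff,
    IntermediateField.mem_fixingSubgroup_iff]
  rfl

lemma eqOn_sup {K M : IntermediateField F Ω} {g g' : Gal(Ω/F)} (hK : ∀ x ∈ K, g x = g' x)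
    (hM : ∀ x ∈ M, g x = g' x) {x : Ω} (hx : x ∈ K ⊔ M) : g x = g' x := by
  have h : g'⁻¹ * g ∈ (K ⊔ M).fixingSubgroup := by
    rw [IntermediateField.fixingSubgroup_sup, Subgroup.mem_inf,
      IntermediateField.mem_fixingSubgroup_iff, IntermediateField.mem_fixingSubgroup_iff]
    constructor
    · intro y hy
      rw [AlgEquiv.mul_apply, hK y hy]
      exact g'.symm_apply_apply y
    · intro y hy
      rw [AlgEquiv.mul_apply, hM y hy]
      exact g'.symm_apply_apply y
  have := (IntermediateField.mem_fixingSubgroup_iff _ _).1 h x hx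
  rw [AlgEquiv.mul_apply] at this
  exact (AlgEquiv.symm_apply_eq g').1 this

lemma mem_of_fixed [IsGalois F Ω] {K : IntermediateField F Ω} {x : Ω}
    (h : ∀ g ∈ K.fixingSubgroup, g x = x) : x ∈ K := by
  rw [← InfiniteGalois.fixedField_fixingSubgroup K, IntermediateField.mem_fixedField_iff]
  exact h

/-- The trace of an element of `K ⊔ M`, along lifts of `Gal(M/F)` fixing `K`, is in `K`. -/
lemma sum_section_mem [IsGalois F Ω] {K M : IntermediateField F Ω} [Normal F M]
    [FiniteDimensional F M]
    {s : Gal(M/F) → Gal(Ω/F)} (hs : ∀ q, AlgEquiv.restrictNormalHom M (s q) = q)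
    (hsK : ∀ q, s q ∈ K.fixingSubgroup) {y : Ω} (hy : y ∈ K ⊔ M) : ∑ q, s q y ∈ K := by
  refine mem_of_fixed fun g hg => ?_
  rw [map_sum]
  -- $g\,s(q)$ and $s(\bar g q)$ agree on $K$ and on $M$, so $g$ permutes the summands. The section
  -- $s$ need not be a homomorphism.
  refine Fintype.sum_equiv (Equiv.mulLeft (AlgEquiv.restrictNormalHom M g)) _ _ fun q => ?_
  change (g * s q) y = _
  refine eqOn_sup (fun x hx => ?_) (fun x hx => ?_) hy
  · exact ((IntermediateField.mem_fixingSubgroup_iff _ _).1 (mul_mem hg (hsK q)) x hx).trans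
      ((IntermediateField.mem_fixingSubgroup_iff _ _).1 (hsK _) x hx).symm
  · refine restrictNormalHom_eq_iff.1 ?_ x hx
    rw [map_mul, hs, hs, Equiv.coe_mulLeft]

lemma section_one_apply [Normal F Ω] {K M : IntermediateField F Ω} [Normal F M]
    {s : Gal(M/F) → Gal(Ω/F)} (hs : ∀ q, AlgEquiv.restrictNormalHom M (s q) = q)
    (hsK : ∀ q, s q ∈ K.fixingSubgroup) {y : Ω} (hy : y ∈ K ⊔ M) : s 1 y = y := by
  refine eqOn_sup (g' := 1) (fun x hx => ?_) (fun x hx => ?_) hy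
  · exact (IntermediateField.mem_fixingSubgroup_iff _ _).1 (hsK 1) x hx
  · exact restrictNormalHom_eq_iff.1 (by rw [hs, map_one]) x hx

end Galois

/-! ### Extensions with trivial inertia and their dual systems. -/

section Unramified

variable {F Ω : Type*} [Field F] [Field Ω] [Algebra F Ω] [IsGalois F Ω] {v : Valuation Ω ℝ≥0}
  {M : IntermediateField F Ω} [Normal F M] [FiniteDimensional F M]

/-- Every automorphism of `Ω/F` acting nontrivially on `M` acts nontrivially on the residue field
of `M`. -/
def TrivialInertia (v : Valuation Ω ℝ≥0) (M : IntermediateField F Ω) : Prop :=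
  ∀ g : Gal(Ω/F), g ∉ M.fixingSubgroup → ∃ a ∈ M, v a ≤ 1 ∧ v (g a - a) = 1

omit [IsGalois F Ω] in
lemma TrivialInertia.iSup {ι : Type*} {M : ι → IntermediateField F Ω}
    (h : ∀ i, TrivialInertia v (M i)) : TrivialInertia v (⨆ i, M i) := by
  intro g hg
  obtain ⟨i, hi⟩ : ∃ i, g ∉ (M i).fixingSubgroup := by
    by_contra! hi
    refine hg ?_
    rw [← Subgroup.zpowers_le, ← IntermediateField.le_iff_le]
    refine iSup_le fun i => ?_
    rw [IntermediateField.le_iff_le, Subgroup.zpowers_le]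
    exact hi i
  obtain ⟨a, ha, h1⟩ := h i g hi
  exact ⟨a, (le_iSup M i : M i ≤ _) ha, h1⟩

/-- A function on the Galois group of the form `g ↦ ∑ bⱼ g(aⱼ)` with integral `aⱼ, bⱼ ∈ M`. -/
def IsTraceForm (v : Valuation Ω ℝ≥0) (M : IntermediateField F Ω) (f : Gal(Ω/F) → Ω) : Prop :=
  ∃ (r : ℕ) (a b : Fin r → Ω), (∀ j, a j ∈ M) ∧ (∀ j, b j ∈ M) ∧ (∀ j, v (a j) ≤ 1) ∧
    (∀ j, v (b j) ≤ 1) ∧ ∀ g, f g = ∑ j, b j * g (a j)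

lemma isTraceForm_of_fintype {ι : Type*} [Fintype ι] {a b : ι → Ω} (ha : ∀ j, a j ∈ M)
    (hb : ∀ j, b j ∈ M) (ha1 : ∀ j, v (a j) ≤ 1) (hb1 : ∀ j, v (b j) ≤ 1) :
    IsTraceForm v M fun g => ∑ j, b j * g (a j) := by
  let e := Fintype.equivFin ι
  exact ⟨Fintype.card ι, a ∘ e.symm, b ∘ e.symm, fun _ => ha _, fun _ => hb _, fun _ => ha1 _,
    fun _ => hb1 _, fun g => (Equiv.sum_comp e.symm (fun j => b j * g (a j))).symm⟩

lemma IsTraceForm.one : IsTraceForm v M 1 := by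
  have := isTraceForm_of_fintype (v := v) (M := M) (ι := Unit) (a := 1) (b := 1)
    (fun _ => one_mem _) (fun _ => one_mem _) (fun _ => by simp) (fun _ => by simp)
  convert this
  simp

lemma IsTraceForm.mul {f f' : Gal(Ω/F) → Ω} (hf : IsTraceForm v M f) (hf' : IsTraceForm v M f') :
    IsTraceForm v M (f * f') := by
  obtain ⟨r, a, b, ha, hb, ha1, hb1, h⟩ := hf
  obtain ⟨r', a', b', ha', hb', ha1', hb1', h'⟩ := hf'
  have := isTraceForm_of_fintype (v := v) (M := M) (ι := Fin r × Fin r')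
    (a := fun j => a j.1 * a' j.2) (b := fun j => b j.1 * b' j.2)
    (fun _ => mul_mem (ha _) (ha' _)) (fun _ => mul_mem (hb _) (hb' _))
    (fun _ => by rw [map_mul]; exact mul_le_one' (ha1 _) (ha1' _))
    (fun _ => by rw [map_mul]; exact mul_le_one' (hb1 _) (hb1' _))
  convert this with g
  rw [Pi.mul_apply, h, h', Finset.sum_mul_sum, Fintype.sum_prod_type]
  refine Finset.sum_congr rfl fun i _ => Finset.sum_congr rfl fun j _ => ?_
  rw [map_mul]
  ring

lemma isTraceForm_prod {ι : Type*} (s : Finset ι) (f : ι → Gal(Ω/F) → Ω)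
    (h : ∀ i ∈ s, IsTraceForm v M (f i)) : IsTraceForm v M (∏ i ∈ s, f i) :=
  Finset.prod_induction f _ (fun _ _ => IsTraceForm.mul) IsTraceForm.one h

/-- For a lift $\gamma$ of $q$ and an integer $a$ with $a-\gamma a$ a unit, take $g\mapsto(g
a-\gamma a)/(a-\gamma a)$. -/
lemma TrivialInertia.exists_separating (hM : TrivialInertia v M)
    (hinv : ∀ (g : Gal(Ω/F)) (x : Ω), v (g x) = v x) (q : Gal(M/F)) (hq : q ≠ 1) :
    ∃ f, IsTraceForm v M f ∧ (∀ g, AlgEquiv.restrictNormalHom M g = 1 → f g = 1) ∧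
      ∀ g, AlgEquiv.restrictNormalHom M g = q → f g = 0 := by
  obtain ⟨γ, rfl⟩ := AlgEquiv.restrictNormalHom_surjective (F := F) (K₁ := M) Ω q
  obtain ⟨a, haM, ha1, ha⟩ := hM γ (by rwa [mem_fixingSubgroup_iff_restrictNormalHom])
  have hd : v (a - γ a) = 1 := by rw [Valuation.map_sub_swap, ha]
  have hd0 : a - γ a ≠ 0 := fun h => by rw [h, map_zero] at hd; exact zero_ne_one hd
  have hγM : γ a ∈ M := apply_mem_of_normal M γ haM
  have hdM : (a - γ a)⁻¹ ∈ M := inv_mem (sub_mem haM hγM)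
  have h := isTraceForm_of_fintype (v := v) (M := M) (ι := Bool)
    (a := fun j => cond j a 1) (b := fun j => cond j (a - γ a)⁻¹ (- (γ a * (a - γ a)⁻¹)))
    (by rintro (_ | _) <;> simp [haM, one_mem])
    (by
      rintro (_ | _)
      · exact neg_mem (mul_mem hγM hdM)
      · exact hdM)
    (by rintro (_ | _) <;> simp [ha1])
    (by
      rintro (_ | _)
      · simp only [cond_false, Valuation.map_neg, map_mul, map_inv₀, hd, hinv, inv_one, mul_one]
        exact ha1
      · simp [hd])
  refine ⟨_, h, fun g hg => ?_, fun g hg => ?_⟩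
  · have hga : g a = a :=
      restrictNormalHom_eq_iff.1 (hg.trans (map_one (AlgEquiv.restrictNormalHom M)).symm) a haM
    simp only [Fintype.sum_bool, cond_true, cond_false, hga, map_one]
    field_simp
    ring
  · have hga : g a = γ a := restrictNormalHom_eq_iff.1 hg a haM
    simp only [Fintype.sum_bool, cond_true, cond_false, hga, map_one]
    ring

open scoped Classical in
/-- An extension with trivial inertia has a dual system: the indicator function of the
automorphisms trivial on `M` is a trace form. -/
lemma TrivialInertia.isTraceForm (hM : TrivialInertia v M)
    (hinv : ∀ (g : Gal(Ω/F)) (x : Ω), v (g x) = v x) :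
    IsTraceForm v M fun g => if AlgEquiv.restrictNormalHom M g = 1 then 1 else 0 := by
  choose! f hf h1 h0 using fun q hq => hM.exists_separating hinv q hq
  -- The indicator is the product over $q\ne1$ of the functions separating $1$ from $q$.
  convert isTraceForm_prod (Finset.univ.erase (1 : Gal(M/F))) f
    fun q hq => hf q (Finset.ne_of_mem_erase hq) with g
  rw [Finset.prod_apply]
  split_ifs with hg
  · exact (Finset.prod_eq_one fun q hq => h1 q (Finset.ne_of_mem_erase hq) g hg).symm
  · exact (Finset.prod_eq_zero (Finset.mem_erase.2 ⟨hg, Finset.mem_univ _⟩) (h0 _ hg g rfl)).symm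

lemma TrivialInertia.exists_dual (hM : TrivialInertia v M)
    (hinv : ∀ (g : Gal(Ω/F)) (x : Ω), v (g x) = v x) {K : IntermediateField F Ω}
    {s : Gal(M/F) → Gal(Ω/F)} (hs : ∀ q, AlgEquiv.restrictNormalHom M (s q) = q)
    (hsK : ∀ q, s q ∈ K.fixingSubgroup) :
    ∃ (r : ℕ) (a b : Fin r → Ω), (∀ j, a j ∈ M) ∧ (∀ j, b j ∈ M) ∧ (∀ j, v (a j) ≤ 1) ∧
      (∀ j, v (b j) ≤ 1) ∧ ∀ x ∈ K ⊔ M, x = ∑ j, b j * ∑ q, s q (x * a j) := by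
  classical
  obtain ⟨r, a, b, ha, hb, ha1, hb1, h⟩ := hM.isTraceForm hinv
  -- After interchanging the sums, the coefficient of $s_q(x)$ is $\sum_j b_j s_q(a_j)$, which is
  -- $1$ for $q=1$ and $0$ otherwise.
  refine ⟨r, a, b, ha, hb, ha1, hb1, fun x hx => ?_⟩
  simp_rw [Finset.mul_sum]
  rw [Finset.sum_comm]
  have : ∀ q, ∑ j, b j * s q (x * a j) = if q = 1 then x else 0 := by
    intro q
    have h1 : ∑ j, b j * s q (x * a j) = s q x * ∑ j, b j * s q (a j) := by
      rw [Finset.mul_sum]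
      refine Finset.sum_congr rfl fun j _ => ?_
      rw [map_mul]
      ring
    rw [h1, ← h]
    simp only [hs]
    split_ifs with hq
    · rw [hq, section_one_apply hs hsK hx, mul_one]
    · rw [mul_zero]
  simp_rw [this]
  rw [Finset.sum_ite_eq' Finset.univ 1, if_pos (Finset.mem_univ _)]

lemma map_section_sum_le (hinv : ∀ (g : Gal(Ω/F)) (x : Ω), v (g x) = v x)
    (s : Gal(M/F) → Gal(Ω/F)) (x : Ω) : v (∑ q, s q x) ≤ v x :=
  Valuation.map_sum_le v fun q _ => (hinv (s q) x).le

/-- The values of `K ⊔ M` are those of `K`. -/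
lemma TrivialInertia.exists_value (hM : TrivialInertia v M)
    (hinv : ∀ (g : Gal(Ω/F)) (x : Ω), v (g x) = v x) {K : IntermediateField F Ω}
    {s : Gal(M/F) → Gal(Ω/F)} (hs : ∀ q, AlgEquiv.restrictNormalHom M (s q) = q)
    (hsK : ∀ q, s q ∈ K.fixingSubgroup) {x : Ω} (hx : x ∈ K ⊔ M) : ∃ y ∈ K, v y = v x := by
  obtain ⟨r, a, b, ha, hb, ha1, hb1, h⟩ := hM.exists_dual hinv hs hsK
  by_cases hx0 : x = 0
  · exact ⟨0, zero_mem _, by rw [hx0]⟩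
  -- The traces in the dual expansion lie in $K$ and have valuation at most $v(x)$. If none attained
  -- $v(x)$, then $x$ would be a sum of strictly smaller terms.
  by_contra! hcon
  refine lt_irrefl (v x) ?_
  conv_lhs => rw [h x hx]
  refine Valuation.map_sum_lt v ((Valuation.ne_zero_iff v).2 hx0) fun j _ => ?_
  have hmem : x * a j ∈ K ⊔ M := mul_mem hx ((le_sup_right : M ≤ K ⊔ M) (ha j))
  rw [map_mul]
  refine lt_of_le_of_lt (mul_le_of_le_one_left zero_le (hb1 j)) ?_
  refine lt_of_le_of_ne ((map_section_sum_le hinv s _).trans ?_)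
    (hcon _ (sum_section_mem hs hsK hmem))
  rw [map_mul]
  exact mul_le_of_le_one_right zero_le (ha1 j)

/-- If the residue field of `K` is that of `F`, then the residue field of `K ⊔ M` is that
of `M`. -/
lemma TrivialInertia.exists_residue (hM : TrivialInertia v M)
    (hinv : ∀ (g : Gal(Ω/F)) (x : Ω), v (g x) = v x) {K : IntermediateField F Ω}
    {s : Gal(M/F) → Gal(Ω/F)} (hs : ∀ q, AlgEquiv.restrictNormalHom M (s q) = q)
    (hsK : ∀ q, s q ∈ K.fixingSubgroup)
    (hres : ∀ x ∈ K, v x ≤ 1 → ∃ c : F, v (x - algebraMap F Ω c) < 1)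
    {x : Ω} (hx : x ∈ K ⊔ M) (hx1 : v x ≤ 1) : ∃ y ∈ M, v (x - y) < 1 := by
  obtain ⟨r, a, b, ha, hb, ha1, hb1, h⟩ := hM.exists_dual hinv hs hsK
  have : ∀ j, ∃ c : F, v (∑ q, s q (x * a j) - algebraMap F Ω c) < 1 := by
    intro j
    refine hres _ (sum_section_mem hs hsK (mul_mem hx ((le_sup_right : M ≤ K ⊔ M) (ha j)))) ?_
    refine (map_section_sum_le hinv s _).trans ?_
    rw [map_mul]
    exact mul_le_one' hx1 (ha1 j)
  choose c hc using this
  -- Each trace in the dual expansion is replaced by a representative in $F$ of its residue class.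
  refine ⟨∑ j, b j * algebraMap F Ω (c j),
    sum_mem fun j _ => mul_mem (hb j) (M.algebraMap_mem _), ?_⟩
  conv_lhs => rw [h x hx]
  rw [← Finset.sum_sub_distrib]
  refine Valuation.map_sum_lt v one_ne_zero fun j _ => ?_
  rw [← mul_sub, map_mul]
  exact lt_of_le_of_lt (mul_le_of_le_one_left zero_le (hb1 j)) (hc j)

/-- An extension with trivial inertia has an integral element of trace one. -/
lemma TrivialInertia.exists_trace_eq_one (hM : TrivialInertia v M)
    (hinv : ∀ (g : Gal(Ω/F)) (x : Ω), v (g x) = v x) :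
    ∃ t : M, v (t : Ω) ≤ 1 ∧ ∑ q : Gal(M/F), q t = 1 := by
  choose s hs using AlgEquiv.restrictNormalHom_surjective (F := F) (K₁ := M) Ω
  have hsK : ∀ q, s q ∈ (⊥ : IntermediateField F Ω).fixingSubgroup := by
    intro q
    rw [IntermediateField.fixingSubgroup_bot]
    exact Subgroup.mem_top _
  obtain ⟨r, a, b, ha, hb, ha1, hb1, h⟩ := hM.exists_dual hinv hs hsK
  have h1 := h 1 (one_mem _)
  -- By the dual expansion of $1$, the traces of the $a_j$ cannot all have valuation below $1$.
  -- Dividing a suitable $a_j$ by its trace, an element of $F$, keeps it integral and gives trace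
  -- one.
  obtain ⟨j, hj⟩ : ∃ j, 1 ≤ v (∑ q, s q (1 * a j)) := by
    by_contra! hcon
    refine lt_irrefl (v (1 : Ω)) ?_
    conv_lhs => rw [h1]
    rw [map_one]
    refine Valuation.map_sum_lt v one_ne_zero fun j _ => ?_
    rw [map_mul]
    exact lt_of_le_of_lt (mul_le_of_le_one_left zero_le (hb1 j)) (hcon j)
  have hT := sum_section_mem hs hsK
    (mul_mem (one_mem _) ((le_sup_right : M ≤ ⊥ ⊔ M) (ha j)))
  obtain ⟨c, hc⟩ := IntermediateField.mem_bot.1 hT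
  rw [← hc] at hj
  have hc0 : c ≠ 0 := by
    rintro rfl
    rw [map_zero, map_zero] at hj
    exact absurd hj (by simp)
  refine ⟨algebraMap F M c⁻¹ * ⟨a j, ha j⟩, ?_, ?_⟩
  · change v (algebraMap F Ω c⁻¹ * a j) ≤ 1
    rw [map_mul, map_inv₀, map_inv₀]
    exact mul_le_one' (inv_le_one_of_one_le₀ hj) (ha1 j)
  · simp_rw [map_mul, AlgEquiv.commutes]
    rw [← Finset.mul_sum]
    have : ∑ q : Gal(M/F), q (⟨a j, ha j⟩ : M) = algebraMap F M c := by
      refine Subtype.ext ?_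
      rw [AddSubmonoidClass.coe_finsetSum]
      refine Eq.trans ?_ hc.symm
      refine Finset.sum_congr rfl fun q _ => ?_
      rw [one_mul, ← coe_restrictNormalHom M (s q) ⟨a j, ha j⟩, hs]
    rw [this, ← map_mul, inv_mul_cancel₀ hc0, map_one]

end Unramified

/-! ### The filtration by principal units. -/

section PrincipalUnits

variable {Ω : Type*} [Field Ω] {v : Valuation Ω ℝ≥0} {x y : Ω} {r : ℝ≥0}

lemma map_eq_one_of_sub_one_lt (hx : v (x - 1) < 1) : v x = 1 := by
  have := Valuation.map_one_add_of_lt v hx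
  rwa [add_sub_cancel] at this

lemma ne_zero_of_sub_one_lt (hx : v (x - 1) < 1) : x ≠ 0 := by
  rintro rfl
  have := map_eq_one_of_sub_one_lt hx
  rw [map_zero] at this
  exact zero_ne_one this

lemma mul_sub_one_le (hr : r < 1) (hx : v (x - 1) ≤ r) (hy : v (y - 1) ≤ r) :
    v (x * y - 1) ≤ r := by
  rw [show x * y - 1 = x * (y - 1) + (x - 1) by ring]
  refine (Valuation.map_add v _ _).trans (max_le ?_ hx)
  rw [map_mul, map_eq_one_of_sub_one_lt (hx.trans_lt hr), one_mul]
  exact hy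

lemma inv_sub_one_le (hr : r < 1) (hx : v (x - 1) ≤ r) : v (x⁻¹ - 1) ≤ r := by
  have h0 := ne_zero_of_sub_one_lt (hx.trans_lt hr)
  rw [show x⁻¹ - 1 = (1 - x) * x⁻¹ by field_simp, map_mul, map_inv₀,
    map_eq_one_of_sub_one_lt (hx.trans_lt hr), inv_one, mul_one, Valuation.map_sub_swap]
  exact hx

lemma div_sub_one_le (hr : r < 1) (hx : v (x - 1) ≤ r) (hy : v (y - 1) ≤ r) :
    v (x / y - 1) ≤ r := by
  rw [div_eq_mul_inv]
  exact mul_sub_one_le hr hx (inv_sub_one_le hr hy)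

lemma mul_sub_one_lt (hx : v (x - 1) < 1) (hy : v (y - 1) < 1) : v (x * y - 1) < 1 :=
  (mul_sub_one_le (max_lt hx hy) (le_max_left _ _) (le_max_right _ _)).trans_lt (max_lt hx hy)

lemma inv_sub_one_lt (hx : v (x - 1) < 1) : v (x⁻¹ - 1) < 1 :=
  (inv_sub_one_le hx le_rfl).trans_lt hx

lemma div_sub_one_lt (hx : v (x - 1) < 1) (hy : v (y - 1) < 1) : v (x / y - 1) < 1 :=
  (div_sub_one_le (max_lt hx hy) (le_max_left _ _) (le_max_right _ _)).trans_lt (max_lt hx hy)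

end PrincipalUnits

/-! ### Elements of norm one modulo $U_1^{\sigma-1}$. -/

/-- A cyclic totally wildly ramified extension `L/F` of degree `n` with prime element `π` and an
unramified Galois extension `T/F` in `Ω`, with an automorphism `σ` which is trivial on `T` and
generates `Gal(L/F)`. -/
structure CyclicSetting {F Ω : Type*} [Field F] [Field Ω] [Algebra F Ω] (v : Valuation Ω ℝ≥0)
    (L T : IntermediateField F Ω) (σ : Gal(Ω/F)) (n : ℕ) (π : Ω) : Prop where
  inv : ∀ (g : Gal(Ω/F)) (x : Ω), v (g x) = v x
  n_pos : 0 < n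
  apply_T : ∀ x ∈ T, σ x = x
  exists_pow : ∀ g : Gal(Ω/F), ∃ i : ℕ, ∀ x ∈ L, g x = (σ ^ i) x
  pow_eq : ∀ i : ℕ, (∀ x ∈ L, (σ ^ i) x = x) ↔ n ∣ i
  mem : π ∈ L
  pos : 0 < v π
  lt_one : v π < 1
  value : ∀ x ∈ L ⊔ T, x ≠ 0 → ∃ k : ℤ, v x = v π ^ k
  value_T : ∀ x ∈ T, x ≠ 0 → ∃ k : ℤ, v x = v π ^ (n * k)
  residue : ∀ x ∈ L ⊔ T, v x ≤ 1 → ∃ y ∈ T, v (x - y) < 1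
  wild : v (σ π / π - 1) < 1

namespace CyclicSetting

variable {F Ω : Type*} [Field F] [Field Ω] [Algebra F Ω] [IsGalois F Ω] {v : Valuation Ω ℝ≥0}
  {L T : IntermediateField F Ω} [Normal F L] [Normal F T] {σ : Gal(Ω/F)} {n : ℕ} {π : Ω}
  (S : CyclicSetting v L T σ n π)

include S

lemma ne_zero : π ≠ 0 := (Valuation.pos_iff v).1 S.pos

lemma mem_sup : π ∈ L ⊔ T := (le_sup_left : L ≤ L ⊔ T) S.mem

omit [IsGalois F Ω] S in
lemma apply_mem (g : Gal(Ω/F)) {x : Ω} (hx : x ∈ L ⊔ T) : g x ∈ L ⊔ T :=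
  apply_mem_of_normal (L ⊔ T) g hx

lemma pow_apply_T (i : ℕ) {x : Ω} (hx : x ∈ T) : (σ ^ i) x = x := by
  induction i with
  | zero => rfl
  | succ i ih => rw [pow_succ, AlgEquiv.mul_apply, S.apply_T x hx, ih]

lemma pow_n_apply {x : Ω} (hx : x ∈ L ⊔ T) : (σ ^ n) x = x :=
  eqOn_sup (g' := 1) ((S.pow_eq n).2 dvd_rfl) (fun _ hy => S.pow_apply_T n hy) hx

/-- `σ` commutes on `L T` with all automorphisms. -/
lemma comm (g : Gal(Ω/F)) {x : Ω} (hx : x ∈ L ⊔ T) : g (σ x) = σ (g x) := by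
  refine eqOn_sup (g := g * σ) (g' := σ * g) (fun y hy => ?_) (fun y hy => ?_) hx
  · obtain ⟨i, hi⟩ := S.exists_pow g
    rw [AlgEquiv.mul_apply, AlgEquiv.mul_apply, hi y hy, hi _ (apply_mem_of_normal L σ hy),
      ← AlgEquiv.mul_apply, ← AlgEquiv.mul_apply, ← pow_succ, ← pow_succ']
  · rw [AlgEquiv.mul_apply, AlgEquiv.mul_apply, S.apply_T y hy,
      S.apply_T _ (apply_mem_of_normal T g hy)]

lemma comm_pow (g : Gal(Ω/F)) (i : ℕ) {x : Ω} (hx : x ∈ L ⊔ T) :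
    g ((σ ^ i) x) = (σ ^ i) (g x) := by
  induction i generalizing x with
  | zero => rfl
  | succ i ih =>
    rw [pow_succ, AlgEquiv.mul_apply, AlgEquiv.mul_apply, ih (apply_mem σ hx), S.comm g hx]

/-- Every automorphism agrees on `T` with one that is trivial on `L`. -/
lemma exists_lift (g : Gal(Ω/F)) : ∃ h ∈ L.fixingSubgroup, ∀ x ∈ T, h x = g x := by
  obtain ⟨i, hi⟩ := S.exists_pow g
  refine ⟨g * (σ ^ i)⁻¹, ?_, fun x hx => ?_⟩
  · rw [IntermediateField.mem_fixingSubgroup_iff]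
    intro x hx
    rw [AlgEquiv.mul_apply, hi _ (apply_mem_of_normal L _ hx)]
    exact (σ ^ i).apply_symm_apply x
  · rw [AlgEquiv.mul_apply]
    congr 1
    exact (AlgEquiv.symm_apply_eq (σ ^ i)).2 (S.pow_apply_T i hx).symm

lemma mem_T_of_fixed {x : Ω} (hx : x ∈ L ⊔ T) (h : σ x = x) : x ∈ T := by
  refine mem_of_fixed fun g hg => ?_
  obtain ⟨i, hi⟩ := S.exists_pow g
  have h1 : g x = (σ ^ i) x := by
    refine eqOn_sup hi (fun y hy => ?_) hx
    rw [(IntermediateField.mem_fixingSubgroup_iff _ _).1 hg y hy, S.pow_apply_T i hy]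
  rw [h1]
  clear h1 hi
  induction i with
  | zero => rfl
  | succ i ih => rw [pow_succ, AlgEquiv.mul_apply, h, ih]

omit S in
variable (σ n) in
/-- The norm `∏ σⁱ x`. -/
noncomputable def nrm (x : Ω) : Ω := ∏ i ∈ Finset.range n, (σ ^ i) x

omit S in
lemma nrm_mul (x y : Ω) : nrm σ n (x * y) = nrm σ n x * nrm σ n y := by
  simp [nrm, Finset.prod_mul_distrib]

omit S in
lemma nrm_div (x y : Ω) : nrm σ n (x / y) = nrm σ n x / nrm σ n y := by
  simp [nrm, Finset.prod_div_distrib]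

lemma nrm_apply {x : Ω} (hx : x ∈ L ⊔ T) : nrm σ n (σ x) = nrm σ n x := by
  by_cases h0 : x = 0
  · simp [h0]
  have h1 := Finset.prod_range_succ (fun i => (σ ^ i) x) n
  rw [Finset.prod_range_succ', S.pow_n_apply hx, pow_zero] at h1
  have := mul_right_cancel₀ h0 h1
  simpa only [nrm, pow_succ, AlgEquiv.mul_apply] using this

lemma nrm_ne_zero {x : Ω} (hx : x ≠ 0) : nrm σ n x ≠ 0 :=
  Finset.prod_ne_zero_iff.2 fun i _ => (map_ne_zero (σ ^ i)).2 hx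

lemma nrm_apply_div {x : Ω} (hx : x ∈ L ⊔ T) (h0 : x ≠ 0) : nrm σ n (σ x / x) = 1 := by
  rw [nrm_div, S.nrm_apply hx, div_self (S.nrm_ne_zero h0)]

/-- Hilbert's Theorem 90 for `σ` on `L T`. -/
lemma hilbert90 {w : Ω} (hw : w ∈ L ⊔ T) (h1 : nrm σ n w = 1) :
    ∃ x ∈ L ⊔ T, x ≠ 0 ∧ w = σ x / x := by
  have hw0 : w ≠ 0 := by
    rintro rfl
    have h0 : nrm σ n (0 : Ω) = 0 := by
      rw [nrm, Finset.prod_eq_zero (Finset.mem_range.2 S.n_pos)]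
      simp
    exact zero_ne_one (h0.symm.trans h1)
  -- The resolvent $b=\sum_i P_i\,\sigma^i(c)$ satisfies $w\,\sigma b=b$, because $w\,\sigma
  -- P_i=P_{i+1}$ and $P_n=N w=1=P_0$. Independence of characters is used on $L$, where the powers
  -- of $\sigma$ below $n$ are distinct.
  let P : ℕ → Ω := fun i => ∏ j ∈ Finset.range i, (σ ^ j) w
  have hP : ∀ i, w * σ (P i) = P (i + 1) := by
    intro i
    simp only [P]
    rw [Finset.prod_range_succ', map_prod, mul_comm, pow_zero]
    simp only [pow_succ', AlgEquiv.mul_apply, AlgEquiv.one_apply]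
  have hPmem : ∀ i, P i ∈ L ⊔ T := fun i => prod_mem fun j _ => apply_mem _ hw
  let f : ℕ → L →* Ω := fun i => ((σ ^ i : Gal(Ω/F)) : Ω →* Ω).comp (algebraMap L Ω : L →* Ω)
  have hinj : Function.Injective fun i : Fin n => f i := by
    intro i j hij
    wlog hle : i ≤ j generalizing i j
    · exact (this hij.symm (le_of_not_ge hle)).symm
    have h2 : n ∣ (j : ℕ) - i := by
      refine (S.pow_eq _).1 fun x hx => ?_
      have h3 : (σ ^ (i : ℕ)) x = (σ ^ (j : ℕ)) x := DFunLike.congr_fun hij (⟨x, hx⟩ : L)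
      rw [← Nat.add_sub_cancel' (show (i : ℕ) ≤ j from hle), pow_add, AlgEquiv.mul_apply] at h3
      exact ((σ ^ (i : ℕ)).injective h3).symm
    have h4 := Nat.eq_zero_of_dvd_of_lt h2 (lt_of_le_of_lt (Nat.sub_le _ _) j.2)
    exact Fin.ext (le_antisymm hle (Nat.sub_eq_zero_iff_le.1 h4))
  have hli := (linearIndependent_monoidHom L Ω).comp _ hinj
  rw [Fintype.linearIndependent_iff] at hli
  obtain ⟨c, hc⟩ : ∃ c : L, ∑ i : Fin n, P i * (σ ^ (i : ℕ)) (c : Ω) ≠ 0 := by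
    by_contra! hcon
    have := hli (fun i => P i) (by
      ext c
      simpa [Finset.sum_apply, f] using hcon c) ⟨0, S.n_pos⟩
    simp [P] at this
  rw [Fin.sum_univ_eq_sum_range fun i => P i * (σ ^ i) (c : Ω)] at hc
  set b := ∑ i ∈ Finset.range n, P i * (σ ^ i) (c : Ω) with hb
  have hcm : (c : Ω) ∈ L ⊔ T := (le_sup_left : L ≤ L ⊔ T) c.2
  have hbm : b ∈ L ⊔ T := sum_mem fun i _ => mul_mem (hPmem i) (apply_mem _ hcm)
  have key : w * σ b = b := by
    have h2 := Finset.sum_range_succ (fun i => P i * (σ ^ i) (c : Ω)) n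
    rw [Finset.sum_range_succ', S.pow_n_apply hcm, show P n = 1 from h1, pow_zero] at h2
    have h3 : P 0 = 1 := by simp [P]
    rw [h3] at h2
    rw [hb]
    refine Eq.trans ?_ (add_right_cancel h2)
    rw [map_sum, Finset.mul_sum]
    refine Finset.sum_congr rfl fun i _ => ?_
    rw [map_mul, ← mul_assoc, hP, pow_succ', AlgEquiv.mul_apply]
  have hσb : σ b ≠ 0 := by simpa using hc
  refine ⟨b⁻¹, inv_mem hbm, inv_ne_zero hc, ?_⟩
  rw [map_inv₀, div_inv_eq_mul, inv_mul_eq_div, eq_div_iff hσb, key]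

/-- Every nonzero element of `L T` is the product of a power of `π`, an element of `T` and a
principal unit. -/
lemma exists_decomposition {x : Ω} (hx : x ∈ L ⊔ T) (hx0 : x ≠ 0) :
    ∃ (k : ℤ) (y z : Ω), y ∈ T ∧ y ≠ 0 ∧ z ∈ L ⊔ T ∧ v (z - 1) < 1 ∧ x = π ^ k * y * z := by
  obtain ⟨k, hk⟩ := S.value x hx hx0
  have hπk : π ^ k ≠ 0 := zpow_ne_zero _ S.ne_zero
  have hv1 : v (x / π ^ k) = 1 := by
    rw [map_div₀, map_zpow₀, hk, div_self]
    exact zpow_ne_zero _ S.pos.ne'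
  have hm : x / π ^ k ∈ L ⊔ T := div_mem hx (zpow_mem S.mem_sup k)
  -- The leading coefficient can be taken in $T$, where $\sigma$ acts trivially.
  obtain ⟨y, hy, hy1⟩ := S.residue _ hm hv1.le
  have hvy : v y = 1 := by
    rw [← hv1]
    refine Valuation.map_eq_of_sub_lt v ?_
    rw [Valuation.map_sub_swap, hv1]
    exact hy1
  have hy0 : y ≠ 0 := by
    rintro rfl
    rw [map_zero] at hvy
    exact zero_ne_one hvy
  refine ⟨k, y, x / π ^ k / y, hy, hy0, div_mem hm ((le_sup_right : T ≤ L ⊔ T) hy), ?_, ?_⟩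
  · rw [div_sub_one hy0, map_div₀, hvy, div_one]
    exact hy1
  · field_simp

omit S in
variable (v L T σ) in
/-- The group `U₁^(σ-1)` of quotients `σ w / w` with principal units `w` of `L T`. -/
def InV (x : Ω) : Prop := ∃ w ∈ L ⊔ T, v (w - 1) < 1 ∧ x = σ w / w

omit S in
lemma InV.mul {x y : Ω} (hx : InV v L T σ x) (hy : InV v L T σ y) : InV v L T σ (x * y) := by
  obtain ⟨a, ha, ha1, rfl⟩ := hx
  obtain ⟨b, hb, hb1, rfl⟩ := hy
  exact ⟨a * b, mul_mem ha hb, mul_sub_one_lt ha1 hb1, by rw [map_mul, div_mul_div_comm]⟩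

omit S in
lemma InV.inv {x : Ω} (hx : InV v L T σ x) : InV v L T σ x⁻¹ := by
  obtain ⟨a, ha, ha1, rfl⟩ := hx
  exact ⟨a⁻¹, inv_mem ha, inv_sub_one_lt ha1, by rw [map_inv₀, inv_div_inv, inv_div]⟩

omit S in
lemma InV.div {x y : Ω} (hx : InV v L T σ x) (hy : InV v L T σ y) : InV v L T σ (x / y) := by
  rw [div_eq_mul_inv]
  exact hx.mul hy.inv

omit S in
lemma InV.one : InV v L T σ 1 := ⟨1, one_mem _, by simp, by simp⟩

lemma apply_sub_one (g : Gal(Ω/F)) {x : Ω} (hx : v (x - 1) < 1) : v (g x - 1) < 1 := by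
  rwa [← map_one g, ← map_sub, S.inv]

lemma InV.apply (g : Gal(Ω/F)) {x : Ω} (hx : InV v L T σ x) : InV v L T σ (g x) := by
  obtain ⟨a, ha, ha1, rfl⟩ := hx
  exact ⟨g a, apply_mem g ha, S.apply_sub_one g ha1, by rw [map_div₀, S.comm g ha]⟩

lemma inV_pow_apply_div (i : ℕ) {x : Ω} (hx : x ∈ L ⊔ T) (hx1 : v (x - 1) < 1) :
    InV v L T σ ((σ ^ i) x / x) := by
  have h0 := ne_zero_of_sub_one_lt hx1
  induction i with
  | zero => simpa [h0] using InV.one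
  | succ i ih =>
    have h1 : InV v L T σ (σ ((σ ^ i) x) / (σ ^ i) x) :=
      ⟨_, apply_mem _ hx, S.apply_sub_one _ hx1, rfl⟩
    have h2 : (σ ^ i) x ≠ 0 := (map_ne_zero (σ ^ i)).2 h0
    have := h1.mul ih
    rwa [div_mul_div_cancel₀ h2, ← AlgEquiv.mul_apply, ← pow_succ'] at this

lemma pow_wild (i : ℕ) : v ((σ ^ i) π / π - 1) < 1 := by
  induction i with
  | zero => simp [S.ne_zero]
  | succ i ih =>
    have h2 : (σ ^ i) π ≠ 0 := (map_ne_zero (σ ^ i)).2 S.ne_zero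
    have := mul_sub_one_lt (S.apply_sub_one (σ ^ i) S.wild) ih
    rwa [map_div₀, div_mul_div_cancel₀ h2, ← AlgEquiv.mul_apply, ← pow_succ] at this

/-- `i ↦ σⁱ π / π` is multiplicative modulo `U₁^(σ-1)`. -/
lemma inV_pow_add (i j : ℕ) :
    InV v L T σ ((σ ^ (i + j)) π / π / ((σ ^ i) π / π * ((σ ^ j) π / π))) := by
  have h := S.inV_pow_apply_div i (x := (σ ^ j) π / π)
    (div_mem (apply_mem _ S.mem_sup) S.mem_sup) (S.pow_wild j)
  have hi : (σ ^ i) π ≠ 0 := (map_ne_zero (σ ^ i)).2 S.ne_zero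
  have hj : (σ ^ j) π ≠ 0 := (map_ne_zero (σ ^ j)).2 S.ne_zero
  have h0 := S.ne_zero
  convert h using 1
  rw [pow_add, AlgEquiv.mul_apply, map_div₀]
  field_simp

lemma inV_pow_div (i : ℕ) : InV v L T σ ((σ ^ i) π / π / (σ π / π) ^ i) := by
  have h0 := S.ne_zero
  induction i with
  | zero => simpa [h0] using InV.one
  | succ i ih =>
    have h := (S.inV_pow_add i 1).mul ih
    have hi : (σ ^ i) π ≠ 0 := (map_ne_zero (σ ^ i)).2 h0
    have h1 : σ π ≠ 0 := by simpa using h0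
    convert h using 1
    rw [pow_one, pow_succ (σ π / π)]
    have h2 : (σ π / π) ^ i ≠ 0 := pow_ne_zero _ (div_ne_zero h1 h0)
    field_simp

/-- `σⁱ π / π` determines `σⁱ` on `L` modulo `U₁^(σ-1)`. -/
lemma dvd_of_inV {i : ℕ} (h : InV v L T σ ((σ ^ i) π / π)) : n ∣ i := by
  have h0 := S.ne_zero
  have hσ0 : σ π ≠ 0 := by simpa using h0
  have hσi : (σ ^ i) π ≠ 0 := (map_ne_zero (σ ^ i)).2 h0
  have h1 := h.div (S.inV_pow_div i)
  rw [div_div_cancel₀ (div_ne_zero hσi h0)] at h1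
  obtain ⟨w, hw, hw1, hw2⟩ := h1
  have hw0 := ne_zero_of_sub_one_lt hw1
  have hσw : σ w ≠ 0 := by simpa using hw0
  -- From $(\sigma\pi/\pi)^i=\sigma w/w$ the element $\pi^i/w$ is fixed by $\sigma$, hence lies in
  -- $T$. Its valuation is $v(\pi)^i$, so $n\mid i$.
  have hT : π ^ i / w ∈ T := by
    refine S.mem_T_of_fixed (div_mem (pow_mem S.mem_sup i) hw) ?_
    rw [map_div₀, map_pow]
    rw [div_pow] at hw2
    field_simp at hw2 ⊢
    linear_combination hw2
  obtain ⟨k, hk⟩ := S.value_T _ hT (div_ne_zero (pow_ne_zero _ h0) hw0)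
  rw [map_div₀, map_pow, map_eq_one_of_sub_one_lt hw1, div_one, ← zpow_natCast] at hk
  have := zpow_right_injective₀ S.pos S.lt_one.ne hk
  exact Int.natCast_dvd_natCast.1 ⟨k, this⟩

/-- An element of norm one is congruent to some `σⁱ π / π` modulo `U₁^(σ-1)`. -/
lemma exists_pow_of_nrm_eq_one {w : Ω} (hw : w ∈ L ⊔ T) (h1 : nrm σ n w = 1) :
    ∃ i : ℕ, InV v L T σ (w / ((σ ^ i) π / π)) := by
  obtain ⟨x, hx, hx0, rfl⟩ := S.hilbert90 hw h1
  obtain ⟨k, y, z, hy, hy0, hz, hz1, rfl⟩ := S.exists_decomposition hx hx0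
  have h0 := S.ne_zero
  have hσ0 : σ π ≠ 0 := by simpa using h0
  have hz0 := ne_zero_of_sub_one_lt hz1
  have hw' : σ (π ^ k * y * z) / (π ^ k * y * z) = (σ π / π) ^ k * (σ z / z) := by
    rw [map_mul, map_mul, map_zpow₀, S.apply_T y hy, div_zpow]
    have : π ^ k ≠ 0 := zpow_ne_zero _ h0
    field_simp
  rw [hw']
  have hn0 : (n : ℤ) ≠ 0 := by exact_mod_cast S.n_pos.ne'
  obtain ⟨i, hi⟩ := Int.eq_ofNat_of_zero_le (Int.emod_nonneg k hn0)
  -- Since $\sigma^n\pi=\pi$, the $n$-th power of $\sigma\pi/\pi$ lies in $U_1^{\sigma-1}$, and the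
  -- integer exponent $k$ may be replaced by its remainder modulo $n$.
  have hpn : InV v L T σ ((σ π / π) ^ n) := by
    have := (S.inV_pow_div n).inv
    rwa [S.pow_n_apply S.mem_sup, div_self h0, one_div, inv_inv] at this
  have hpnk : ∀ m : ℤ, InV v L T σ (((σ π / π) ^ n) ^ m) := by
    intro m
    have hnat : ∀ m : ℕ, InV v L T σ (((σ π / π) ^ n) ^ m) := by
      intro m
      induction m with
      | zero => simpa using InV.one
      | succ m ih => rw [pow_succ]; exact ih.mul hpn
    obtain ⟨m, rfl | rfl⟩ := m.eq_nat_or_neg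
    · rw [zpow_natCast]; exact hnat m
    · rw [zpow_neg, zpow_natCast]; exact (hnat m).inv
  refine ⟨i, ?_⟩
  have h2 := ((hpnk (k / n)).mul (S.inV_pow_div i).inv).mul ⟨z, hz, hz1, rfl⟩
  convert h2 using 1
  have hk : k = (n : ℤ) * (k / n) + (i : ℤ) := by
    rw [← hi]
    exact (Int.mul_ediv_add_emod k n).symm
  have hσi : (σ ^ i) π ≠ 0 := (map_ne_zero (σ ^ i)).2 h0
  have : (σ π / π) ^ k = ((σ π / π) ^ n) ^ (k / n) * (σ π / π) ^ i := by
    conv_lhs => rw [hk]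
    rw [zpow_add₀ (div_ne_zero hσ0 h0), zpow_mul, zpow_natCast, zpow_natCast]
  rw [this, inv_div]
  simp only [div_eq_mul_inv]
  ring

end CyclicSetting

/-! ### Invariants of $U_1/U_1^{\sigma-1}$ by successive approximation. -/

/-- A cyclic setting over a complete base, in which `T` is a union of finite unramified
extensions. -/
structure CompleteSetting {F Ω : Type*} [Field F] [Field Ω] [Algebra F Ω] (v : Valuation Ω ℝ≥0)
    (L T : IntermediateField F Ω) (σ : Gal(Ω/F)) (n : ℕ) (π : Ω) : Prop
    extends CyclicSetting v L T σ n π where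
  finite : FiniteDimensional F L
  complete : ∀ (E : IntermediateField F Ω), FiniteDimensional F E →
    ∀ (x : ℕ → Ω) (r : ℝ≥0), r < 1 → (∀ i, x i ∈ E) → (∀ i, v (x (i + 1) - x i) ≤ r ^ i) →
      ∃ y ∈ E, ∀ i, v (y - x i) ≤ r ^ i
  exists_level : ∀ s : Finset Ω, (∀ x ∈ s, x ∈ L ⊔ T) → ∃ M ≤ T, FiniteDimensional F M ∧
    Normal F M ∧ TrivialInertia v M ∧ ∀ x ∈ s, x ∈ L ⊔ M
  residue_L : ∀ x ∈ L, v x ≤ 1 → ∃ c : F, v (x - algebraMap F Ω c) < 1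
  exists_prime : ∃ c : F, v (algebraMap F Ω c) = v π ^ n

namespace CompleteSetting

variable {F Ω : Type*} [Field F] [Field Ω] [Algebra F Ω] [IsGalois F Ω] {v : Valuation Ω ℝ≥0}
  {L T : IntermediateField F Ω} [Normal F L] [Normal F T] {σ : Gal(Ω/F)} {n : ℕ} {π : Ω}
  (S : CompleteSetting v L T σ n π)

include S

/-- Discreteness of the values of $LT$: a strict inequality gains one step of the filtration. -/
lemma le_pow_succ {z : Ω} (hz : z ∈ L ⊔ T) {i : ℕ} (h : v z < v π ^ i) : v z ≤ v π ^ (i + 1) := by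
  by_cases h0 : z = 0
  · simp [h0]
  obtain ⟨k, hk⟩ := S.value z hz h0
  rw [hk, ← zpow_natCast] at h ⊢
  rw [zpow_lt_zpow_iff_right_of_lt_one₀ S.pos S.lt_one] at h
  rw [zpow_le_zpow_iff_right_of_lt_one₀ S.pos S.lt_one]
  push_cast
  omega

/-- Lifts trivial on $L$ let the traces and dual systems of $M/F$ act on $LM$ over $L$. -/
lemma exists_section (M : IntermediateField F Ω) [Normal F M] (hMT : M ≤ T) :
    ∃ s : Gal(M/F) → Gal(Ω/F), (∀ q, AlgEquiv.restrictNormalHom M (s q) = q) ∧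
      ∀ q, s q ∈ L.fixingSubgroup := by
  have : ∀ q : Gal(M/F), ∃ g ∈ L.fixingSubgroup, AlgEquiv.restrictNormalHom M g = q := by
    intro q
    obtain ⟨γ, rfl⟩ := AlgEquiv.restrictNormalHom_surjective (F := F) (K₁ := M) Ω q
    obtain ⟨h, hL, hT⟩ := S.exists_lift γ
    exact ⟨h, hL, restrictNormalHom_eq_iff.2 fun x hx => hT x (hMT hx)⟩
  choose s h1 h2 using this
  exact ⟨s, h2, h1⟩

variable {M : IntermediateField F Ω} [Normal F M] [FiniteDimensional F M]

/-- Improvement of an approximation at a level divisible by the ramification index. -/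
lemma exists_improve_of_dvd (hMT : M ≤ T) (hM : TrivialInertia v M) {i : ℕ} (hi : 1 ≤ i)
    (hni : n ∣ i) {x : Ω} (hx : x ∈ L ⊔ M) (hx1 : v (x - 1) ≤ v π ^ i) :
    ∃ x' ∈ L ⊔ M, v (x' - 1) ≤ v π ^ (i + 1) ∧ σ x / x = σ x' / x' := by
  obtain ⟨j, rfl⟩ := hni
  obtain ⟨c, hc⟩ := S.exists_prime
  obtain ⟨s, hs, hsL⟩ := S.exists_section M hMT
  -- $d\in F$ has the valuation of the level, so $x\equiv1+yd$ with $y\in M$. The factor $1+yd$ is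
  -- fixed by $\sigma$, so dividing $x$ by it leaves $\sigma x/x$ unchanged.
  set d := algebraMap F Ω c ^ j with hd
  have hvd : v d = v π ^ (n * j) := by rw [hd, map_pow, hc, pow_mul]
  have hpos : 0 < v π ^ (n * j) := pow_pos S.pos _
  have hlt : v π ^ (n * j) < 1 := pow_lt_one₀ zero_le S.lt_one (by omega)
  have hd0 : d ≠ 0 := (Valuation.pos_iff v).1 (hvd ▸ hpos)
  have hdM : d ∈ M := pow_mem (M.algebraMap_mem c) j
  have hM' : M ≤ L ⊔ M := le_sup_right
  have hLM : L ⊔ M ≤ L ⊔ T := sup_le_sup_left hMT L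
  obtain ⟨y, hy, hy1⟩ := hM.exists_residue S.inv hs hsL S.residue_L (x := (x - 1) / d)
    (div_mem (sub_mem hx (one_mem _)) (hM' hdM)) (by
      rw [map_div₀, hvd]
      exact div_le_one_of_le₀ hx1 zero_le)
  have hvy : v y ≤ 1 := by
    rw [show y = (x - 1) / d - ((x - 1) / d - y) by ring]
    refine (Valuation.map_sub v _ _).trans (max_le ?_ hy1.le)
    rw [map_div₀, hvd]
    exact div_le_one_of_le₀ hx1 zero_le
  have hyd : v (y * d + 1 - 1) < 1 := by
    rw [add_sub_cancel_right, map_mul]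
    exact (mul_le_of_le_one_left zero_le hvy).trans_lt (hvd ▸ hlt)
  have he0 := ne_zero_of_sub_one_lt hyd
  have heM : y * d + 1 ∈ M := add_mem (mul_mem hy hdM) (one_mem _)
  have hx0 := ne_zero_of_sub_one_lt (hx1.trans_lt hlt)
  refine ⟨x / (y * d + 1), div_mem hx (hM' heM), ?_, ?_⟩
  · refine S.le_pow_succ (hLM (sub_mem (div_mem hx (hM' heM)) (one_mem _))) ?_
    rw [div_sub_one he0, map_div₀, map_eq_one_of_sub_one_lt hyd, div_one,
      show x - (y * d + 1) = ((x - 1) / d - y) * d by field_simp; ring, map_mul, hvd]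
    exact mul_lt_of_lt_one_left hpos hy1
  · rw [map_div₀, S.apply_T _ (hMT heM)]
    field_simp

omit [Normal F M] [FiniteDimensional F M] in
/-- Solutions `x_g` of `g u / u = σ x_g / x_g` form a cocycle modulo higher principal units. -/
lemma cocycle_le (hMT : M ≤ T) {i : ℕ} (hi : 1 ≤ i) (hni : ¬ n ∣ i) {u : Ω}
    (hu0 : u ≠ 0) {g h : Gal(Ω/F)} {a b c : Ω} (ha : a ∈ L ⊔ M) (hb : b ∈ L ⊔ M) (hc : c ∈ L ⊔ M)
    (ha1 : v (a - 1) ≤ v π ^ i) (hb1 : v (b - 1) ≤ v π ^ i) (hc1 : v (c - 1) ≤ v π ^ i)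
    (hga : g u / u = σ a / a) (hhb : h u / u = σ b / b) (hgc : (g * h) u / u = σ c / c) :
    v ((c - 1) - (a - 1) - g (b - 1)) ≤ v π ^ (i + 1) := by
  have hlt : v π ^ i < 1 := pow_lt_one₀ zero_le S.lt_one (by omega)
  have hLM : L ⊔ M ≤ L ⊔ T := sup_le_sup_left hMT L
  have hgb1 : v (g b - 1) ≤ v π ^ i := by rwa [← map_one g, ← map_sub, S.inv]
  have ha0 := ne_zero_of_sub_one_lt (ha1.trans_lt hlt)
  have hb0 := ne_zero_of_sub_one_lt (hb1.trans_lt hlt)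
  have hc0 := ne_zero_of_sub_one_lt (hc1.trans_lt hlt)
  have hgb0 := ne_zero_of_sub_one_lt (hgb1.trans_lt hlt)
  have hgu0 : g u ≠ 0 := (map_ne_zero g).2 hu0
  have hghu0 : g (h u) ≠ 0 := (map_ne_zero g).2 ((map_ne_zero h).2 hu0)
  set m := c / (a * g b) with hm
  have hab1 : v (a * g b - 1) ≤ v π ^ i := mul_sub_one_le hlt ha1 hgb1
  have hm1 : v (m - 1) ≤ v π ^ i := div_sub_one_le hlt hc1 hab1
  have hmem : m ∈ L ⊔ T :=
    div_mem (hLM hc) (mul_mem (hLM ha) (CyclicSetting.apply_mem g (hLM hb)))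
  -- The three equations make $m=c/(a\cdot g b)$ fixed by $\sigma$, hence an element of $T$. The
  -- exponents of $T$ are multiples of $n$ and $n\nmid i$, so $m$ lies one level deeper.
  have hσm : σ m = m := by
    have e1 : σ a = a * (g u / u) := by rw [hga]; field_simp
    have e2 : σ c = c * (g (h u) / u) := by
      rw [← AlgEquiv.mul_apply, hgc]; field_simp
    have e3 : σ (g b) = g b * (g (h u) / g u) := by
      have hσb : σ b = b * (h u / u) := by rw [hhb]; field_simp
      rw [← S.comm g (hLM hb), hσb, map_mul, map_div₀]
    rw [hm, map_div₀, map_mul, e1, e2, e3]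
    field_simp
  have hmT : m - 1 ∈ T := sub_mem (S.mem_T_of_fixed hmem hσm) (one_mem _)
  have hm2 : v (m - 1) ≤ v π ^ (i + 1) := by
    refine S.le_pow_succ ((le_sup_right : T ≤ L ⊔ T) hmT) (lt_of_le_of_ne hm1 fun heq => ?_)
    have hne : m - 1 ≠ 0 := (Valuation.pos_iff v).1 (heq ▸ pow_pos S.pos i)
    obtain ⟨k, hk⟩ := S.value_T _ hmT hne
    rw [heq, ← zpow_natCast] at hk
    exact hni (Int.natCast_dvd_natCast.1 ⟨k, zpow_right_injective₀ S.pos S.lt_one.ne hk⟩)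
  have hdec : (c - 1) - (a - 1) - g (b - 1) = (m - 1) * (a * g b) + (a - 1) * (g b - 1) := by
    rw [map_sub, map_one, hm]
    field_simp
    ring
  rw [hdec]
  refine (Valuation.map_add v _ _).trans (max_le ?_ ?_)
  · rw [map_mul, map_eq_one_of_sub_one_lt (hab1.trans_lt hlt), mul_one]
    exact hm2
  · rw [map_mul]
    refine (mul_le_mul' ha1 hgb1).trans ?_
    rw [← pow_add]
    exact pow_le_pow_of_le_one zero_le S.lt_one.le (by omega)

/-- One step of the successive approximation. -/
lemma exists_improve (hMT : M ≤ T) (hM : TrivialInertia v M) {i : ℕ} (hi : 1 ≤ i)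
    {u : Ω} (hu : u ∈ L ⊔ M) (hu0 : u ≠ 0) (h : ∀ g ∈ L.fixingSubgroup,
      ∃ x ∈ L ⊔ M, v (x - 1) ≤ v π ^ i ∧ g u / u = σ x / x) :
    ∃ w ∈ L ⊔ M, v (w - 1) ≤ v π ^ i ∧ ∀ g ∈ L.fixingSubgroup,
      ∃ x ∈ L ⊔ M, v (x - 1) ≤ v π ^ (i + 1) ∧
        g (u * (σ w / w)) / (u * (σ w / w)) = σ x / x := by
  have hlt : v π ^ i < 1 := pow_lt_one₀ zero_le S.lt_one (by omega)
  have hLM : L ⊔ M ≤ L ⊔ T := sup_le_sup_left hMT L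
  -- If $n\mid i$, then $u$ needs no correction: the solutions $x$ themselves can be improved.
  by_cases hni : n ∣ i
  · refine ⟨1, one_mem _, by simp, fun g hg => ?_⟩
    obtain ⟨x, hx, hx1, hgx⟩ := h g hg
    obtain ⟨x', hx', hx1', he⟩ := S.exists_improve_of_dvd hMT hM hi hni hx hx1
    exact ⟨x', hx', hx1', by rw [map_one, div_one, mul_one, hgx, he]⟩
  obtain ⟨s, hs, hsL⟩ := S.exists_section M hMT
  obtain ⟨t, ht1, ht⟩ := hM.exists_trace_eq_one S.inv
  -- The solution is chosen as a function of $g u/u$ rather than of $g$, so that automorphisms with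
  -- the same effect on $u$ share it. The reindexing of $b$ below depends on this.
  have hc : ∃ c : Ω → Ω, ∀ y, (∃ x ∈ L ⊔ M, v (x - 1) ≤ v π ^ i ∧ y = σ x / x) →
      c y ∈ L ⊔ M ∧ v (c y - 1) ≤ v π ^ i ∧ y = σ (c y) / c y := by
    choose! c hc using fun (y : Ω) (hy : ∃ x ∈ L ⊔ M, v (x - 1) ≤ v π ^ i ∧ y = σ x / x) => hy
    exact ⟨c, hc⟩
  obtain ⟨c, hc⟩ := hc
  let X : Gal(Ω/F) → Ω := fun g => c (g u / u)
  have hX : ∀ g ∈ L.fixingSubgroup, X g ∈ L ⊔ M ∧ v (X g - 1) ≤ v π ^ i ∧ g u / u = σ (X g) / X g :=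
    fun g hg => hc _ (h g hg)
  have htq : ∀ q : Gal(M/F), ((q t : M) : Ω) ∈ L ⊔ M := fun q => (le_sup_right : M ≤ L ⊔ M) (q t).2
  have htv : ∀ q : Gal(M/F), v ((q t : M) : Ω) ≤ 1 := by
    intro q
    rw [← hs q, coe_restrictNormalHom, S.inv]
    exact ht1
  have htΩ : ∑ q : Gal(M/F), ((q t : M) : Ω) = 1 := by
    rw [← AddSubmonoidClass.coe_finsetSum, ht]
    rfl
  -- $X_g-1$ is an additive cocycle modulo level $i+1$. Weighting it by the conjugates of $t$, which
  -- sum to $1$, gives $g b-b\equiv-(X_g-1)$.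
  set b := ∑ q : Gal(M/F), (X (s q) - 1) * ((q t : M) : Ω) with hb
  have hbm : b ∈ L ⊔ M :=
    sum_mem fun q _ => mul_mem (sub_mem (hX _ (hsL q)).1 (one_mem _)) (htq q)
  have hbv : v b ≤ v π ^ i := Valuation.map_sum_le v fun q _ => by
    rw [map_mul]
    exact (mul_le_of_le_one_right zero_le (htv q)).trans (hX _ (hsL q)).2.1
  have hgb : ∀ g ∈ L.fixingSubgroup, v (g b - b + (X g - 1)) ≤ v π ^ (i + 1) := by
    intro g hg
    let γ := AlgEquiv.restrictNormalHom M g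
    have e1 : g b = ∑ q : Gal(M/F), g (X (s q) - 1) * (((γ * q) t : M) : Ω) := by
      rw [hb, map_sum]
      refine Finset.sum_congr rfl fun q _ => ?_
      rw [map_mul, AlgEquiv.mul_apply, coe_restrictNormalHom]
    have e2 : b = ∑ q : Gal(M/F), (X (g * s q) - 1) * (((γ * q) t : M) : Ω) := by
      rw [hb]
      refine (Fintype.sum_equiv (Equiv.mulLeft γ) _ _ fun q => ?_).symm
      have : (g * s q) u = s (γ * q) u := by
        refine eqOn_sup (fun x hx => ?_) (fun x hx => ?_) hu
        · exact ((IntermediateField.mem_fixingSubgroup_iff _ _).1 (mul_mem hg (hsL q)) x hx).trans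
            ((IntermediateField.mem_fixingSubgroup_iff _ _).1 (hsL _) x hx).symm
        · refine restrictNormalHom_eq_iff.1 ?_ x hx
          rw [map_mul, hs, hs]
      simp only [X, this, Equiv.coe_mulLeft]
    have e3 : X g - 1 = ∑ q : Gal(M/F), (X g - 1) * (((γ * q) t : M) : Ω) := by
      rw [← Finset.mul_sum, Fintype.sum_equiv (Equiv.mulLeft γ) (fun q => (((γ * q) t : M) : Ω))
        (fun q => ((q t : M) : Ω)) (fun q => rfl), htΩ, mul_one]
    have e4 : g b - b + (X g - 1) = ∑ q : Gal(M/F),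
        -((X (g * s q) - 1) - (X g - 1) - g (X (s q) - 1)) * (((γ * q) t : M) : Ω) := by
      conv_lhs => rw [e1, e2, e3]
      rw [← Finset.sum_sub_distrib, ← Finset.sum_add_distrib]
      refine Finset.sum_congr rfl fun q _ => ?_
      ring
    rw [e4]
    refine Valuation.map_sum_le v fun q _ => ?_
    rw [map_mul, Valuation.map_neg]
    refine (mul_le_of_le_one_right zero_le (htv _)).trans ?_
    obtain ⟨a1, a2, a3⟩ := hX g hg
    obtain ⟨b1, b2, b3⟩ := hX _ (hsL q)
    obtain ⟨c1, c2, c3⟩ := hX _ (mul_mem hg (hsL q))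
    exact S.cocycle_le hMT hi hni hu0 a1 b1 c1 a2 b2 c2 a3 b3 c3
  have hw1 : v (1 + b - 1) ≤ v π ^ i := by rwa [add_sub_cancel_left]
  have hw0 := ne_zero_of_sub_one_lt (hw1.trans_lt hlt)
  have hwm : 1 + b ∈ L ⊔ M := add_mem (one_mem _) hbm
  refine ⟨1 + b, hwm, hw1, fun g hg => ?_⟩
  obtain ⟨a1, a2, a3⟩ := hX g hg
  have hX0 := ne_zero_of_sub_one_lt (a2.trans_lt hlt)
  -- As $g$ and $\sigma$ commute on $LT$, multiplying $u$ by $\sigma w/w$ replaces $X_g$ by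
  -- $X_g\cdot g w/w$.
  refine ⟨X g * g (1 + b) / (1 + b),
    div_mem (mul_mem a1 (apply_mem_of_normal _ g hwm)) hwm, ?_, ?_⟩
  · rw [div_sub_one hw0, map_div₀, map_eq_one_of_sub_one_lt (hw1.trans_lt hlt), div_one,
      show X g * g (1 + b) - (1 + b) = (g b - b + (X g - 1)) + (X g - 1) * g b by
        rw [map_add, map_one]; ring]
    refine (Valuation.map_add v _ _).trans (max_le (hgb g hg) ?_)
    rw [map_mul, S.inv]
    refine (mul_le_mul' a2 hbv).trans ?_
    rw [← pow_add]
    exact pow_le_pow_of_le_one zero_le S.lt_one.le (by omega)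
  · have hσw : σ (1 + b) ≠ 0 := (map_ne_zero σ).2 hw0
    have hgw : g (1 + b) ≠ 0 := (map_ne_zero g).2 hw0
    have hgσw : σ (g (1 + b)) ≠ 0 := (map_ne_zero σ).2 hgw
    have hσX : σ (X g) = X g * (g u / u) := by rw [a3]; field_simp
    have hgu0 : g u ≠ 0 := (map_ne_zero g).2 hu0
    rw [map_mul g, map_div₀ g, S.comm g (hLM hwm), map_div₀ σ, map_mul σ, hσX]
    field_simp

/-- The `Gal(L T/L)`-invariants of the quotient of the principal units of `L T` by `U₁^(σ-1)` come
from principal units of `L`. -/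
theorem exists_nrm_eq {u : Ω} (hu : u ∈ L ⊔ T) (hu1 : v (u - 1) < 1)
    (h : ∀ g ∈ L.fixingSubgroup, CyclicSetting.InV v L T σ (g u / u)) :
    ∃ w ∈ L, v (w - 1) < 1 ∧ CyclicSetting.nrm σ n u = CyclicSetting.nrm σ n w := by
  classical
  have := S.finite
  have hu0 := ne_zero_of_sub_one_lt hu1
  -- a finite level containing `u` and solutions for all conjugates of `u`
  obtain ⟨M, hMT, hMf, hMn, hM, hMu⟩ : ∃ M ≤ T, FiniteDimensional F M ∧ Normal F M ∧
      TrivialInertia v M ∧ u ∈ L ⊔ M ∧ ∀ g ∈ L.fixingSubgroup,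
        ∃ x ∈ L ⊔ M, v (x - 1) < 1 ∧ g u / u = σ x / x := by
    choose! c hc using fun (y : Ω) (hy : CyclicSetting.InV v L T σ y) => hy
    -- $u$ has finitely many conjugates, so solutions chosen as functions of $g u/u$ are finite in
    -- number.
    have hfin : (Set.range fun g : L.fixingSubgroup => c ((g : Gal(Ω/F)) u / u)).Finite := by
      have h1 : {y | ∃ g : Gal(Ω/F), g u = y}.Finite := by
        refine (Polynomial.rootSet_finite (minpoly F u) Ω).subset ?_
        rintro y ⟨g, rfl⟩
        rw [Polynomial.mem_rootSet]
        refine ⟨minpoly.ne_zero (Algebra.IsIntegral.isIntegral u), ?_⟩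
        change Polynomial.aeval ((g : Ω →ₐ[F] Ω) u) _ = 0
        rw [Polynomial.aeval_algHom_apply, minpoly.aeval, map_zero]
      refine (h1.image fun y => c (y / u)).subset ?_
      rintro _ ⟨g, rfl⟩
      exact ⟨_, ⟨g, rfl⟩, rfl⟩
    obtain ⟨M, hMT, hMf, hMn, hM, hs⟩ := S.exists_level (insert u hfin.toFinset) (by
      intro x hx
      rw [Finset.mem_insert, Set.Finite.mem_toFinset] at hx
      rcases hx with rfl | ⟨g, rfl⟩
      · exact hu
      · exact (hc _ (h g g.2)).1)
    refine ⟨M, hMT, hMf, hMn, hM, hs u (Finset.mem_insert_self _ _), fun g hg => ?_⟩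
    refine ⟨c (g u / u), hs _ (Finset.mem_insert_of_mem ?_), (hc _ (h g hg)).2⟩
    rw [Set.Finite.mem_toFinset]
    exact ⟨⟨g, hg⟩, rfl⟩
  obtain ⟨huM, hsol⟩ := hMu
  have hLM : L ⊔ M ≤ L ⊔ T := sup_le_sup_left hMT L
  -- After multiplication of $u$ by $\sigma W/W$, all solutions can be taken at level $i+1$. Passing
  -- to the next $W$ multiplies it by a unit of level $i+1$, so the corrections converge in the
  -- complete field $LM$.
  let P : ℕ → Ω → Prop := fun i W => W ∈ L ⊔ M ∧ v (W - 1) < 1 ∧ ∀ g ∈ L.fixingSubgroup,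
    ∃ x ∈ L ⊔ M, v (x - 1) ≤ v π ^ (i + 1) ∧
      g (u * (σ W / W)) / (u * (σ W / W)) = σ x / x
  have hP0 : P 0 1 := by
    refine ⟨one_mem _, by simp, fun g hg => ?_⟩
    obtain ⟨x, hx, hx1, hgx⟩ := hsol g hg
    refine ⟨x, hx, S.le_pow_succ (hLM (sub_mem hx (one_mem _))) (by simpa using hx1), ?_⟩
    rw [map_one, div_one, mul_one, hgx]
  have hPs : ∀ i W, P i W → ∃ W', P (i + 1) W' ∧ v (W' - W) ≤ v π ^ i := by
    rintro i W ⟨hW, hW1, hWg⟩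
    have hW0 := ne_zero_of_sub_one_lt hW1
    have hσW0 : σ W ≠ 0 := (map_ne_zero σ).2 hW0
    obtain ⟨w, hw, hw1, hwg⟩ := S.exists_improve hMT hM (Nat.le_add_left 1 i)
      (mul_mem huM (div_mem (apply_mem_of_normal _ σ hW) hW))
      (mul_ne_zero hu0 (div_ne_zero hσW0 hW0)) hWg
    have hlt : v π ^ (i + 1) < 1 := pow_lt_one₀ zero_le S.lt_one (by omega)
    refine ⟨W * w, ⟨mul_mem hW hw, mul_sub_one_lt hW1 (hw1.trans_lt hlt), fun g hg => ?_⟩, ?_⟩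
    · obtain ⟨x, hx, hx1, hgx⟩ := hwg g hg
      refine ⟨x, hx, hx1, ?_⟩
      rw [show σ (W * w) / (W * w) = σ W / W * (σ w / w) by rw [map_mul, div_mul_div_comm],
        ← mul_assoc, hgx]
    · rw [show W * w - W = W * (w - 1) by ring, map_mul, map_eq_one_of_sub_one_lt hW1, one_mul]
      exact hw1.trans (pow_le_pow_of_le_one zero_le S.lt_one.le (by omega))
  choose! f hf1 hf2 using hPs
  let W : ℕ → Ω := fun i => Nat.rec 1 f i
  have hWP : ∀ i, P i (W i) := by
    intro i
    induction i with
    | zero => exact hP0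
    | succ i ih => exact hf1 i _ ih
  obtain ⟨Z, hZ, hZW⟩ := S.complete (L ⊔ M) inferInstance W (v π) S.lt_one
    (fun i => (hWP i).1) (fun i => hf2 i _ (hWP i))
  have hZ1 : v (Z - 1) < 1 := by
    rw [← sub_add_sub_cancel Z (W 1)]
    refine (Valuation.map_add v _ _).trans_lt (max_lt ((hZW 1).trans_lt ?_) (hWP 1).2.1)
    rw [pow_one]
    exact S.lt_one
  have hZ0 := ne_zero_of_sub_one_lt hZ1
  have hσZ1 := S.apply_sub_one σ hZ1
  -- In the limit $g y-y$ is arbitrarily small for all $g$ fixing $L$, so $y\in L$. The factor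
  -- $\sigma Z/Z$ has norm one.
  set y := u * (σ Z / Z) with hy
  have hy1 : v (y - 1) < 1 := mul_sub_one_lt hu1 (div_sub_one_lt hσZ1 hZ1)
  have hyL : y ∈ L := by
    refine mem_of_fixed fun g hg => ?_
    have key : ∀ i : ℕ, 1 ≤ i → v (g y - y) ≤ v π ^ i := by
      intro i hi
      have hlt : v π ^ i < 1 := pow_lt_one₀ zero_le S.lt_one (by omega)
      obtain ⟨hW, hW1, hWg⟩ := hWP i
      have hW0 := ne_zero_of_sub_one_lt hW1
      have hσW1 := S.apply_sub_one σ hW1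
      have hσW0 := ne_zero_of_sub_one_lt hσW1
      obtain ⟨x, hx, hx1, hgx⟩ := hWg g hg
      have hx1' := hx1.trans (pow_le_pow_of_le_one zero_le S.lt_one.le (Nat.le_succ i))
      set yi := u * (σ (W i) / W i) with hyi
      have hyi1 : v (yi - 1) < 1 := mul_sub_one_lt hu1 (div_sub_one_lt hσW1 hW1)
      have hyi0 := ne_zero_of_sub_one_lt hyi1
      have d1 : v (g yi - yi) ≤ v π ^ i := by
        have h2 : v (g yi / yi - 1) ≤ v π ^ i := by
          rw [hgx]
          refine div_sub_one_le hlt ?_ hx1'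
          rwa [← map_one σ, ← map_sub, S.inv]
        rwa [div_sub_one hyi0, map_div₀, map_eq_one_of_sub_one_lt hyi1, div_one] at h2
      have d2 : v (y - yi) ≤ v π ^ i := by
        have h2 : v (Z / W i - 1) ≤ v π ^ i := by
          rw [div_sub_one hW0, map_div₀, map_eq_one_of_sub_one_lt hW1, div_one]
          exact hZW i
        have h3 : v (y / yi - 1) ≤ v π ^ i := by
          have : y / yi = σ (Z / W i) / (Z / W i) := by
            rw [hy, hyi, map_div₀]
            field_simp
          rw [this]
          refine div_sub_one_le hlt ?_ h2
          rwa [← map_one σ, ← map_sub, S.inv]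
        rwa [div_sub_one hyi0, map_div₀, map_eq_one_of_sub_one_lt hyi1, div_one] at h3
      rw [show g y - y = g (y - yi) + (g yi - yi) - (y - yi) by rw [map_sub]; ring]
      refine (Valuation.map_sub v _ _).trans (max_le ((Valuation.map_add v _ _).trans
        (max_le ?_ d1)) d2)
      rw [S.inv]
      exact d2
    by_contra hne
    have hpos : 0 < v (g y - y) := (Valuation.pos_iff v).2 (sub_ne_zero.2 hne)
    obtain ⟨i, hi⟩ := exists_pow_lt_of_lt_one hpos S.lt_one
    refine ((key (i + 1) (Nat.le_add_left 1 i)).trans ?_).not_gt hi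
    exact pow_le_pow_of_le_one zero_le S.lt_one.le (Nat.le_succ i)
  refine ⟨y, hyL, hy1, ?_⟩
  rw [hy, CyclicSetting.nrm_mul, S.nrm_apply_div (hLM hZ) hZ0, mul_one]

end CompleteSetting

/-! ### Characters associated with principal units. -/

/-- The unit `τ π / π`. -/
noncomputable def primeQuotient {F Ω : Type*} [Field F] [Field Ω] [Algebra F Ω]
    {L : IntermediateField F Ω} (π : L) (τ : Gal(L/F)) : Ω := (τ π : L) / (π : Ω)

namespace CyclicSetting

variable {F Ω : Type*} [Field F] [Field Ω] [Algebra F Ω] [IsGalois F Ω] {v : Valuation Ω ℝ≥0}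
  {L T : IntermediateField F Ω} [Normal F L] [Normal F T] {σ : Gal(Ω/F)} {n : ℕ} {π : L}
  (S : CyclicSetting v L T σ n π)

include S

lemma exists_pow_eq (τ : Gal(L/F)) : ∃ i : ℕ, ∀ x : L, ((τ x : L) : Ω) = (σ ^ i) x := by
  obtain ⟨g, rfl⟩ := AlgEquiv.restrictNormalHom_surjective (F := F) (K₁ := L) Ω τ
  obtain ⟨i, hi⟩ := S.exists_pow g
  exact ⟨i, fun x => by rw [coe_restrictNormalHom, hi x x.2]⟩

/-- Every pair of automorphisms of `T` and `L` has a common extension. -/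
lemma exists_extension (φ : Gal(T/F)) (τ : Gal(L/F)) : ∃ g : Gal(Ω/F),
    AlgEquiv.restrictNormalHom T g = φ ∧ AlgEquiv.restrictNormalHom L g = τ := by
  obtain ⟨γ, rfl⟩ := AlgEquiv.restrictNormalHom_surjective (F := F) (K₁ := T) Ω φ
  obtain ⟨h, hL, hT⟩ := S.exists_lift γ
  obtain ⟨i, hi⟩ := S.exists_pow_eq τ
  refine ⟨h * σ ^ i, ?_, ?_⟩
  · rw [restrictNormalHom_eq_iff]
    intro x hx
    rw [AlgEquiv.mul_apply, S.pow_apply_T i hx, hT x hx]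
  · ext x
    rw [coe_restrictNormalHom, hi, AlgEquiv.mul_apply]
    exact (IntermediateField.mem_fixingSubgroup_iff _ _).1 hL _ (apply_mem_of_normal L _ x.2)

lemma primeQuotient_eq {τ : Gal(L/F)} {i : ℕ} (h : ∀ x : L, ((τ x : L) : Ω) = (σ ^ i) x) :
    primeQuotient π τ = (σ ^ i) π / π := by
  rw [primeQuotient, h]

lemma primeQuotient_ne_zero (τ : Gal(L/F)) : primeQuotient π τ ≠ 0 := by
  obtain ⟨i, hi⟩ := S.exists_pow_eq τ
  rw [S.primeQuotient_eq hi]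
  exact div_ne_zero ((map_ne_zero (σ ^ i)).2 S.ne_zero) S.ne_zero

lemma primeQuotient_sub_one (τ : Gal(L/F)) : v (primeQuotient π τ - 1) < 1 := by
  obtain ⟨i, hi⟩ := S.exists_pow_eq τ
  rw [S.primeQuotient_eq hi]
  exact S.pow_wild i

lemma primeQuotient_one : primeQuotient π (1 : Gal(L/F)) = 1 := div_self S.ne_zero

/-- With `eq_one_of_inV`, this makes $\tau\mapsto\tau\pi/\pi$ an embedding of $\mathrm{Gal}(L/F)$
into $U_1/U_1^{\sigma-1}$. -/
lemma inV_primeQuotient_mul (τ τ' : Gal(L/F)) : InV v L T σ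
    (primeQuotient π (τ * τ') / (primeQuotient π τ * primeQuotient π τ')) := by
  obtain ⟨i, hi⟩ := S.exists_pow_eq τ
  obtain ⟨j, hj⟩ := S.exists_pow_eq τ'
  have hij : ∀ x : L, (((τ * τ') x : L) : Ω) = (σ ^ (i + j)) x := fun x => by
    rw [AlgEquiv.mul_apply, hi, hj, pow_add, AlgEquiv.mul_apply]
  rw [S.primeQuotient_eq hi, S.primeQuotient_eq hj, S.primeQuotient_eq hij]
  exact S.inV_pow_add i j

lemma eq_one_of_inV {τ : Gal(L/F)} (h : InV v L T σ (primeQuotient π τ)) : τ = 1 := by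
  obtain ⟨i, hi⟩ := S.exists_pow_eq τ
  rw [S.primeQuotient_eq hi] at h
  have := (S.pow_eq i).2 (S.dvd_of_inV h)
  ext x
  rw [hi, this x x.2]
  rfl

lemma eq_of_inV_div {τ τ' : Gal(L/F)} (h : InV v L T σ (primeQuotient π τ / primeQuotient π τ')) :
    τ = τ' := by
  rw [← mul_inv_eq_one]
  refine S.eq_one_of_inV ?_
  have h1 := S.inV_primeQuotient_mul τ τ'⁻¹
  have h2 := S.inV_primeQuotient_mul τ' τ'⁻¹
  rw [mul_inv_cancel, S.primeQuotient_one] at h2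
  have h3 := (h1.mul h).div h2
  have := S.primeQuotient_ne_zero τ
  have := S.primeQuotient_ne_zero τ'
  have := S.primeQuotient_ne_zero τ'⁻¹
  convert h3 using 1
  field_simp

omit S in
variable (v σ π) in
/-- The principal unit `η` is associated with the character `χ`: modulo `U₁^(σ-1)` one has
`η / h η = χ(h) π / π` for the automorphisms `h` trivial on `L`. -/
def IsAssociated (χ : Gal(T/F) →* Gal(L/F)) (η : Ω) : Prop :=
  ∀ h ∈ L.fixingSubgroup,
    InV v L T σ (η / h η / primeQuotient π (χ (AlgEquiv.restrictNormalHom T h)))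

/-- If `π η` is fixed by the automorphisms which restrict to `χ(φ)` on `L` and to `φ` on `T`, then
`η` is associated with `χ`. -/
lemma isAssociated_of_fixed {χ : Gal(T/F) →* Gal(L/F)} {η : Ω} (hη : η ∈ L ⊔ T)
    (hη1 : v (η - 1) < 1) (hfix : ∀ g : Gal(Ω/F), χ (AlgEquiv.restrictNormalHom T g) =
      AlgEquiv.restrictNormalHom L g → g (π * η) = π * η) : IsAssociated v σ π χ η := by
  intro h hh
  set τ := χ (AlgEquiv.restrictNormalHom T h) with hτ
  obtain ⟨i, hi⟩ := S.exists_pow_eq τ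
  -- $\sigma$ is trivial on $T$ and $h$ on $L$, so $h\sigma^i$ restricts to $h$ on $T$ and to
  -- $\chi(h)$ on $L$. Its fixing $\pi\eta$ reads $\eta/h\eta=(\sigma^i\pi/\pi)\cdot
  -- h(\sigma^i\eta/\eta)$.
  have hg : (h * σ ^ i) (π * η) = π * η := by
    refine hfix _ ?_
    have h1 : AlgEquiv.restrictNormalHom T (h * σ ^ i) = AlgEquiv.restrictNormalHom T h := by
      rw [restrictNormalHom_eq_iff]
      intro x hx
      rw [AlgEquiv.mul_apply, S.pow_apply_T i hx]
    rw [h1, ← hτ]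
    ext x
    rw [coe_restrictNormalHom, hi, AlgEquiv.mul_apply]
    exact ((IntermediateField.mem_fixingSubgroup_iff _ _).1 hh _
      (apply_mem_of_normal L _ x.2)).symm
  have h0 := S.ne_zero
  have hη0 := ne_zero_of_sub_one_lt hη1
  have hπi : h ((σ ^ i) (π : Ω)) = (σ ^ i) π :=
    (IntermediateField.mem_fixingSubgroup_iff _ _).1 hh _ (apply_mem_of_normal L _ π.2)
  rw [AlgEquiv.mul_apply, map_mul, map_mul, hπi] at hg
  have h2 := InV.apply S h (S.inV_pow_apply_div i hη hη1)
  rw [S.primeQuotient_eq hi]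
  have hσi : (σ ^ i) (π : Ω) ≠ 0 := (map_ne_zero (σ ^ i)).2 h0
  have hhη : h η ≠ 0 := (map_ne_zero h).2 hη0
  convert h2 using 1
  rw [map_div₀]
  field_simp
  linear_combination -hg

lemma IsAssociated.mul {χ χ' χ'' : Gal(T/F) →* Gal(L/F)} {η η' : Ω} (hη : η ≠ 0) (hη' : η' ≠ 0)
    (h : IsAssociated v σ π χ η) (h' : IsAssociated v σ π χ' η')
    (hχ : ∀ φ, χ'' φ = χ φ * χ' φ) : IsAssociated v σ π χ'' (η * η') := by
  intro g hg
  have h1 := ((h g hg).mul (h' g hg)).div (S.inV_primeQuotient_mul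
    (χ (AlgEquiv.restrictNormalHom T g)) (χ' (AlgEquiv.restrictNormalHom T g)))
  rw [← hχ] at h1
  have hgη : g η ≠ 0 := (map_ne_zero g).2 hη
  have hgη' : g η' ≠ 0 := (map_ne_zero g).2 hη'
  have := S.primeQuotient_ne_zero (χ (AlgEquiv.restrictNormalHom T g))
  have := S.primeQuotient_ne_zero (χ' (AlgEquiv.restrictNormalHom T g))
  have := S.primeQuotient_ne_zero (χ'' (AlgEquiv.restrictNormalHom T g))
  convert h1 using 1
  rw [map_mul]
  field_simp

/-- Modulo $U_1^{\sigma-1}$, which $h$ preserves, $z$ is some $\sigma^i\pi/\pi\in L$, and $h$ fixes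
it. -/
lemma inV_of_nrm_eq {z : Ω} (hz : z ∈ L ⊔ T) (h1 : nrm σ n z = 1) {h : Gal(Ω/F)}
    (hh : h ∈ L.fixingSubgroup) : InV v L T σ (z / h z) := by
  obtain ⟨i, hi⟩ := S.exists_pow_of_nrm_eq_one hz h1
  have h2 := hi.div (InV.apply S h hi)
  have hπ : h (π : Ω) = π := (IntermediateField.mem_fixingSubgroup_iff _ _).1 hh _ π.2
  have hπi : h ((σ ^ i) (π : Ω)) = (σ ^ i) π :=
    (IntermediateField.mem_fixingSubgroup_iff _ _).1 hh _ (apply_mem_of_normal L _ π.2)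
  rw [map_div₀, map_div₀, hπ, hπi] at h2
  have h0 := S.ne_zero
  have hσi : (σ ^ i) (π : Ω) ≠ 0 := (map_ne_zero (σ ^ i)).2 h0
  convert h2 using 1
  rw [div_div_div_cancel_right₀ (div_ne_zero hσi h0)]

/-- A character associated with a unit whose norm is a norm from `L` is trivial. -/
lemma IsAssociated.eq_one {χ : Gal(T/F) →* Gal(L/F)} {η w : Ω} (h : IsAssociated v σ π χ η)
    (hη : η ∈ L ⊔ T) (hη0 : η ≠ 0) (hw : w ∈ L) (hw0 : w ≠ 0)
    (hN : nrm σ n η = nrm σ n w) (φ : Gal(T/F)) : χ φ = 1 := by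
  obtain ⟨g, rfl, hg⟩ := S.exists_extension φ 1
  rw [← mem_fixingSubgroup_iff_restrictNormalHom] at hg
  have hgw : g w = w := (IntermediateField.mem_fixingSubgroup_iff _ _).1 hg _ hw
  have h1 := S.inV_of_nrm_eq (z := η / w) (div_mem hη ((le_sup_left : L ≤ L ⊔ T) hw))
    (by rw [nrm_div, hN, div_self (S.nrm_ne_zero hw0)]) hg
  rw [map_div₀, hgw, div_div_div_cancel_right₀ hw0] at h1
  have h2 := h1.div (h g hg)
  have hgη : g η ≠ 0 := (map_ne_zero g).2 hη0
  rw [div_div_cancel₀ (div_ne_zero hη0 hgη)] at h2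
  exact S.eq_one_of_inV h2

/-- A principal unit whose norm is in `F` is associated with a character. -/
lemma exists_isAssociated {η : Ω} (hη : η ∈ L ⊔ T) (hη1 : v (η - 1) < 1)
    (hN : ∀ g : Gal(Ω/F), g (nrm σ n η) = nrm σ n η) :
    ∃ χ : Gal(T/F) →* Gal(L/F), IsAssociated v σ π χ η := by
  have hη0 := ne_zero_of_sub_one_lt hη1
  have happ : ∀ (h : Gal(Ω/F)), h η ≠ 0 := fun h => (map_ne_zero h).2 hη0
  have hex : ∀ h : Gal(Ω/F), ∃ τ : Gal(L/F), InV v L T σ (η / h η / primeQuotient π τ) := by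
    intro h
    have hn : nrm σ n (h η) = nrm σ n η := by
      rw [← hN h, nrm, nrm, map_prod]
      exact Finset.prod_congr rfl fun i _ => (S.comm_pow h i hη).symm
    obtain ⟨i, hi⟩ := S.exists_pow_of_nrm_eq_one (w := η / h η) (div_mem hη (apply_mem h hη))
      (by rw [nrm_div, hn, div_self (S.nrm_ne_zero hη0)])
    refine ⟨AlgEquiv.restrictNormalHom L (σ ^ i), ?_⟩
    rwa [S.primeQuotient_eq fun x => coe_restrictNormalHom L (σ ^ i) x]
  have huniq : ∀ (h : Gal(Ω/F)) (τ τ' : Gal(L/F)), InV v L T σ (η / h η / primeQuotient π τ) →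
      InV v L T σ (η / h η / primeQuotient π τ') → τ = τ' := by
    intro h τ τ' h1 h2
    refine S.eq_of_inV_div ?_
    have := S.primeQuotient_ne_zero τ
    have := S.primeQuotient_ne_zero τ'
    have := happ h
    convert h2.div h1 using 1
    field_simp
  choose l hlT hlL using fun φ : Gal(T/F) => S.exists_extension φ 1
  have hl : ∀ φ, l φ ∈ L.fixingSubgroup := fun φ =>
    mem_fixingSubgroup_iff_restrictNormalHom.2 (hlL φ)
  have hag : ∀ {h h' : Gal(Ω/F)}, h ∈ L.fixingSubgroup → h' ∈ L.fixingSubgroup →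
      AlgEquiv.restrictNormalHom T h = AlgEquiv.restrictNormalHom T h' → h η = h' η := by
    intro h h' hh hh' he
    refine eqOn_sup (fun x hx => ?_) (restrictNormalHom_eq_iff.1 he) hη
    rw [(IntermediateField.mem_fixingSubgroup_iff _ _).1 hh x hx,
      (IntermediateField.mem_fixingSubgroup_iff _ _).1 hh' x hx]
  choose c hc using fun φ => hex (l φ)
  -- From $\eta/hh'\eta=(\eta/h\eta)\cdot h(\eta/h'\eta)$ and the fact that $h$ fixes
  -- $\tau\pi/\pi\in L$, the cocycle is a homomorphism.
  have hmul : ∀ φ ψ, c (φ * ψ) = c φ * c ψ := by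
    intro φ ψ
    refine huniq (l (φ * ψ)) _ _ (hc _) ?_
    have e : l (φ * ψ) η = l φ (l ψ η) := by
      rw [← AlgEquiv.mul_apply]
      exact hag (hl _) (mul_mem (hl _) (hl _)) (by rw [map_mul, hlT, hlT, hlT])
    have hfix : l φ (primeQuotient π (c ψ)) = primeQuotient π (c ψ) :=
      (IntermediateField.mem_fixingSubgroup_iff _ _).1 (hl φ) _
        (div_mem (c ψ π).2 π.2)
    have h1 := ((hc φ).mul (InV.apply S (l φ) (hc ψ))).div (S.inV_primeQuotient_mul (c φ) (c ψ))
    rw [map_div₀, map_div₀, hfix] at h1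
    rw [e]
    have := S.primeQuotient_ne_zero (c φ)
    have := S.primeQuotient_ne_zero (c ψ)
    have := S.primeQuotient_ne_zero (c φ * c ψ)
    have := happ (l φ)
    have : l φ (l ψ η) ≠ 0 := (map_ne_zero (l φ)).2 (happ (l ψ))
    convert h1 using 1
    field_simp
  refine ⟨MonoidHom.mk' c hmul, fun h hh => ?_⟩
  rw [hag hh (hl (AlgEquiv.restrictNormalHom T h)) (hlT _).symm]
  exact hc _

/-- A character associated with a unit is trivial where the unit is fixed. -/
lemma IsAssociated.apply_eq_one {χ : Gal(T/F) →* Gal(L/F)} {η : Ω} (h : IsAssociated v σ π χ η)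
    (hη0 : η ≠ 0) {g : Gal(Ω/F)} (hg : g ∈ L.fixingSubgroup) (hgη : g η = η) :
    χ (AlgEquiv.restrictNormalHom T g) = 1 := by
  have h1 := (h g hg).inv
  rw [hgη, div_self hη0, one_div, inv_inv] at h1
  exact S.eq_one_of_inV h1

end CyclicSetting

/-! ### Uniqueness of norms and existence of twisted primes. -/

namespace CompleteSetting

open CyclicSetting

variable {F Ω : Type*} [Field F] [Field Ω] [Algebra F Ω] [IsGalois F Ω] {v : Valuation Ω ℝ≥0}
  {L T : IntermediateField F Ω} [Normal F L] [Normal F T] {σ : Gal(Ω/F)} {n : ℕ} {π : L}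
  (S : CompleteSetting v L T σ n π)

include S

/-- The norms of units associated with the same character differ by a norm from `L`. -/
lemma exists_nrm_eq_mul {χ : Gal(T/F) →* Gal(L/F)} {η η' : Ω} (h : IsAssociated v σ π χ η)
    (h' : IsAssociated v σ π χ η') (hη : η ∈ L ⊔ T) (hη1 : v (η - 1) < 1) (hη' : η' ∈ L ⊔ T)
    (hη1' : v (η' - 1) < 1) :
    ∃ w ∈ L, v (w - 1) < 1 ∧ nrm σ n η = nrm σ n η' * nrm σ n w := by
  have hη0 := ne_zero_of_sub_one_lt hη1
  have hη0' := ne_zero_of_sub_one_lt hη1'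
  -- The factors $\chi(g)\pi/\pi$ cancel in $\eta/\eta'$, so its class modulo $U_1^{\sigma-1}$ is
  -- invariant.
  obtain ⟨w, hw, hw1, hN⟩ := S.exists_nrm_eq (u := η / η') (div_mem hη hη')
    (div_sub_one_lt hη1 hη1') (by
      intro g hg
      have h1 := (h' g hg).div (h g hg)
      have hg1 : g η ≠ 0 := (map_ne_zero g).2 hη0
      have hg2 : g η' ≠ 0 := (map_ne_zero g).2 hη0'
      have := S.primeQuotient_ne_zero (χ (AlgEquiv.restrictNormalHom T g))
      convert h1 using 1
      rw [map_div₀]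
      field_simp)
  refine ⟨w, hw, hw1, ?_⟩
  rw [← hN, nrm_div, mul_div_cancel₀ _ (S.nrm_ne_zero hη0')]

/-- The twisted field of a character contains an element congruent to `π`. -/
lemma exists_twisted_prime (χ : Gal(T/F) →* Gal(L/F)) (M : IntermediateField F Ω) (hMT : M ≤ T)
    [FiniteDimensional F M] [Normal F M] (hM : TrivialInertia v M)
    (hχ : ∀ g ∈ M.fixingSubgroup, χ (AlgEquiv.restrictNormalHom T g) = 1) :
    ∃ η ∈ L ⊔ T, v (η - 1) < 1 ∧ ∀ g : Gal(Ω/F), χ (AlgEquiv.restrictNormalHom T g) =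
      AlgEquiv.restrictNormalHom L g → g (π * η) = π * η := by
  have h0 := S.ne_zero
  let C : Gal(Ω/F) →* Gal(L/F) := χ.comp (AlgEquiv.restrictNormalHom T)
  have hCM : ∀ {g g' : Gal(Ω/F)},
      AlgEquiv.restrictNormalHom M g = AlgEquiv.restrictNormalHom M g' → C g = C g' := by
    intro g g' h
    have h1 : C (g'⁻¹ * g) = 1 := by
      refine hχ _ (mem_fixingSubgroup_iff_restrictNormalHom.2 ?_)
      rw [map_mul, map_inv, h, inv_mul_cancel]
    rw [map_mul, map_inv, inv_mul_eq_one] at h1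
    exact h1.symm
  -- Each element of $\mathrm{Gal}(M/F)$ is lifted into the twisted group of $\chi$.
  have hsec : ∀ q : Gal(M/F), ∃ g : Gal(Ω/F), AlgEquiv.restrictNormalHom M g = q ∧
      AlgEquiv.restrictNormalHom L g = C g := by
    intro q
    obtain ⟨γ, rfl⟩ := AlgEquiv.restrictNormalHom_surjective (F := F) (K₁ := M) Ω q
    obtain ⟨g, hgT, hgL⟩ := S.exists_extension (AlgEquiv.restrictNormalHom T γ) (C γ)
    have hgM : AlgEquiv.restrictNormalHom M g = AlgEquiv.restrictNormalHom M γ :=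
      restrictNormalHom_eq_iff.2 fun x hx => restrictNormalHom_eq_iff.1 hgT x (hMT hx)
    exact ⟨g, hgM, hgL.trans (hCM hgM).symm⟩
  choose s hsM hsL using hsec
  obtain ⟨t, ht1, ht⟩ := hM.exists_trace_eq_one S.inv
  have htv : ∀ q : Gal(M/F), v ((q t : M) : Ω) ≤ 1 := by
    intro q
    rw [← hsM q, coe_restrictNormalHom, S.inv]
    exact ht1
  have htΩ : ∑ q : Gal(M/F), ((q t : M) : Ω) = 1 := by
    rw [← AddSubmonoidClass.coe_finsetSum, ht]
    rfl
  have hst : ∀ q, s q (t * π) = ((q t : M) : Ω) * (C (s q) π : L) := by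
    intro q
    rw [map_mul, ← coe_restrictNormalHom M (s q) t, hsM, ← coe_restrictNormalHom L (s q) π, hsL]
  have hLT : L ≤ L ⊔ T := le_sup_left
  have hMLT : M ≤ L ⊔ T := hMT.trans le_sup_right
  -- The twisted trace of $t\pi$. The conjugates of $t$ sum to $1$ and each $\tau\pi/\pi$ is a
  -- principal unit, so $z/\pi\equiv1$.
  set z := ∑ q, s q (t * π) with hz
  have hπz : (π : Ω) * (z / π) = z := mul_div_cancel₀ _ h0
  refine ⟨z / π, div_mem (sum_mem fun q _ => ?_) S.mem_sup, ?_, fun g hg => ?_⟩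
  · rw [hst]
    exact mul_mem (hMLT (q t).2) (hLT (C (s q) π).2)
  · have hd : z / π - 1 = ∑ q : Gal(M/F), ((q t : M) : Ω) * (primeQuotient π (C (s q)) - 1) := by
      simp_rw [mul_sub, mul_one]
      rw [Finset.sum_sub_distrib, htΩ, hz, Finset.sum_div]
      congr 1
      refine Finset.sum_congr rfl fun q _ => ?_
      rw [hst, primeQuotient, mul_div_assoc]
    rw [hd]
    refine Valuation.map_sum_lt v one_ne_zero fun q _ => ?_
    rw [map_mul]
    exact (mul_le_of_le_one_left zero_le (htv q)).trans_lt (S.primeQuotient_sub_one _)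
  · rw [hπz, hz, map_sum]
    refine Fintype.sum_equiv (Equiv.mulLeft (AlgEquiv.restrictNormalHom M g)) _ _ fun q => ?_
    have hM' : AlgEquiv.restrictNormalHom M (g * s q) =
        AlgEquiv.restrictNormalHom M (s (AlgEquiv.restrictNormalHom M g * q)) := by
      rw [map_mul, hsM, hsM]
    have hL' : AlgEquiv.restrictNormalHom L (g * s q) =
        AlgEquiv.restrictNormalHom L (s (AlgEquiv.restrictNormalHom M g * q)) := by
      rw [map_mul, hsL, hsL, ← hg, ← hCM hM', map_mul]
      rfl
    rw [Equiv.coe_mulLeft, ← AlgEquiv.mul_apply, map_mul, map_mul,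
      restrictNormalHom_eq_iff.1 hM' _ t.2, restrictNormalHom_eq_iff.1 hL' _ π.2]

end CompleteSetting

/-! ### Finite levels of $\tilde F$. -/

/-- Finitely many elements of `K ⊔ ⨆ i, f i` are in `K ⊔ M` for the compositum `M` of finitely many
of the fields `f i`. -/
lemma exists_level_of_iSup {F Ω : Type*} [Field F] [Field Ω] [Algebra F Ω] {v : Valuation Ω ℝ≥0}
    {ι : Type*} (f : ι → IntermediateField F Ω) (hf : ∀ i, FiniteDimensional F (f i))
    (hn : ∀ i, Normal F (f i)) (ht : ∀ i, TrivialInertia v (f i)) (K : IntermediateField F Ω)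
    (s : Finset Ω) (hs : ∀ x ∈ s, x ∈ K ⊔ ⨆ i, f i) :
    ∃ M ≤ ⨆ i, f i, FiniteDimensional F M ∧ Normal F M ∧ TrivialInertia v M ∧
      ∀ x ∈ s, x ∈ K ⊔ M := by
  classical
  have hex : ∀ x ∈ K ⊔ ⨆ i, f i, ∃ t : Finset ι, x ∈ K ⊔ ⨆ i ∈ t, f i := by
    intro x hx
    -- $K$ joins the family as an extra member, discarded afterwards by `Finset.eraseNone`.
    let f' : Option ι → IntermediateField F Ω := fun o => o.elim K f
    have hle : K ⊔ ⨆ i, f i ≤ ⨆ o, f' o :=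
      sup_le (le_iSup f' none) (iSup_le fun i => le_iSup f' (some i))
    obtain ⟨t, ht⟩ := IntermediateField.exists_finset_of_mem_iSup (hle hx)
    refine ⟨Finset.eraseNone t, ?_⟩
    have hle' : ⨆ o ∈ t, f' o ≤ K ⊔ ⨆ i ∈ Finset.eraseNone t, f i := by
      refine iSup₂_le fun o ho => ?_
      cases o with
      | none => exact le_sup_left
      | some i =>
        exact le_trans (le_iSup₂_of_le (f := fun i (_ : i ∈ Finset.eraseNone t) => f i) i
          (Finset.mem_eraseNone.2 ho) le_rfl) le_sup_right
    exact hle' ht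
  choose! t ht' using hex
  have hmono : ∀ x ∈ s, K ⊔ (⨆ i ∈ t x, f i) ≤ K ⊔ ⨆ i : s.biUnion t, f i := fun x hx =>
    sup_le_sup_left (iSup₂_le fun i hi =>
      le_iSup (fun i : s.biUnion t => f i) ⟨i, Finset.mem_biUnion.2 ⟨x, hx, hi⟩⟩) K
  exact ⟨⨆ i : s.biUnion t, f i, iSup_le fun i => le_iSup f i,
    IntermediateField.finiteDimensional_iSup_of_finite,
    IntermediateField.normal_iSup F Ω _, TrivialInertia.iSup fun i => ht i,
    fun x hx => SetLike.le_def.1 (hmono x hx) (ht' x (hs x hx))⟩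

section Levels

variable (p : ℕ) {A F Ω : Type*} [CommRing A] [IsDomain A] [IsDiscreteValuationRing A]
  [Field F] [Algebra A F] [IsFractionRing A F] [Field Ω] [Algebra F Ω] [Algebra A Ω]
  [IsScalarTower A F Ω] [IsGalois F Ω] {v : Valuation Ω ℝ≥0} (hv : IsExtendedValuation A F v)

include hv

/-- Finitely many elements of `K F̃` are defined over `K M` for a finite Galois extension `M` with
trivial inertia. -/
lemma exists_level_sup (K : IntermediateField F Ω) (s : Finset Ω)
    (hs : ∀ x ∈ s, x ∈ K ⊔ maxAbUnram p A F Ω) :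
    ∃ M ≤ maxAbUnram p A F Ω, FiniteDimensional F M ∧ Normal F M ∧ TrivialInertia v M ∧
      ∀ x ∈ s, x ∈ K ⊔ M :=
  exists_level_of_iSup (fun E : {E : IntermediateField F Ω // IsFiniteAbelianUnramified A F E p} =>
      E.1) (fun E => E.2.finiteDimensional) (fun E => E.2.isAbelianGalois.toIsGalois.to_normal)
    (fun E g => by
      have := E.2.finiteDimensional
      have := E.2.isAbelianGalois.toIsGalois
      have := E.2.formallyUnramified
      exact hv.exists_of_formallyUnramified E.1 g) K s hs

/-- Each element lies in a finite level with trivial inertia, which has the values of its base; here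
the base is $F$, that is, $K=\bot$. -/
lemma value_maxAbUnram {ϖ : A} (hϖ : Irreducible ϖ) {x : Ω} (hx : x ∈ maxAbUnram p A F Ω)
    (hx0 : x ≠ 0) : ∃ k : ℤ, v x = v (algebraMap A Ω ϖ) ^ k := by
  obtain ⟨M, -, hMf, hMn, hM, hxM⟩ := exists_level_sup p hv ⊥ {x} (by simpa using hx)
  choose s hs using AlgEquiv.restrictNormalHom_surjective (F := F) (K₁ := M) Ω
  have hsK : ∀ q, s q ∈ (⊥ : IntermediateField F Ω).fixingSubgroup := by
    intro q
    rw [IntermediateField.fixingSubgroup_bot]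
    exact Subgroup.mem_top _
  obtain ⟨y, hy, hyx⟩ := hM.exists_value hv.map_algEquiv hs hsK (hxM x (Finset.mem_singleton_self x))
  obtain ⟨c, rfl⟩ := IntermediateField.mem_bot.1 hy
  have hc : c ≠ 0 := by
    rintro rfl
    rw [map_zero, map_zero] at hyx
    exact hx0 ((Valuation.zero_iff v).1 hyx.symm)
  rw [← hyx]
  exact hv.exists_zpow_of_base hϖ hc

end Levels

/-! ### The cyclic setting of a totally ramified $p$-extension. -/

section Setting

variable (p : ℕ) {A F Ω : Type*} [CommRing A] [IsDomain A] [IsDiscreteValuationRing A]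
  [Field F] [Algebra A F] [IsFractionRing A F] [Field Ω] [Algebra F Ω] [Algebra A Ω]
  [IsScalarTower A F Ω] [IsGalois F Ω] {v : Valuation Ω ℝ≥0} (hv : IsExtendedValuation A F v)
  (L : IntermediateField F Ω) [FiniteDimensional F L] [IsGalois F L]

include hv

/-- `L` and `F̃` are linearly disjoint. -/
lemma map_fixingSubgroup_eq_top {ϖ : A} (hϖ : Irreducible ϖ) {π : Ω} (hπL : π ∈ L)
    (hπ : v π ^ Module.finrank F L = v (algebraMap A Ω ϖ)) :
    (maxAbUnram p A F Ω).fixingSubgroup.map (AlgEquiv.restrictNormalHom L) = ⊤ := by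
  have hn : Module.finrank F L ≠ 0 := Module.finrank_pos.ne'
  rw [← IntermediateField.fixingSubgroup_fixedField (Subgroup.map _ _),
    ← IntermediateField.fixingSubgroup_bot]
  congr 1
  -- The fixed field is $L\cap\tilde F$. An element of $L$ outside $F$ differs from some $c\in F$ by
  -- an element with exponent prime to being a multiple of $n$, that is, with $n\nmid k$; no such
  -- value occurs in $\tilde F$.
  rw [eq_bot_iff]
  intro x hx
  rw [IntermediateField.mem_fixedField_iff] at hx
  have hxT : (x : Ω) ∈ maxAbUnram p A F Ω := mem_of_fixed fun g hg => by
    rw [← coe_restrictNormalHom, hx _ ⟨g, hg, rfl⟩]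
  obtain ⟨c, -, h | ⟨k, hk, h⟩⟩ := hv.ramified_exists_sub hϖ hπ hn rfl hπL x.2
  · exact IntermediateField.mem_bot.2 ⟨c, Subtype.ext h.symm⟩
  · have hpos := hv.ramified_pos hn hϖ hπ
    have hne : (x : Ω) - algebraMap F Ω c ≠ 0 :=
      (Valuation.pos_iff v).1 (h ▸ zpow_pos hpos k)
    obtain ⟨l, hl⟩ := value_maxAbUnram p hv hϖ
      (sub_mem hxT ((maxAbUnram p A F Ω).algebraMap_mem c)) hne
    rw [h, ← hπ, ← zpow_natCast, ← zpow_mul] at hl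
    have := zpow_right_injective₀ hpos (hv.ramified_lt_one hϖ hπ).ne hl
    exact absurd ⟨l, this⟩ hk

omit [IsGalois F Ω] in
/-- In characteristic `p`, the only root of unity of `p`-power order is `1`. -/
lemma algebraMap_sub_one_lt [Fact p.Prime] [CharP (ResidueField A) p] {a : A} {m : ℕ}
    (h : v (algebraMap A Ω a ^ p ^ m - 1) < 1) : v (algebraMap A Ω a - 1) < 1 := by
  rw [← map_pow, ← map_one (algebraMap A Ω), ← map_sub] at h
  have h2 : a ^ p ^ m - 1 ∈ maximalIdeal A := by
    rw [mem_maximalIdeal, mem_nonunits_iff]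
    rintro ⟨u, hu⟩
    rw [← hu, hv.algebraMap_unit] at h
    exact lt_irrefl _ h
  rw [← residue_eq_zero_iff, map_sub, map_one, map_pow] at h2
  have h3 : (residue A a - 1) ^ p ^ m = 0 := by
    rw [sub_pow_char_pow, one_pow, h2]
  have h4 : residue A (a - 1) = 0 := by
    rw [map_sub, map_one]
    exact eq_zero_of_pow_eq_zero h3
  have h5 := hv.lt_one_of_mem_maximalIdeal ((residue_eq_zero_iff _).1 h4)
  rwa [map_sub, map_one] at h5

/-- A totally ramified `p`-extension is wildly ramified. -/
lemma wild_of_isPGroup [Fact p.Prime] [CharP (ResidueField A) p] (hp : IsPGroup p Gal(L/F))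
    {ϖ : A} (hϖ : Irreducible ϖ) {π : Ω} (hπL : π ∈ L)
    (hπ : v π ^ Module.finrank F L = v (algebraMap A Ω ϖ)) {σ : Gal(Ω/F)}
    (hσ : ∀ x ∈ L, (σ ^ Module.finrank F L) x = x) : v (σ π / π - 1) < 1 := by
  have hn : Module.finrank F L ≠ 0 := Module.finrank_pos.ne'
  have hπ0 : π ≠ 0 := (Valuation.pos_iff v).1 (hv.ramified_pos hn hϖ hπ)
  obtain ⟨m, hm⟩ := IsPGroup.iff_card.1 hp
  rw [IsGalois.card_aut_eq_finrank] at hm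
  obtain ⟨a, ha⟩ := hv.ramified_residue hϖ hπ hn rfl hπL (x := σ π / π)
    (div_mem (apply_mem_of_normal L σ hπL) hπL) (by
      rw [map_div₀, hv.map_algEquiv, div_self ((Valuation.ne_zero_iff v).2 hπ0)])
  have hσa : ∀ g : Gal(Ω/F), g (algebraMap A Ω a) = algebraMap A Ω a := fun g => by
    rw [IsScalarTower.algebraMap_apply A F Ω, AlgEquiv.commutes]
  -- Modulo the maximal ideal $\sigma\pi/\pi$ is a constant $a$, so $\sigma^i\pi/\pi\equiv a^i$. For
  -- $i=n=p^m$ this gives $a^{p^m}\equiv1$, hence $a\equiv1$.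
  have hpow : ∀ i : ℕ, v ((σ ^ i) π / π - algebraMap A Ω a ^ i) < 1 := by
    intro i
    induction i with
    | zero => simp [hπ0]
    | succ i ih =>
      have hi : (σ ^ i) π ≠ 0 := (map_ne_zero (σ ^ i)).2 hπ0
      have e : (σ ^ (i + 1)) π / π - algebraMap A Ω a ^ (i + 1) =
          (σ ^ i) (σ π / π - algebraMap A Ω a) * ((σ ^ i) π / π) +
            algebraMap A Ω a * ((σ ^ i) π / π - algebraMap A Ω a ^ i) := by
        rw [map_sub, map_div₀, hσa, pow_succ, pow_succ, AlgEquiv.mul_apply]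
        field_simp
        ring
      rw [e]
      refine (Valuation.map_add v _ _).trans_lt (max_lt ?_ ?_)
      · rw [map_mul, hv.map_algEquiv, map_div₀, hv.map_algEquiv,
          div_self ((Valuation.ne_zero_iff v).2 hπ0), mul_one]
        exact ha
      · rw [map_mul]
        exact (mul_le_of_le_one_left zero_le (hv.algebraMap_le_one a)).trans_lt ih
  have h1 := hpow (Module.finrank F L)
  rw [hσ π hπL, div_self hπ0, Valuation.map_sub_swap, hm] at h1
  have h5 := algebraMap_sub_one_lt p hv h1
  rw [← sub_add_sub_cancel _ (algebraMap A Ω a)]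
  exact (Valuation.map_add v _ _).trans_lt (max_lt ha h5)

theorem exists_completeSetting [Fact p.Prime] [CharP (ResidueField A) p] [IsCyclic Gal(L/F)]
    (hp : IsPGroup p Gal(L/F)) (hL : IsTotallyRamified A F L) {ϖ : A} (hϖ : Irreducible ϖ) :
    ∃ (σ : Gal(Ω/F)) (π : L), v π ^ Module.finrank F L = v (algebraMap A Ω ϖ) ∧
      CompleteSetting v L (maxAbUnram p A F Ω) σ (Module.finrank F L) π := by
  have hn : Module.finrank F L ≠ 0 := Module.finrank_pos.ne'
  obtain ⟨π, hπL, hπ⟩ := hv.exists_uniformizer L hL hϖ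
  have hpos := hv.ramified_pos hn hϖ hπ
  have hlt := hv.ramified_lt_one hϖ hπ
  have htop := map_fixingSubgroup_eq_top p hv L hϖ hπL hπ
  obtain ⟨τ, hτ⟩ := IsCyclic.exists_monoid_generator (α := Gal(L/F))
  -- Linear disjointness lifts the generator to an automorphism trivial on $\tilde F$.
  obtain ⟨σ, hσT, hσL⟩ : τ ∈ (maxAbUnram p A F Ω).fixingSubgroup.map
      (AlgEquiv.restrictNormalHom L) := htop ▸ Subgroup.mem_top τ
  have hord : orderOf τ = Module.finrank F L := by
    rw [← IsGalois.card_aut_eq_finrank F L]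
    exact orderOf_eq_card_of_forall_mem_powers hτ
  have hpow : ∀ i : ℕ, (∀ x ∈ L, (σ ^ i) x = x) ↔ Module.finrank F L ∣ i := by
    intro i
    rw [← IntermediateField.mem_fixingSubgroup_iff, mem_fixingSubgroup_iff_restrictNormalHom,
      map_pow, hσL, ← orderOf_dvd_iff_pow_eq_one, hord]
  have hsec : ∀ (M : IntermediateField F Ω) [Normal F M], M ≤ maxAbUnram p A F Ω →
      ∀ q : Gal(M/F), ∃ g : Gal(Ω/F), AlgEquiv.restrictNormalHom M g = q ∧
        g ∈ L.fixingSubgroup := by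
    intro M _ hMT q
    obtain ⟨γ, rfl⟩ := AlgEquiv.restrictNormalHom_surjective (F := F) (K₁ := M) Ω q
    obtain ⟨k, hkT, hkL⟩ : AlgEquiv.restrictNormalHom L γ ∈
        (maxAbUnram p A F Ω).fixingSubgroup.map (AlgEquiv.restrictNormalHom L) :=
      htop ▸ Subgroup.mem_top _
    have hkM : AlgEquiv.restrictNormalHom M k = 1 := by
      rw [← mem_fixingSubgroup_iff_restrictNormalHom]
      exact IntermediateField.fixingSubgroup_le hMT hkT
    refine ⟨γ * k⁻¹, ?_, ?_⟩
    · rw [map_mul, map_inv, hkM, inv_one, mul_one]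
    · rw [mem_fixingSubgroup_iff_restrictNormalHom, map_mul, map_inv, hkL, mul_inv_cancel]
  have hres : ∀ x ∈ L, v x ≤ 1 → ∃ c : F, v (x - algebraMap F Ω c) < 1 := by
    intro x hx hx1
    obtain ⟨a, ha⟩ := hv.ramified_residue hϖ hπ hn rfl hπL hx hx1
    exact ⟨algebraMap A F a, by rwa [← IsScalarTower.algebraMap_apply]⟩
  refine ⟨σ, ⟨π, hπL⟩, hπ, ?_⟩
  exact {
    inv := hv.map_algEquiv
    n_pos := Nat.pos_of_ne_zero hn
    apply_T := (IntermediateField.mem_fixingSubgroup_iff _ _).1 hσT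
    exists_pow := by
      intro g
      obtain ⟨i, hi⟩ := hτ (AlgEquiv.restrictNormalHom L g)
      refine ⟨i, restrictNormalHom_eq_iff.1 ?_⟩
      rw [← hi, map_pow, hσL]
    pow_eq := hpow
    mem := hπL
    pos := hpos
    lt_one := hlt
    value := by
      intro x hx hx0
      obtain ⟨M, hMT, hMf, hMn, hM, hxM⟩ := exists_level_sup p hv L {x} (by simpa using hx)
      choose s hs hsL using hsec M hMT
      obtain ⟨y, hy, hyx⟩ := hM.exists_value hv.map_algEquiv hs hsL
        (hxM x (Finset.mem_singleton_self x))
      have hy0 : y ≠ 0 := by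
        rintro rfl
        rw [map_zero] at hyx
        exact hx0 ((Valuation.zero_iff v).1 hyx.symm)
      rw [← hyx]
      exact hv.ramified_exists_zpow hϖ hπ hn rfl hπL hy hy0
    value_T := by
      intro x hx hx0
      obtain ⟨k, hk⟩ := value_maxAbUnram p hv hϖ hx hx0
      exact ⟨k, by rw [hk, ← hπ, zpow_mul, zpow_natCast]⟩
    residue := by
      intro x hx hx1
      obtain ⟨M, hMT, hMf, hMn, hM, hxM⟩ := exists_level_sup p hv L {x} (by simpa using hx)
      choose s hs hsL using hsec M hMT
      obtain ⟨y, hy, hyx⟩ := hM.exists_residue hv.map_algEquiv hs hsL hres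
        (hxM x (Finset.mem_singleton_self x)) hx1
      exact ⟨y, hMT hy, hyx⟩
    wild := wild_of_isPGroup p hv L hp hϖ hπL hπ ((hpow _).2 dvd_rfl)
    finite := inferInstance
    complete := hv.complete
    exists_level := exists_level_sup p hv L
    residue_L := hres
    exists_prime := ⟨algebraMap A F ϖ, by rw [← IsScalarTower.algebraMap_apply, hπ]⟩ }

end Setting

/-! ### Field norms as products over powers of $\sigma$. -/

section Norm

open CyclicSetting

/-- The norm of a finite Galois extension whose Galois group is generated by the restriction of
`σ`. -/
lemma norm_eq_nrm {F Ω : Type*} [Field F] [Field Ω] [Algebra F Ω] {σ : Gal(Ω/F)} {n : ℕ}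
    {K E : Type*} [Field K] [Field E] [Algebra K E] [FiniteDimensional K E] [IsGalois K E]
    (ι : E →+* Ω) {s : Gal(E/K)} (hs : ∀ x, ι (s x) = σ (ι x))
    (hgen : ∀ τ : Gal(E/K), ∃ i : ℕ, ∀ x, ι (τ x) = (σ ^ i) (ι x))
    (hord : ∀ i : ℕ, (∀ x, (σ ^ i) (ι x) = ι x) ↔ n ∣ i) :
    Module.finrank K E = n ∧ ∀ x : E, ι (algebraMap K E (Algebra.norm K x)) = nrm σ n (ι x) := by
  have hpow : ∀ (i : ℕ) (x : E), ι ((s ^ i) x) = (σ ^ i) (ι x) := by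
    intro i x
    induction i with
    | zero => rfl
    | succ i ih => rw [pow_succ', pow_succ', AlgEquiv.mul_apply, AlgEquiv.mul_apply, hs, ih]
  have hgen' : ∀ τ : Gal(E/K), τ ∈ Submonoid.powers s := by
    intro τ
    obtain ⟨i, hi⟩ := hgen τ
    refine ⟨i, AlgEquiv.ext fun x => ι.injective ?_⟩
    change ι ((s ^ i) x) = _
    rw [hpow, hi]
  have hn : orderOf s = n := by
    refine Nat.dvd_right_iff_eq.1 fun i => ?_
    rw [orderOf_dvd_iff_pow_eq_one, ← hord]
    constructor
    · intro h x
      rw [← hpow, h]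
      rfl
    · intro h
      refine AlgEquiv.ext fun x => ι.injective ?_
      rw [hpow, h]
      rfl
  refine ⟨?_, fun x => ?_⟩
  · rw [← IsGalois.card_aut_eq_finrank K E, ← hn, orderOf_eq_card_of_forall_mem_powers hgen']
  rw [Algebra.norm_eq_prod_automorphisms, map_prod, nrm]
  symm
  refine Finset.prod_nbij (fun i => s ^ i) (fun _ _ => Finset.mem_univ _) ?_ ?_ fun i _ =>
    (hpow i x).symm
  · intro i hi j hj hij
    rw [Finset.coe_range, ← hn] at hi hj
    exact pow_injOn_Iio_orderOf hi hj hij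
  · rintro τ -
    obtain ⟨i, rfl⟩ := hgen' τ
    refine ⟨i % n, ?_, ?_⟩
    · rw [Finset.coe_range]
      exact Nat.mod_lt _ (hn ▸ orderOf_pos s)
    · change s ^ (i % n) = s ^ i
      rw [← hn, pow_mod_orderOf]

end Norm

open CyclicSetting

/-! ### The norm groups in terms of `nrm`. -/

section Groups

variable {p : ℕ} {A F Ω : Type*} [CommRing A] [IsDomain A] [IsDiscreteValuationRing A]
  [Field F] [Algebra A F] [IsFractionRing A F] [Field Ω] [Algebra F Ω] [Algebra A Ω]
  [IsScalarTower A F Ω] [IsGalois F Ω] {v : Valuation Ω ℝ≥0} (hv : IsExtendedValuation A F v)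
  {L : IntermediateField F Ω} [FiniteDimensional F L] [IsGalois F L]
  {σ : Gal(Ω/F)} {n : ℕ} {π : L} (S : CompleteSetting v L (maxAbUnram p A F Ω) σ n π)

lemma mem_tildeExt {x : Ω} : x ∈ tildeExt p A L ↔ x ∈ L ⊔ maxAbUnram p A F Ω :=
  IntermediateField.mem_extendScalars _

lemma normal_tildeExt : Normal (maxAbUnram p A F Ω) (tildeExt p A L) := by
  rw [IntermediateField.normal_iff_forall_map_le']
  rintro g _ ⟨x, hx, rfl⟩
  have hx' : x ∈ L ⊔ maxAbUnram p A F Ω := mem_tildeExt.1 hx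
  exact mem_tildeExt.2 (apply_mem_of_normal (L ⊔ maxAbUnram p A F Ω) (g.restrictScalars F) hx')

/-- A primitive element of $L/F$ generates $L\tilde F$ over $\tilde F$. -/
lemma finiteDimensional_tildeExt : FiniteDimensional (maxAbUnram p A F Ω) (tildeExt p A L) := by
  obtain ⟨α, hα⟩ := Field.exists_primitive_element F L
  let E : IntermediateField (maxAbUnram p A F Ω) Ω :=
    IntermediateField.adjoin (maxAbUnram p A F Ω) {(α : Ω)}
  have hE : FiniteDimensional (maxAbUnram p A F Ω) E :=
    IntermediateField.adjoin.finiteDimensional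
      ((Algebra.IsIntegral.isIntegral (R := F) (α : Ω)).tower_top)
  have hLE : L ≤ E.restrictScalars F := by
    have h1 : L = (IntermediateField.adjoin F {α}).map L.val := by
      rw [hα, ← AlgHom.fieldRange_eq_map, IntermediateField.fieldRange_val]
    rw [h1, IntermediateField.adjoin_map, IntermediateField.adjoin_le_iff, Set.image_singleton,
      Set.singleton_subset_iff]
    exact IntermediateField.mem_adjoin_simple_self (maxAbUnram p A F Ω) (α : Ω)
  have hTE : maxAbUnram p A F Ω ≤ E.restrictScalars F := fun x hx =>
    E.algebraMap_mem ⟨x, hx⟩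
  have hle : tildeExt p A L ≤ E := fun x hx => sup_le hLE hTE (mem_tildeExt.1 hx)
  exact FiniteDimensional.of_injective (IntermediateField.inclusion hle).toLinearMap
    (IntermediateField.inclusion_injective hle)

include S in
lemma norm_L (x : L) : algebraMap F Ω (Algebra.norm F x) = nrm σ n (x : Ω) := by
  refine (norm_eq_nrm (algebraMap L Ω) (s := AlgEquiv.restrictNormalHom L σ)
    (fun x => coe_restrictNormalHom L σ x) S.exists_pow_eq fun i => ?_).2 x
  rw [← S.pow_eq]
  exact ⟨fun h x hx => h ⟨x, hx⟩, fun h x => h x x.2⟩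

include S in
lemma norm_tildeExt (x : tildeExt p A L) :
    algebraMap (maxAbUnram p A F Ω) Ω (Algebra.norm (maxAbUnram p A F Ω) x) =
      nrm σ n (x : Ω) := by
  have := normal_tildeExt (p := p) (A := A) (L := L)
  have := finiteDimensional_tildeExt (p := p) (A := A) (L := L)
  have : IsGalois (maxAbUnram p A F Ω) (tildeExt p A L) := ⟨⟩
  let σT : Gal(Ω/maxAbUnram p A F Ω) := (maxAbUnram p A F Ω).fixingSubgroupEquiv
    ⟨σ, (IntermediateField.mem_fixingSubgroup_iff _ _).2 S.apply_T⟩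
  refine (norm_eq_nrm (F := F) (σ := σ) (algebraMap (tildeExt p A L) Ω)
    (s := AlgEquiv.restrictNormalHom (tildeExt p A L) σT)
    (fun x => coe_restrictNormalHom (tildeExt p A L) σT x) (fun τ => ?_) fun i => ?_).2 x
  · obtain ⟨g, rfl⟩ := AlgEquiv.restrictNormalHom_surjective
      (F := maxAbUnram p A F Ω) (K₁ := tildeExt p A L) Ω τ
    obtain ⟨i, hi⟩ := S.exists_pow (g.restrictScalars F)
    refine ⟨i, fun x => (coe_restrictNormalHom (tildeExt p A L) g x).trans ?_⟩
    refine eqOn_sup (g := g.restrictScalars F) hi (fun y hy => ?_) (mem_tildeExt.1 x.2)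
    rw [S.pow_apply_T i hy]
    exact g.commutes ⟨y, hy⟩
  · rw [← S.pow_eq]
    constructor
    · intro h y hy
      exact h ⟨y, mem_tildeExt.2 ((le_sup_left : L ≤ L ⊔ maxAbUnram p A F Ω) hy)⟩
    · intro h y
      exact eqOn_sup (g' := 1) h (fun z hz => S.pow_apply_T i hz) (mem_tildeExt.1 y.2)

include S in
lemma nrm_sub_one_lt {η : Ω} (hη1 : v (η - 1) < 1) : v (nrm σ n η - 1) < 1 :=
  Finset.prod_induction _ (fun x => v (x - 1) < 1) (fun _ _ => mul_sub_one_lt) (by simp)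
    fun i _ => S.apply_sub_one (σ ^ i) hη1

include hv S in
lemma mem_normUnits_iff {y : Fˣ} : y ∈ normUnits A L ↔
    ∃ w ∈ L, v w = 1 ∧ algebraMap F Ω y = nrm σ n w := by
  constructor
  · rintro ⟨w, hw, rfl⟩
    exact ⟨(w : L), (w : L).2, (hv.mem_unitGroup_iff w).1 hw, norm_L S w⟩
  · rintro ⟨w, hw, hw1, hy⟩
    have hw0 : (⟨w, hw⟩ : L) ≠ 0 := fun h => by
      rw [show w = 0 from congrArg Subtype.val h, map_zero] at hw1
      exact zero_ne_one hw1
    refine ⟨Units.mk0 ⟨w, hw⟩ hw0, (hv.mem_unitGroup_iff _).2 hw1, Units.ext ?_⟩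
    refine (algebraMap F Ω).injective (Eq.trans ?_ hy.symm)
    exact norm_L S ⟨w, hw⟩

include hv S in
lemma mem_normPrincipalUnits_iff {y : Fˣ} : y ∈ normPrincipalUnits A L ↔
    ∃ w ∈ L, v (w - 1) < 1 ∧ algebraMap F Ω y = nrm σ n w := by
  constructor
  · rintro ⟨w, hw, rfl⟩
    exact ⟨(w : L), (w : L).2, (hv.mem_principalUnits_iff w).1 hw, norm_L S w⟩
  · rintro ⟨w, hw, hw1, hy⟩
    have hw0 : (⟨w, hw⟩ : L) ≠ 0 := fun h =>
      ne_zero_of_sub_one_lt hw1 (congrArg Subtype.val h)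
    refine ⟨Units.mk0 ⟨w, hw⟩ hw0, (hv.mem_principalUnits_iff _).2 hw1, Units.ext ?_⟩
    refine (algebraMap F Ω).injective (Eq.trans ?_ hy.symm)
    exact norm_L S ⟨w, hw⟩

-- Membership in $U_{1,F}$ is automatic, as the norm of a principal unit is principal.
include hv S in
lemma mem_tildeNorms_iff {y : Fˣ} : y ∈ tildeNorms p A L ↔
    ∃ η ∈ L ⊔ maxAbUnram p A F Ω, v (η - 1) < 1 ∧ algebraMap F Ω y = nrm σ n η := by
  constructor
  · rintro ⟨-, ⟨w, hw, h⟩⟩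
    refine ⟨((w : tildeExt p A L) : Ω), mem_tildeExt.1 (w : tildeExt p A L).2,
      (hv.mem_principalUnits_iff w).1 hw, ?_⟩
    rw [← norm_tildeExt S]
    have := congrArg (fun u : (maxAbUnram p A F Ω)ˣ => algebraMap (maxAbUnram p A F Ω) Ω u) h
    exact this.symm
  · rintro ⟨η, hη, hη1, hy⟩
    have hη0 : (⟨η, mem_tildeExt.2 hη⟩ : tildeExt p A L) ≠ 0 := fun h =>
      ne_zero_of_sub_one_lt hη1 (congrArg Subtype.val h)
    refine ⟨(hv.mem_principalUnits_iff y).2 (hy ▸ nrm_sub_one_lt S hη1), ?_⟩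
    refine ⟨Units.mk0 ⟨η, mem_tildeExt.2 hη⟩ hη0, (hv.mem_principalUnits_iff _).2 hη1,
      Units.ext ?_⟩
    refine (algebraMap (maxAbUnram p A F Ω) Ω).injective (Eq.trans ?_ hy.symm)
    exact norm_tildeExt S ⟨η, mem_tildeExt.2 hη⟩

-- Write $w=a w_1$ with $a\in A$ and $w_1$ principal. Then $N w=a^n N w_1$, and $a^n\equiv1$ with
-- $n$ a power of $p$ forces $a\equiv1$. So congruence modulo $N_{L/F}U_L$ pins down a class modulo
-- $N_{L/F}U_{1,L}$.
include hv S in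
lemma mem_normPrincipalUnits_of_mem_normUnits [Fact p.Prime] [CharP (ResidueField A) p]
    (hp : IsPGroup p Gal(L/F)) (hn : Module.finrank F L = n) {y : Fˣ}
    (hy : y ∈ normUnits A L) (hy1 : v (algebraMap F Ω y - 1) < 1) :
    y ∈ normPrincipalUnits A L := by
  obtain ⟨w, hw, hw1, hyw⟩ := (mem_normUnits_iff hv S).1 hy
  obtain ⟨c, hc⟩ := S.residue_L w hw hw1.le
  have hvc : v (algebraMap F Ω c) = 1 := by
    rw [← hw1]
    refine Valuation.map_eq_of_sub_lt v ?_
    rwa [Valuation.map_sub_swap, hw1]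
  obtain ⟨a, rfl⟩ := hv.exists_algebraMap_of_le_one hvc.le
  rw [← IsScalarTower.algebraMap_apply A F Ω] at hc hvc
  have ha0 : algebraMap A Ω a ≠ 0 := fun h => by
    rw [h, map_zero] at hvc
    exact zero_ne_one hvc
  have hwa : v (w / algebraMap A Ω a - 1) < 1 := by
    rwa [div_sub_one ha0, map_div₀, hvc, div_one]
  have hna : nrm σ n (algebraMap A Ω a) = algebraMap A Ω a ^ n := by
    rw [nrm, Finset.prod_congr rfl fun i _ => show (σ ^ i) (algebraMap A Ω a) = algebraMap A Ω a by
      rw [IsScalarTower.algebraMap_apply A F Ω, AlgEquiv.commutes], Finset.prod_const,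
      Finset.card_range]
  have h1 := nrm_sub_one_lt S hwa
  rw [nrm_div, ← hyw, hna] at h1
  have h2 := div_sub_one_lt hy1 h1
  rw [div_div_cancel₀ (by simp)] at h2
  obtain ⟨m, hm⟩ := IsPGroup.iff_card.1 hp
  rw [IsGalois.card_aut_eq_finrank, hn] at hm
  rw [hm] at h2
  have h3 := mul_sub_one_lt hwa (algebraMap_sub_one_lt p hv h2)
  rw [div_mul_cancel₀ _ ha0] at h3
  exact (mem_normPrincipalUnits_iff hv S).2 ⟨w, hw, h3, hyw⟩

end Groups

/-! ### The fields $\Sigma_\chi$ and the levels of characters. -/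

section Twisted

variable {p : ℕ} {A F Ω : Type*} [CommRing A] [IsDomain A] [IsDiscreteValuationRing A]
  [Field F] [Algebra A F] [IsFractionRing A F] [Field Ω] [Algebra F Ω] [Algebra A Ω]
  [IsScalarTower A F Ω] [IsGalois F Ω] {v : Valuation Ω ℝ≥0} (hv : IsExtendedValuation A F v)
  {L : IntermediateField F Ω} [FiniteDimensional F L] [IsGalois F L]
  {σ : Gal(Ω/F)} {n : ℕ} {π : L} (S : CompleteSetting v L (maxAbUnram p A F Ω) σ n π)
  (χ : GalTilde p A L)

lemma mem_twistedGroup {g : Gal(Ω/F)} : g ∈ twistedGroup χ ↔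
    χ (AlgEquiv.restrictNormalHom (maxAbUnram p A F Ω) g) = AlgEquiv.restrictNormalHom L g :=
  Iff.rfl

/-- Automorphisms trivial on $L\tilde F$ belong to the twisted group, so lying in $L\tilde F$ is
automatic. -/
lemma mem_twistedField {x : Ω} : x ∈ twistedField χ ↔ ∀ g ∈ twistedGroup χ, g x = x := by
  rw [twistedField, IntermediateField.mem_inf, IntermediateField.mem_fixedField_iff,
    and_iff_right_iff_imp]
  intro h
  refine mem_of_fixed fun g hg => h g ?_
  rw [IntermediateField.fixingSubgroup_sup, Subgroup.mem_inf] at hg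
  rw [mem_twistedGroup, mem_fixingSubgroup_iff_restrictNormalHom.1 hg.1,
    mem_fixingSubgroup_iff_restrictNormalHom.1 hg.2, map_one]

lemma twistedField_eq : twistedField χ = IntermediateField.fixedField (twistedGroup χ) := by
  ext x
  rw [mem_twistedField, IntermediateField.mem_fixedField_iff]

/-- It is the equalizer of two continuous maps to a discrete group. Hence $\Sigma_\chi/F$ is finite
and its fixing group is exactly the twisted group. -/
lemma isOpen_twistedGroup : IsOpen (twistedGroup χ : Set Gal(Ω/F)) := by
  have := krullTopology_discreteTopology_of_finiteDimensional F L
  have h1 : Continuous fun g : Gal(Ω/F) =>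
      (χ (AlgEquiv.restrictNormalHom (maxAbUnram p A F Ω) g), AlgEquiv.restrictNormalHom L g) :=
    (χ.continuous_toFun.comp (InfiniteGalois.restrictNormalHom_continuous _)).prodMk
      (InfiniteGalois.restrictNormalHom_continuous L)
  exact (isOpen_discrete (Set.diagonal Gal(L/F))).preimage h1

lemma fixingSubgroup_twistedField : (twistedField χ).fixingSubgroup = twistedGroup χ := by
  rw [twistedField_eq]
  exact InfiniteGalois.fixingSubgroup_fixedField
    ⟨twistedGroup χ, Subgroup.isClosed_of_isOpen _ (isOpen_twistedGroup χ)⟩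

lemma finiteDimensional_twistedField : FiniteDimensional F (twistedField χ) := by
  rw [← InfiniteGalois.isOpen_iff_finite, fixingSubgroup_twistedField]
  exact isOpen_twistedGroup χ

lemma isGalois_twistedField [IsMulCommutative Gal(L/F)] : IsGalois F (twistedField χ) := by
  rw [← InfiniteGalois.normal_iff_isGalois, fixingSubgroup_twistedField]
  refine ⟨fun g hg k => ?_⟩
  rw [mem_twistedGroup] at hg ⊢
  simp only [map_mul, map_inv, hg]
  rw [mul_comm' (χ _) _, mul_inv_cancel_right, mul_comm' (AlgEquiv.restrictNormalHom L k) _,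
    mul_inv_cancel_right]

-- If $\sigma^i$ restricts to $\chi(g)^{-1}g$ on $L$, then commutativity puts $\sigma^{-i}g$ in the
-- twisted group, so $g=\sigma^i$ on $\Sigma_\chi$. Also $\sigma^i$ is trivial on $\Sigma_\chi$
-- exactly when it is on $L$. Norms from $\Sigma_\chi$ and from $L$ are therefore the same product.
include S in
lemma norm_twistedField [IsMulCommutative Gal(L/F)] : Module.finrank F (twistedField χ) = n ∧
    ∀ x : twistedField χ, algebraMap F Ω (Algebra.norm F x) = nrm σ n (x : Ω) := by
  have := finiteDimensional_twistedField χ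
  have := isGalois_twistedField χ
  have hσT : ∀ i : ℕ, AlgEquiv.restrictNormalHom (maxAbUnram p A F Ω) (σ ^ i) = 1 := fun i => by
    rw [← mem_fixingSubgroup_iff_restrictNormalHom, IntermediateField.mem_fixingSubgroup_iff]
    exact fun x hx => S.pow_apply_T i hx
  refine norm_eq_nrm (algebraMap (twistedField χ) Ω)
    (s := AlgEquiv.restrictNormalHom (twistedField χ) σ)
    (fun x => coe_restrictNormalHom (twistedField χ) σ x) (fun τ => ?_) fun i => ?_
  · obtain ⟨g, rfl⟩ := AlgEquiv.restrictNormalHom_surjective (F := F) (K₁ := twistedField χ) Ω τ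
    obtain ⟨i, hi⟩ := S.exists_pow_eq
      ((χ (AlgEquiv.restrictNormalHom (maxAbUnram p A F Ω) g))⁻¹ * AlgEquiv.restrictNormalHom L g)
    have hi' : AlgEquiv.restrictNormalHom L (σ ^ i) =
        (χ (AlgEquiv.restrictNormalHom (maxAbUnram p A F Ω) g))⁻¹ *
          AlgEquiv.restrictNormalHom L g := by
      ext x
      rw [coe_restrictNormalHom, hi]
    refine ⟨i, fun x => (coe_restrictNormalHom (twistedField χ) g x).trans ?_⟩
    have hmem : (σ ^ i)⁻¹ * g ∈ twistedGroup χ := by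
      rw [mem_twistedGroup, map_mul, map_inv, hσT, inv_one, one_mul, map_mul, map_inv, hi',
        mul_inv_rev, inv_inv, mul_assoc,
        mul_comm' (χ (AlgEquiv.restrictNormalHom (maxAbUnram p A F Ω) g)) _,
        inv_mul_cancel_left]
    have := (mem_twistedField χ).1 x.2 _ hmem
    rw [AlgEquiv.mul_apply] at this
    exact (AlgEquiv.symm_apply_eq (σ ^ i)).1 this
  · rw [← S.pow_eq]
    have h1 : (∀ x : twistedField χ, (σ ^ i) (algebraMap (twistedField χ) Ω x) =
        algebraMap (twistedField χ) Ω x) ↔ σ ^ i ∈ (twistedField χ).fixingSubgroup := by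
      rw [IntermediateField.mem_fixingSubgroup_iff]
      exact ⟨fun h x hx => h ⟨x, hx⟩, fun h x => h x x.2⟩
    rw [h1, fixingSubgroup_twistedField, mem_twistedGroup, hσT, map_one,
      ← IntermediateField.mem_fixingSubgroup_iff, mem_fixingSubgroup_iff_restrictNormalHom, eq_comm]

include hv in
/-- A continuous character of `Gal(F̃/F)` factors through a finite level. -/
lemma exists_level_character : ∃ M ≤ maxAbUnram p A F Ω, FiniteDimensional F M ∧ Normal F M ∧
    TrivialInertia v M ∧ ∀ g ∈ M.fixingSubgroup,
      χ (AlgEquiv.restrictNormalHom (maxAbUnram p A F Ω) g) = 1 := by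
  classical
  have := krullTopology_discreteTopology_of_finiteDimensional F L
  have hker : χ ⁻¹' {1} ∈ nhds (1 : Gal(maxAbUnram p A F Ω/F)) :=
    ((isOpen_discrete {(1 : Gal(L/F))}).preimage χ.continuous_toFun).mem_nhds (map_one χ)
  obtain ⟨E, hE, hEχ⟩ := (krullTopology_mem_nhds_one_iff _ _ _).1 hker
  let b := Module.finBasis F E
  -- The kernel contains the fixing group of a finite $E$; a level containing a basis of $E$
  -- contains $E$.
  obtain ⟨M, hMT, hMf, hMn, hM, hMs⟩ := exists_level_sup p hv (⊥ : IntermediateField F Ω)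
    (Finset.univ.image fun i => ((b i : maxAbUnram p A F Ω) : Ω)) (by
      intro x hx
      obtain ⟨i, -, rfl⟩ := Finset.mem_image.1 hx
      rw [bot_sup_eq]
      exact (b i : maxAbUnram p A F Ω).2)
  refine ⟨M, hMT, hMf, hMn, hM, fun g hg => hEχ ?_⟩
  have hbM : ∀ i, ((b i : maxAbUnram p A F Ω) : Ω) ∈ M := fun i => by
    have := hMs _ (Finset.mem_image_of_mem _ (Finset.mem_univ i))
    rwa [bot_sup_eq] at this
  rw [SetLike.mem_coe, IntermediateField.mem_fixingSubgroup_iff]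
  intro x hx
  refine Subtype.ext ?_
  rw [coe_restrictNormalHom]
  refine (IntermediateField.mem_fixingSubgroup_iff _ _).1 hg _ ?_
  have hx' : x = ((∑ i, b.repr ⟨x, hx⟩ i • b i : E) : maxAbUnram p A F Ω) := by
    rw [b.sum_repr]
  rw [hx', AddSubmonoidClass.coe_finsetSum, AddSubmonoidClass.coe_finsetSum]
  exact sum_mem fun i _ => M.smul_mem (hbM i)

/-- A character of `Gal(F̃/F)` which factors through a finite level is continuous. -/
lemma continuous_of_level (c : Gal(maxAbUnram p A F Ω/F) →* Gal(L/F))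
    {M : IntermediateField F Ω} (hMT : M ≤ maxAbUnram p A F Ω) [FiniteDimensional F M]
    (h : ∀ g ∈ M.fixingSubgroup, c (AlgEquiv.restrictNormalHom (maxAbUnram p A F Ω) g) = 1) :
    Continuous c := by
  have := krullTopology_discreteTopology_of_finiteDimensional F L
  refine continuous_of_continuousAt_one c ?_
  rw [ContinuousAt, map_one, nhds_discrete Gal(L/F), Filter.tendsto_pure]
  refine (krullTopology_mem_nhds_one_iff _ _ _).2 ⟨IntermediateField.restrict hMT,
    (IntermediateField.restrictAlgEquiv hMT).toLinearEquiv.finiteDimensional, ?_⟩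
  intro φ hφ
  obtain ⟨g, rfl⟩ := AlgEquiv.restrictNormalHom_surjective (F := F)
    (K₁ := maxAbUnram p A F Ω) Ω φ
  refine h g ((IntermediateField.mem_fixingSubgroup_iff _ _).2 fun x hx => ?_)
  rw [SetLike.mem_coe, IntermediateField.mem_fixingSubgroup_iff] at hφ
  have := hφ ⟨x, hMT hx⟩ ((IntermediateField.mem_restrict hMT _).2 hx)
  rw [← coe_restrictNormalHom (maxAbUnram p A F Ω) g ⟨x, hMT hx⟩, this]

end Twisted

/-! ### The class of the reciprocity map at a character. -/

section Reciprocity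

variable {p : ℕ} {A F Ω : Type*} [CommRing A] [IsDomain A] [IsDiscreteValuationRing A]
  [Field F] [Algebra A F] [IsFractionRing A F] [Field Ω] [Algebra F Ω] [Algebra A Ω]
  [IsScalarTower A F Ω] [IsGalois F Ω] {v : Valuation Ω ℝ≥0} (hv : IsExtendedValuation A F v)
  {L : IntermediateField F Ω} [FiniteDimensional F L] [IsGalois F L]
  {σ : Gal(Ω/F)} {n : ℕ} {π : L} (S : CompleteSetting v L (maxAbUnram p A F Ω) σ n π)

include hv S

lemma isPrimeElement_L_iff (πL : Lˣ) : IsPrimeElement A L πL ↔ v ((πL : L) : Ω) = v (π : Ω) :=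
  hv.isPrimeElement_iff (E := L) S.pos S.lt_one
    (fun x hx => S.value x ((le_sup_left : L ≤ L ⊔ maxAbUnram p A F Ω) x.2) (by simpa using hx))
    ⟨π, rfl⟩ πL

lemma isPrimeElement_twisted_iff {χ : GalTilde p A L} {η : Ω} (hη1 : v (η - 1) < 1)
    (hη : (π : Ω) * η ∈ twistedField χ) (πχ : (twistedField χ)ˣ) :
    IsPrimeElement A (twistedField χ) πχ ↔ v ((πχ : twistedField χ) : Ω) = v (π : Ω) :=
  hv.isPrimeElement_iff (E := twistedField χ) S.pos S.lt_one
    (fun x hx => S.value x ((inf_le_left : twistedField χ ≤ L ⊔ maxAbUnram p A F Ω) x.2)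
      (by simpa using hx))
    ⟨⟨(π : Ω) * η, hη⟩, by
      change v ((π : Ω) * η) = _
      rw [map_mul, map_eq_one_of_sub_one_lt hη1, mul_one]⟩ πχ

/-- For every character `χ` there are a principal unit `η` associated with `χ` and a prime element
`π η` of the twisted field. -/
lemma exists_prime_twistedField (χ : GalTilde p A L) :
    ∃ η ∈ L ⊔ maxAbUnram p A F Ω, v (η - 1) < 1 ∧ (π : Ω) * η ∈ twistedField χ ∧
      IsAssociated v σ π χ.toMonoidHom η := by
  obtain ⟨M, hMT, hMf, hMn, hM, hMχ⟩ := exists_level_character hv χ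
  obtain ⟨η, hη, hη1, hfix⟩ := S.exists_twisted_prime χ.toMonoidHom M hMT hM hMχ
  exact ⟨η, hη, hη1, (mem_twistedField χ).2 hfix, S.isAssociated_of_fixed hη hη1 hfix⟩

/-- The norms of units of the twisted field. -/
lemma exists_nrm_eq_of_twisted [IsMulCommutative Gal(L/F)] {ϖ : A} (hϖ : Irreducible ϖ)
    (hπ : v (π : Ω) ^ n = v (algebraMap A Ω ϖ)) {χ : GalTilde p A L} {η z : Ω}
    (hη : η ∈ L ⊔ maxAbUnram p A F Ω) (hη1 : v (η - 1) < 1) (hηχ : (π : Ω) * η ∈ twistedField χ)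
    (hz : z ∈ twistedField χ) (hzv : v z = v (π : Ω)) :
    ∃ w ∈ L, v w = 1 ∧ nrm σ n z = nrm σ n π * nrm σ n η * nrm σ n w := by
  have hπ0 := S.ne_zero
  have hη0 := ne_zero_of_sub_one_lt hη1
  have hz0 : z ≠ 0 := (Valuation.pos_iff v).1 (hzv ▸ S.pos)
  have hvη : v ((π : Ω) * η) = v (π : Ω) := by
    rw [map_mul, map_eq_one_of_sub_one_lt hη1, mul_one]
  have := finiteDimensional_twistedField χ
  have hn := (norm_twistedField S χ).1
  have hε : z / (π * η) ∈ twistedField χ := div_mem hz hηχ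
  have hεv : v (z / (π * η)) = 1 := by rw [map_div₀, hzv, hvη, div_self S.pos.ne']
  -- $\Sigma_\chi$ has degree $n$ and prime element $\pi\eta$, so its residue field is that of $A$.
  -- Thus $z=\pi\eta\,\varepsilon\,a$ with $a\in A$ and $\varepsilon$ a principal unit.
  obtain ⟨a, ha⟩ := hv.ramified_residue hϖ (hvη.symm ▸ hπ) S.n_pos.ne' hn hηχ hε hεv.le
  have hva : v (algebraMap A Ω a) = 1 := by
    rw [← hεv]
    refine Valuation.map_eq_of_sub_lt v ?_
    rwa [Valuation.map_sub_swap, hεv]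
  have ha0 : algebraMap A Ω a ≠ 0 := fun h => by
    rw [h, map_zero] at hva
    exact zero_ne_one hva
  have haF : ∀ K : IntermediateField F Ω, algebraMap A Ω a ∈ K := fun K => by
    rw [IsScalarTower.algebraMap_apply A F Ω]
    exact K.algebraMap_mem _
  set ε := z / (π * η) / algebraMap A Ω a with hεdef
  have hε1 : v (ε - 1) < 1 := by
    rwa [hεdef, div_sub_one ha0, map_div₀, hva, div_one]
  have hεχ : ε ∈ twistedField χ := div_mem hε (haF _)
  have hεm : ε ∈ L ⊔ maxAbUnram p A F Ω :=
    (inf_le_left : twistedField χ ≤ L ⊔ maxAbUnram p A F Ω) hεχ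
  have hηε : (π : Ω) * (η * ε) ∈ twistedField χ := by
    rw [← mul_assoc]
    exact mul_mem hηχ hεχ
  -- $\pi\eta$ and $\pi\eta\varepsilon$ both lie in $\Sigma_\chi$, so $\eta$ and $\eta\varepsilon$
  -- are associated with the same character.
  obtain ⟨w, hw, hw1, hN⟩ := S.exists_nrm_eq_mul
    (S.isAssociated_of_fixed (χ := χ.toMonoidHom) (mul_mem hη hεm) (mul_sub_one_lt hη1 hε1)
      ((mem_twistedField χ).1 hηε))
    (S.isAssociated_of_fixed (χ := χ.toMonoidHom) hη hη1 ((mem_twistedField χ).1 hηχ))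
    (mul_mem hη hεm) (mul_sub_one_lt hη1 hε1) hη hη1
  refine ⟨w * algebraMap A Ω a, mul_mem hw (haF L), ?_, ?_⟩
  · rw [map_mul, hva, map_eq_one_of_sub_one_lt hw1, one_mul]
  · have hz' : z = π * (η * ε) * algebraMap A Ω a := by
      rw [hεdef]
      field_simp
    rw [hz', nrm_mul, nrm_mul, hN, nrm_mul]
    ring

/-- The class of the reciprocity map at a character. -/
lemma exists_reciprocity_class [IsMulCommutative Gal(L/F)] {ϖ : A} (hϖ : Irreducible ϖ)
    (hπ : v (π : Ω) ^ n = v (algebraMap A Ω ϖ)) (χ : GalTilde p A L) :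
    ∃ (y : tildeNorms p A L) (η : Ω), η ∈ L ⊔ maxAbUnram p A F Ω ∧ v (η - 1) < 1 ∧
      IsAssociated v σ π χ.toMonoidHom η ∧ algebraMap F Ω (y : Fˣ) = nrm σ n η ∧
      (∃ πχ, IsPrimeElement A (twistedField χ) πχ) ∧
      ∀ (πχ : (twistedField χ)ˣ) (πL : Lˣ), IsPrimeElement A (twistedField χ) πχ →
        IsPrimeElement A L πL → Units.map (Algebra.norm F : twistedField χ →* F) πχ /
          Units.map (Algebra.norm F : L →* F) πL / (y : Fˣ) ∈ normUnits A L := by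
  obtain ⟨η, hη, hη1, hηχ, has⟩ := exists_prime_twistedField hv S χ
  have hπ0 := S.ne_zero
  have hη0 := ne_zero_of_sub_one_lt hη1
  have hN := (norm_twistedField S χ).2
  have hz0 : (⟨π * η, hηχ⟩ : twistedField χ) ≠ 0 := fun h =>
    mul_ne_zero hπ0 hη0 (congrArg Subtype.val h)
  have hπL0 : π ≠ 0 := fun h => hπ0 (by rw [h]; rfl)
  let z : (twistedField χ)ˣ := Units.mk0 ⟨π * η, hηχ⟩ hz0
  -- For the prime elements $\pi\eta$ and $\pi$ the quotient of norms is exactly $N\eta$.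
  let y : Fˣ := Units.map (Algebra.norm F : twistedField χ →* F) z /
    Units.map (Algebra.norm F : L →* F) (Units.mk0 π hπL0)
  have hy : algebraMap F Ω y = nrm σ n η := by
    have h1 : algebraMap F Ω y = algebraMap F Ω (Algebra.norm F (⟨π * η, hηχ⟩ : twistedField χ)) /
        algebraMap F Ω (Algebra.norm F π) := by
      rw [← map_div₀, Units.val_div_eq_div_val]
      rfl
    rw [h1, hN, norm_L S, nrm_mul, mul_div_cancel_left₀ _ (S.nrm_ne_zero hπ0)]
  refine ⟨⟨y, (mem_tildeNorms_iff hv S).2 ⟨η, hη, hη1, hy⟩⟩, η, hη, hη1, has, hy, ⟨z, ?_⟩,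
    fun πχ πL hχ hL => ?_⟩
  · rw [isPrimeElement_twisted_iff hv S hη1 hηχ]
    change v ((π : Ω) * η) = _
    rw [map_mul, map_eq_one_of_sub_one_lt hη1, mul_one]
  · rw [isPrimeElement_twisted_iff hv S hη1 hηχ] at hχ
    rw [isPrimeElement_L_iff hv S] at hL
    obtain ⟨w, hw, hw1, hNw⟩ := exists_nrm_eq_of_twisted hv S hϖ hπ hη hη1 hηχ
      (πχ : twistedField χ).2 hχ
    have hπL' : ((πL : L) : Ω) ≠ 0 := (Valuation.pos_iff v).1 (hL ▸ S.pos)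
    rw [mem_normUnits_iff hv S]
    -- The factor $\pi/\pi_L$ accounts for the change of prime element in $L$.
    refine ⟨w * (π / (πL : L)), mul_mem hw (div_mem π.2 (πL : L).2), ?_, ?_⟩
    · rw [map_mul, map_div₀, hL, div_self S.pos.ne', hw1, one_mul]
    · have h1 : algebraMap F Ω ((Units.map (Algebra.norm F : twistedField χ →* F) πχ /
          Units.map (Algebra.norm F : L →* F) πL / y : Fˣ) : F) =
          algebraMap F Ω (Algebra.norm F (πχ : twistedField χ)) /
            algebraMap F Ω (Algebra.norm F (πL : L)) / algebraMap F Ω y := by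
        rw [← map_div₀, ← map_div₀, Units.val_div_eq_div_val, Units.val_div_eq_div_val]
        rfl
      refine h1.trans ?_
      have := S.nrm_ne_zero hη0
      have := S.nrm_ne_zero hπL'
      rw [hN, norm_L S, hy, hNw, nrm_mul, nrm_div]
      field_simp

/-- Every element of `U₁ ∩ N U₁(L̃)` is the norm of a unit associated with a continuous
character. -/
lemma exists_character {y : Fˣ} (hy : y ∈ tildeNorms p A L) :
    ∃ (χ : GalTilde p A L) (η : Ω), η ∈ L ⊔ maxAbUnram p A F Ω ∧ v (η - 1) < 1 ∧
      IsAssociated v σ π χ.toMonoidHom η ∧ algebraMap F Ω y = nrm σ n η := by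
  obtain ⟨η, hη, hη1, hyη⟩ := (mem_tildeNorms_iff hv S).1 hy
  obtain ⟨c, hc⟩ := S.exists_isAssociated hη hη1 fun g => by rw [← hyη, AlgEquiv.commutes]
  -- Automorphisms trivial on $L$ and on this $M$ fix $\eta$, so the character is trivial on them
  -- and therefore continuous.
  obtain ⟨M, hMT, hMf, hMn, hM, hηM⟩ := S.exists_level {η} (by simpa using hη)
  have hcont : Continuous c := by
    refine continuous_of_level c hMT fun g hg => ?_
    obtain ⟨h, hL, hT⟩ := S.exists_lift g
    have he : AlgEquiv.restrictNormalHom (maxAbUnram p A F Ω) h =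
        AlgEquiv.restrictNormalHom (maxAbUnram p A F Ω) g := restrictNormalHom_eq_iff.2 hT
    rw [← he]
    refine CyclicSetting.IsAssociated.apply_eq_one S.toCyclicSetting hc
      (ne_zero_of_sub_one_lt hη1) hL ?_
    refine eqOn_sup (g' := 1) ((IntermediateField.mem_fixingSubgroup_iff _ _).1 hL)
      (fun x hx => ?_) (hηM η (Finset.mem_singleton_self η))
    rw [hT x (hMT hx)]
    exact (IntermediateField.mem_fixingSubgroup_iff _ _).1 hg x hx
  exact ⟨⟨c, hcont⟩, η, hη, hη1, hc, hyη⟩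

end Reciprocity

end LocalReciprocity

/-! ### The reciprocity isomorphism. -/

theorem mainTheorem2
    (p : ℕ) [Fact p.Prime]
    (A : Type*) [CommRing A] [IsDomain A] [IsDiscreteValuationRing A]
    [IsAdicComplete (maximalIdeal A) A]
    [CharP (ResidueField A) p]
    (hk : ¬ Function.Surjective (fun a : ResidueField A => a ^ p - a))
    (F : Type*) [Field F] [Algebra A F] [IsFractionRing A F]
    (Ω : Type*) [Field Ω] [Algebra F Ω] [IsSepClosure F Ω]
    [Algebra A Ω] [IsScalarTower A F Ω]
    (L : IntermediateField F Ω) [FiniteDimensional F L] [IsGalois F L]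
    [IsCyclic Gal(L/F)] (hp : IsPGroup p Gal(L/F))
    (hL : IsTotallyRamified A F L) :
    ∃ Υ : GalTilde p A L ≃* TildeNormQuotient p A L,
      ∀ ρ : GalTilde p A L → TildeNormQuotient p A L, IsReciprocityMap ρ ↔ ρ = Υ := by
  obtain ⟨v, hv⟩ := exists_isExtendedValuation A F Ω
  obtain ⟨ϖ, hϖ⟩ := IsDiscreteValuationRing.exists_irreducible A
  obtain ⟨σ, π, hπ, S⟩ := exists_completeSetting p hv L hp hL hϖ
  choose y η hη hη1 has hy hprime hrec using exists_reciprocity_class hv S hϖ hπ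
  have hy1 : ∀ z : tildeNorms p A L, v (algebraMap F Ω (z : Fˣ) - 1) < 1 := fun z =>
    (hv.mem_principalUnits_iff _).1 z.2.1
  have hη0 := fun χ => ne_zero_of_sub_one_lt (hη1 χ)
  -- two classes agree if the norms of the associated units agree up to norms from `L`
  have hclass : ∀ (a b : tildeNorms p A L), ((a : TildeNormQuotient p A L) = b) ↔
      ∃ w ∈ L, v (w - 1) < 1 ∧ algebraMap F Ω (b : Fˣ) =
        algebraMap F Ω (a : Fˣ) * CyclicSetting.nrm σ (Module.finrank F L) w := by
    intro a b
    rw [QuotientGroup.eq, Subgroup.mem_subgroupOf, mem_normPrincipalUnits_iff hv S]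
    refine exists_congr fun w => and_congr_right fun _ => and_congr_right fun _ => ?_
    have ha0 : algebraMap F Ω (a : Fˣ) ≠ 0 := by simp
    rw [Subgroup.coe_mul, Subgroup.coe_inv, Units.val_mul, Units.val_inv_eq_inv_val, map_mul,
      map_inv₀, inv_mul_eq_iff_eq_mul₀ ha0]
  -- The class of $N\theta$ depends only on the character with which $\theta$ is associated;
  -- multiplicativity and surjectivity both reduce to this.
  have hcongr : ∀ (χ : GalTilde p A L) (z : tildeNorms p A L) (θ : Ω),
      θ ∈ L ⊔ maxAbUnram p A F Ω → v (θ - 1) < 1 →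
      CyclicSetting.IsAssociated v σ π χ.toMonoidHom θ →
      algebraMap F Ω (z : Fˣ) = CyclicSetting.nrm σ (Module.finrank F L) θ →
      ((y χ : TildeNormQuotient p A L) = z) := by
    intro χ z θ h1 h2 h3 h4
    rw [hclass, h4, hy]
    exact S.exists_nrm_eq_mul h3 (has χ) h1 h2 (hη χ) (hη1 χ)
  have hmul : ∀ χ χ' : GalTilde p A L, ((y (χ * χ') : TildeNormQuotient p A L)) =
      (y χ : TildeNormQuotient p A L) * y χ' := by
    intro χ χ'
    refine hcongr (χ * χ') (y χ * y χ') (η χ * η χ') (mul_mem (hη χ) (hη χ'))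
      (mul_sub_one_lt (hη1 χ) (hη1 χ')) ?_ ?_
    · exact CyclicSetting.IsAssociated.mul S.toCyclicSetting (hη0 χ) (hη0 χ') (has χ) (has χ')
        fun φ => rfl
    · rw [Subgroup.coe_mul, Units.val_mul, map_mul, hy, hy, CyclicSetting.nrm_mul]
  let f : GalTilde p A L →* TildeNormQuotient p A L := MonoidHom.mk' (fun χ => y χ) hmul
  have hinj : Function.Injective f := by
    rw [injective_iff_map_eq_one]
    intro χ hχ
    obtain ⟨w, hw, hw1, hN⟩ := (hclass 1 (y χ)).1 hχ.symm
    rw [Subgroup.coe_one, Units.val_one, map_one, one_mul, hy] at hN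
    refine ContinuousMonoidHom.ext fun φ => ?_
    exact CyclicSetting.IsAssociated.eq_one S.toCyclicSetting (has χ) (hη χ) (hη0 χ) hw
      (ne_zero_of_sub_one_lt hw1) hN φ
  have hsurj : Function.Surjective f := by
    intro c
    obtain ⟨z, rfl⟩ := QuotientGroup.mk_surjective c
    obtain ⟨χ, θ, h1, h2, h3, h4⟩ := exists_character hv S z.2
    exact ⟨χ, hcongr χ z θ h1 h2 h3 h4⟩
  have hf : IsReciprocityMap f := by
    intro χ πχ πL hχ hπL z
    have h1 := hrec χ πχ πL hχ hπL
    set r := Units.map (Algebra.norm F : twistedField χ →* F) πχ /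
      Units.map (Algebra.norm F : L →* F) πL
    have h2 : (z : Fˣ)⁻¹ * y χ = (r / z) / (r / y χ) := by
      rw [div_div_div_cancel_left, div_eq_inv_mul]
    change ((y χ : TildeNormQuotient p A L) = z) ↔ _
    rw [eq_comm, QuotientGroup.eq, Subgroup.mem_subgroupOf, Subgroup.coe_mul, Subgroup.coe_inv, h2]
    constructor
    · intro h
      obtain ⟨w, hw, hw1, hN⟩ := (mem_normPrincipalUnits_iff hv S).1 h
      have h3 : r / z / (r / y χ) ∈ normUnits A L :=
        (mem_normUnits_iff hv S).2 ⟨w, hw, map_eq_one_of_sub_one_lt hw1, hN⟩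
      have := mul_mem h3 h1
      rwa [div_mul_cancel] at this
    -- $z$ and $y_\chi$ are principal units, so a quotient of them in $N_{L/F}U_L$ is already in
    -- $N_{L/F}U_{1,L}$.
    · intro h
      refine mem_normPrincipalUnits_of_mem_normUnits hv S hp rfl (div_mem h h1) ?_
      rw [← h2, Units.val_mul, Units.val_inv_eq_inv_val, map_mul, map_inv₀]
      exact mul_sub_one_lt (inv_sub_one_lt (hy1 z)) (hy1 (y χ))
  refine ⟨MulEquiv.ofBijective f ⟨hinj, hsurj⟩, fun ρ => ⟨fun hρ => funext fun χ => ?_, ?_⟩⟩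
  -- Uniqueness: prime elements of $\Sigma_\chi$ and $L$ exist, and the defining property for one
  -- choice determines the class.
  · have hπ0 : π ≠ 0 := fun h => S.ne_zero (by rw [h]; rfl)
    have hπ' : IsPrimeElement A L (Units.mk0 π hπ0) := (isPrimeElement_L_iff hv S _).2 rfl
    obtain ⟨πχ, hχ⟩ := hprime χ
    exact (hρ χ πχ _ hχ hπ' (y χ)).2 (hrec χ πχ _ hχ hπ')
  · rintro rfl
    exact hf
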